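/- Let $(M,P,N)$ be a Poisson–Nijenhuis manifold: $M$ is a smooth manifold of dimension $n$, $P$ is a Poisson bivector (also regarded as the map $P:T^*M\to TM$, $\alpha\mapsto i_\alpha P$), $N$ is a $(1,1)$-tensor with vanishing Nijenhuis torsion, $NP=P\,{}^tN$, and $$[\alpha,\beta]_{NP}=[{}^tN\alpha,\beta]_P+[\alpha,{}^tN\beta]_P-{}^tN[\alpha,\beta]_P$$ for all 1-forms $\alpha,\beta$, where $[\alpha,\beta]_P=L_{P\alpha}\beta-L_{P\beta}\alpha-d(P(\alpha,\beta))$. Put $P_k=N^kP$ for $k\ge 0$. Let $(TM,N^k)$ denote $TM$ with anchor $N^k$ and bracket $[X,Y]_{N^k}=[N^kX,Y]+[X,N^kY]-N^k[X,Y]$, and let $(T^*M,P_k)$ denote $T^*M$ with anchor $P_k$ and bracket $[\,,\,]_{P_k}$. For a Lie algebroid $A$ over $M$ with anchor $\rho$, the modular class $\mathrm{Mod}(A)\in H^1(A)$ is the class of the section $\xi$ of $A^*$ defined by $\langle\xi,X\rangle\,\eta=L_X\eta$ for all sections $X$ of $A$, where $\eta$ is a smooth nowhere vanishing section of $\bigwedge^{top}A\otimes\bigwedge^{top}T^*M$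 and $L_X(\lambda\otimes\mu)=[X,\lambda]\otimes\mu+\lambda\otimes L_{\rho(X)}\mu$; it does not depend on $\eta$. The modular class of a morphism of Lie algebroids $\Phi:A\to B$ over the identity of $M$ is $\mathrm{Mod}^\Phi=\mathrm{Mod}(A)-\Phi^*\mathrm{Mod}(B)\in H^1(A)$. Sections of the dual of $T^*M$ are identified with vector fields. Let $k\ge 1$. (i) The maps $N^k:(TM,N^k)\to(TM,\mathrm{id})$ and ${}^tN^k:(T^*M,P_k)\to(T^*M,P)$ are morphisms of Lie algebroids, their modular classes are well defined, and $$\mathrm{Mod}^{{}^tN^k}=-P\,\mathrm{Mod}^{N^k},$$ i.e. if a 1-form $\theta$ represents $\mathrm{Mod}^{N^k}$, then the vector field $-P\theta$ represents $\mathrm{Mod}^{{}^tN^k}$. (ii) Let $N^{[k]}:(TM,N^k)\to(TM,N^{k-1})$ be the map $N$ and let ${}^tN^{[k]}:(T^*M,P_k)\to(T^*M,P_{k-1})$ be the map ${}^tN$. These are morphisms of Lie algebroids, their modular classes are well defined, and, in the same sense, $$\mathrm{Mod}^{{}^tN^{[k]}}=-P\,\mathrm{Mod}^{N^{[k]}}.$$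 Moreover, the vector field $-P\,d\,\mathrm{Tr}(N^k/k)$ represents $\mathrm{Mod}^{{}^tN^{[k]}}$, and it is equal to $2X^{(k)}$. Here $X^{(k)}=X^k_\mu-N X^{k-1}_\mu$ for any volume form $\mu$ on $M$, where $X^j_\mu$ is the (unique) modular vector field of $P_j$ with respect to $\mu$, defined by $\langle X^j_\mu,df\rangle\,\mu=L_{P_jdf}\,\mu$ for all $f\in C^\infty(M)$. -/

import Mathlib

open scoped Manifold ContDiff

namespace PNModular

open Bundle

noncomputable section

/-! ### Smooth functions, sections and one-forms on an `n`-dimensional manifold `M` -/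

/-- The model space `ℝⁿ`. -/
abbrev Model (n : ℕ) : Type := EuclideanSpace ℝ (Fin n)

section Smooth

variable (n : ℕ) {M : Type*} [TopologicalSpace M] [ChartedSpace (Model n) M]

/-- Vector fields on `M` (no regularity). -/
abbrev VField (n : ℕ) (M : Type*) [TopologicalSpace M] [ChartedSpace (Model n) M] : Type _ :=
  Π x : M, TangentSpace (𝓡 n) x

/-- One-forms on `M` (no regularity). -/
abbrev OneForm (n : ℕ) (M : Type*) [TopologicalSpace M] [ChartedSpace (Model n) M] : Type _ :=
  Π x : M, TangentSpace (𝓡 n) x →L[ℝ] ℝ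

/-- Fields of endomorphisms of the tangent bundle, i.e. `(1,1)`-tensors (no regularity). -/
abbrev EndField (n : ℕ) (M : Type*) [TopologicalSpace M] [ChartedSpace (Model n) M] : Type _ :=
  Π x : M, TangentSpace (𝓡 n) x →L[ℝ] TangentSpace (𝓡 n) x

/-- Fields of contravariant 2-tensors, seen as maps `T*M → TM` (no regularity). -/
abbrev BiField (n : ℕ) (M : Type*) [TopologicalSpace M] [ChartedSpace (Model n) M] : Type _ :=
  Π x : M, (TangentSpace (𝓡 n) x →L[ℝ] ℝ) →L[ℝ] TangentSpace (𝓡 n) x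

/-- `f ∈ C^∞(M)`. -/
def SmoothFun (f : M → ℝ) : Prop := ContMDiff (𝓡 n) 𝓘(ℝ, ℝ) ∞ f

/-- `s` is a smooth section of the vector bundle `A` with model fibre `F`. -/
def SmoothSection (F : Type*) [NormedAddCommGroup F] [NormedSpace ℝ F] {A : M → Type*}
    [TopologicalSpace (TotalSpace F A)] [∀ x, TopologicalSpace (A x)] [FiberBundle F A]
    (s : Π x, A x) : Prop :=
  ContMDiff (𝓡 n) ((𝓡 n).prod 𝓘(ℝ, F)) ∞ (fun x => TotalSpace.mk' F x (s x))

/-- `X` is a smooth vector field. -/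
abbrev SmoothVField [IsManifold (𝓡 n) ∞ M] (X : VField n M) : Prop := SmoothSection n (Model n) X

/-- `α` is a smooth one-form. -/
abbrev SmoothOneForm [IsManifold (𝓡 n) ∞ M] (α : OneForm n M) : Prop := SmoothSection n (Model n →L[ℝ] ℝ) α

/-- A section of the dual bundle `A*` is smooth iff its values on smooth sections of `A` are. -/
def SmoothDual (F : Type*) [NormedAddCommGroup F] [NormedSpace ℝ F] {A : M → Type*}
    [TopologicalSpace (TotalSpace F A)] [∀ x, TopologicalSpace (A x)]
    [∀ x, AddCommGroup (A x)] [∀ x, Module ℝ (A x)] [FiberBundle F A]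
    (ξ : Π x, A x →L[ℝ] ℝ) : Prop :=
  ∀ X : Π x, A x, SmoothSection n F X → SmoothFun n (fun x => ξ x (X x))

end Smooth

/-! ### Lie algebroids, their first cohomology and their modular class -/

/-- An anchor `ρ : A → TM` together with a bracket of sections of `A`; the axioms of a Lie
algebroid are in `IsLieAlgebroid`. -/
structure AlgebroidData (n : ℕ) {M : Type*} [TopologicalSpace M] [ChartedSpace (Model n) M]
    (A : M → Type*) [∀ x, TopologicalSpace (A x)] [∀ x, AddCommGroup (A x)]
    [∀ x, Module ℝ (A x)] where
  anchor : Π x, A x →L[ℝ] TangentSpace (𝓡 n) x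
  bracket : (Π x, A x) → (Π x, A x) → Π x, A x

section Calculus

variable {n : ℕ} {M : Type*} [TopologicalSpace M] [ChartedSpace (Model n) M]

lemma mvfderiv_add_of_smooth {f g : M → ℝ} (hf : SmoothFun n f) (hg : SmoothFun n g) (x : M) :
    mvfderiv (𝓡 n) (fun y => f y + g y) x = mvfderiv (𝓡 n) f x + mvfderiv (𝓡 n) g x :=
  mvfderiv_add (hf.mdifferentiableAt (by simp)) (hg.mdifferentiableAt (by simp))

lemma mvfderiv_const_mul_of_smooth {f : M → ℝ} (c : ℝ) (hf : SmoothFun n f) (x : M) :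
    mvfderiv (𝓡 n) (fun y => c * f y) x = c • mvfderiv (𝓡 n) f x := by
  have h := mvfderiv_mul (I := 𝓡 n) (f := fun _ : M => c) (x := x)
    (contMDiff_const.mdifferentiableAt (n := ∞) (by simp)) (hf.mdifferentiableAt (by simp))
  rw [mvfderiv_const] at h
  exact h.trans (by simp)

end Calculus

section Algebroid

variable {n : ℕ} {M : Type*} [TopologicalSpace M] [ChartedSpace (Model n) M]
  [IsManifold (𝓡 n) ∞ M]
  (F : Type*) [NormedAddCommGroup F] [NormedSpace ℝ F] {A : M → Type*}
  [TopologicalSpace (TotalSpace F A)] [∀ x, TopologicalSpace (A x)]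
  [∀ x, AddCommGroup (A x)] [∀ x, Module ℝ (A x)] [FiberBundle F A]
  (F' : Type*) [NormedAddCommGroup F'] [NormedSpace ℝ F'] {A' : M → Type*}
  [TopologicalSpace (TotalSpace F' A')] [∀ x, TopologicalSpace (A' x)]
  [∀ x, AddCommGroup (A' x)] [∀ x, Module ℝ (A' x)] [FiberBundle F' A']

/-- The vector field `ρ(X)`. -/
def AlgebroidData.anchorField (D : AlgebroidData n A) (X : Π x, A x) : VField n M :=
  fun x => D.anchor x (X x)

/-- The function `ρ(X) · f`. -/
def AlgebroidData.act (D : AlgebroidData n A) (X : Π x, A x) (f : M → ℝ) : M → ℝ :=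
  fun x => mvfderiv (𝓡 n) f x (D.anchor x (X x))

/-- The axioms of a Lie algebroid. -/
structure IsLieAlgebroid (D : AlgebroidData n A) : Prop where
  smooth_anchor : ∀ X, SmoothSection n F X → SmoothVField n (D.anchorField X)
  smooth_bracket : ∀ X Y, SmoothSection n F X → SmoothSection n F Y →
    SmoothSection n F (D.bracket X Y)
  add_bracket : ∀ X Y Z, SmoothSection n F X → SmoothSection n F Y → SmoothSection n F Z →
    D.bracket (X + Y) Z = D.bracket X Z + D.bracket Y Z
  skew : ∀ X Y, SmoothSection n F X → SmoothSection n F Y → D.bracket X Y = - D.bracket Y X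
  jacobi : ∀ X Y Z, SmoothSection n F X → SmoothSection n F Y → SmoothSection n F Z →
    D.bracket X (D.bracket Y Z) + D.bracket Y (D.bracket Z X) + D.bracket Z (D.bracket X Y) = 0
  leibniz : ∀ X Y (f : M → ℝ), SmoothSection n F X → SmoothSection n F Y → SmoothFun n f →
    D.bracket X (fun x => f x • Y x) = fun x => f x • D.bracket X Y x + D.act X f x • Y x
  anchor_bracket : ∀ X Y, SmoothSection n F X → SmoothSection n F Y →
    D.anchorField (D.bracket X Y) =
      VectorField.mlieBracket (𝓡 n) (D.anchorField X) (D.anchorField Y)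

/-- `Φ : A → A'` (over the identity of `M`) is a morphism of Lie algebroids. -/
structure IsLieAlgebroidMorphism (D : AlgebroidData n A) (D' : AlgebroidData n A')
    (Φ : Π x, A x →L[ℝ] A' x) : Prop where
  source : IsLieAlgebroid F D
  target : IsLieAlgebroid F' D'
  smooth : ∀ X, SmoothSection n F X → SmoothSection n F' (fun x => Φ x (X x))
  anchor : ∀ x a, D'.anchor x (Φ x a) = D.anchor x a
  bracket : ∀ X Y, SmoothSection n F X → SmoothSection n F Y → ∀ x,
    Φ x (D.bracket X Y x) = D'.bracket (fun y => Φ y (X y)) (fun y => Φ y (Y y)) x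

/-- The smooth sections `ξ` of `A*` with `d_A ξ = 0`, where
`(d_A ξ)(X, Y) = ρ(X)·ξ(Y) - ρ(Y)·ξ(X) - ξ([X, Y])`. -/
def Z1 (D : AlgebroidData n A) : Submodule ℝ (Π x, A x →L[ℝ] ℝ) where
  carrier := {ξ | SmoothDual n F ξ ∧
    ∀ X Y, SmoothSection n F X → SmoothSection n F Y → ∀ x,
      D.act X (fun y => ξ y (Y y)) x - D.act Y (fun y => ξ y (X y)) x
        - ξ x (D.bracket X Y x) = 0}
  add_mem' := by
    rintro ξ ζ ⟨h1, h2⟩ ⟨h3, h4⟩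
    refine ⟨fun X hX => (h1 X hX).add (h3 X hX), fun X Y hX hY x => ?_⟩
    have e := h2 X Y hX hY x
    have e' := h4 X Y hX hY x
    simp only [AlgebroidData.act, Pi.add_apply, _root_.add_apply] at e e' ⊢
    rw [mvfderiv_add_of_smooth (h1 Y hY) (h3 Y hY), mvfderiv_add_of_smooth (h1 X hX) (h3 X hX)]
    simp only [_root_.add_apply]
    linarith
  zero_mem' := by
    refine ⟨fun X hX => contMDiff_const, fun X Y hX hY x => ?_⟩
    simp [AlgebroidData.act, mvfderiv_const]
  smul_mem' := by
    rintro c ξ ⟨h1, h2⟩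
    refine ⟨fun X hX => contMDiff_const.mul (h1 X hX), fun X Y hX hY x => ?_⟩
    have e := h2 X Y hX hY x
    simp only [AlgebroidData.act, Pi.smul_apply, _root_.smul_apply, smul_eq_mul] at e ⊢
    rw [mvfderiv_const_mul_of_smooth c (h1 Y hY), mvfderiv_const_mul_of_smooth c (h1 X hX)]
    simp only [_root_.smul_apply, smul_eq_mul]
    linear_combination c * e

/-- The sections `d_A f = df ∘ ρ` of `A*`, for `f ∈ C^∞(M)`. -/
def B1 (D : AlgebroidData n A) : Submodule ℝ (Π x, A x →L[ℝ] ℝ) where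
  carrier := {ξ | ∃ f : M → ℝ, SmoothFun n f ∧
    ∀ x, ξ x = (mvfderiv (𝓡 n) f x).comp (D.anchor x)}
  add_mem' := by
    rintro ξ ζ ⟨f, hf, h1⟩ ⟨g, hg, h2⟩
    refine ⟨fun x => f x + g x, hf.add hg, fun x => ?_⟩
    rw [Pi.add_apply, h1, h2, mvfderiv_add_of_smooth hf hg, ContinuousLinearMap.add_comp]
  zero_mem' := ⟨fun _ => 0, contMDiff_const, fun x => by simp [mvfderiv_const]⟩
  smul_mem' := by
    rintro c ξ ⟨f, hf, h1⟩
    refine ⟨fun x => c * f x, contMDiff_const.mul hf, fun x => ?_⟩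
    rw [Pi.smul_apply, h1, mvfderiv_const_mul_of_smooth c hf, ContinuousLinearMap.smul_comp]

/-- The first Lie algebroid cohomology space: the image of the cocycles in the space of all
sections of `A*` modulo the sections `d_A f`. -/
abbrev H1 (D : AlgebroidData n A) : Type _ := ↥((Z1 F D).map (B1 D).mkQ)

/-- `ξ` is a cocycle and its class is `c`. -/
def Represents (D : AlgebroidData n A) (ξ : Π x, A x →L[ℝ] ℝ) (c : H1 F D) : Prop :=
  ξ ∈ Z1 F D ∧ (B1 D).mkQ ξ = c.1

/-- Sections of the line bundle `⋀^top A ⊗ ⋀^top T*M`, i.e. of `Hom(⋀^top A*, ⋀^top T*M)`. The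
section `λ ⊗ μ` is `(θ, Y) ↦ λ(θ₁, …, θᵣ) μ(Y₁, …, Yₙ)`. -/
abbrev TopField (n : ℕ) {M : Type*} [TopologicalSpace M] [ChartedSpace (Model n) M]
    (F : Type*) [NormedAddCommGroup F] [NormedSpace ℝ F] (A : M → Type*)
    [∀ x, TopologicalSpace (A x)] [∀ x, AddCommGroup (A x)] [∀ x, Module ℝ (A x)] : Type _ :=
  Π x : M, (A x →L[ℝ] ℝ) [⋀^Fin (Module.finrank ℝ F)]→ₗ[ℝ]
    (TangentSpace (𝓡 n) x [⋀^Fin n]→ₗ[ℝ] ℝ)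

/-- `η` is a smooth nowhere vanishing section of `⋀^top A ⊗ ⋀^top T*M`. -/
def IsNonvanishingTop (η : TopField n F A) : Prop :=
  (∀ x, η x ≠ 0) ∧
  ∀ (θ : Fin (Module.finrank ℝ F) → Π x, A x →L[ℝ] ℝ) (Y : Fin n → VField n M),
    (∀ i, SmoothDual n F (θ i)) → (∀ j, SmoothVField n (Y j)) →
    SmoothFun n (fun x => η x (fun i => θ i x) (fun j => Y j x))

/-- `θ'` is the Lie derivative along `X` of the section `θ` of `A*`:
`θ'(Z) = ρ(X)·θ(Z) - θ([X, Z])` for all sections `Z` of `A`. -/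
def IsLieDerivDual (D : AlgebroidData n A) (X : Π x, A x) (θ θ' : Π x, A x →L[ℝ] ℝ) : Prop :=
  SmoothDual n F θ' ∧ ∀ Z, SmoothSection n F Z → ∀ x,
    θ' x (Z x) = D.act X (fun y => θ y (Z y)) x - θ x (D.bracket X Z x)

/-- `⟨ξ, X⟩ η = L_X η` for all sections `X` of `A`, where
`L_X (λ ⊗ μ) = [X, λ] ⊗ μ + λ ⊗ L_{ρ(X)} μ`, i.e. `(L_X η)(θ, Y)` is
`ρ(X)·η(θ, Y) - ∑ᵢ η(θ₁, …, L_X θᵢ, …; Y) - ∑ⱼ η(θ; Y₁, …, [ρ(X), Yⱼ], …)`. -/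
def IsModularForm (D : AlgebroidData n A) (η : TopField n F A) (ξ : Π x, A x →L[ℝ] ℝ) : Prop :=
  ∀ (X : Π x, A x) (θ θ' : Fin (Module.finrank ℝ F) → Π x, A x →L[ℝ] ℝ)
    (Y : Fin n → VField n M),
    SmoothSection n F X → (∀ i, SmoothDual n F (θ i)) →
    (∀ i, IsLieDerivDual F D X (θ i) (θ' i)) → (∀ j, SmoothVField n (Y j)) → ∀ x,
    ξ x (X x) * η x (fun i => θ i x) (fun j => Y j x) =
      D.act X (fun y => η y (fun i => θ i y) (fun j => Y j y)) x
      - ∑ i, η x (Function.update (fun i => θ i x) i (θ' i x)) (fun j => Y j x)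
      - ∑ j, η x (fun i => θ i x) (Function.update (fun j => Y j x) j
          (VectorField.mlieBracket (𝓡 n) (D.anchorField X) (Y j) x))

/-- `ξ` is a cocycle representing the modular class of `A`. -/
def IsModularCocycle (D : AlgebroidData n A) (ξ : Π x, A x →L[ℝ] ℝ) : Prop :=
  ξ ∈ Z1 F D ∧ ∃ η : TopField n F A, IsNonvanishingTop F η ∧ IsModularForm F D η ξ

/-- `Φ` is a morphism of Lie algebroids and `c` is its (relative) modular class
`Mod A - Φ^* Mod A'`. -/
def IsModularClassOfMorphism (D : AlgebroidData n A) (D' : AlgebroidData n A')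
    (Φ : Π x, A x →L[ℝ] A' x) (c : H1 F D) : Prop :=
  IsLieAlgebroidMorphism F F' D D' Φ ∧
  ∃ ξ ξ', IsModularCocycle F D ξ ∧ IsModularCocycle F' D' ξ' ∧
    Represents F D (fun x => ξ x - (ξ' x).comp (Φ x)) c

end Algebroid

/-! ### Poisson-Nijenhuis structures -/

section PN

variable {n : ℕ} {M : Type*} [TopologicalSpace M] [ChartedSpace (Model n) M]

/-- The one-form `α` read in the preferred chart at `x`. -/
def oneFormInChart (α : OneForm n M) (x : M) (u : Model n) : Model n →L[ℝ] ℝ :=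
  (α ((extChartAt (𝓡 n) x).symm u)).comp
    (mfderiv 𝓘(ℝ, Model n) (𝓡 n) (extChartAt (𝓡 n) x).symm u)

/-- The exterior derivative of a one-form: `extDeriv₁ α x v w = (dα)ₓ(v, w)`, computed in the
preferred chart at `x`. -/
def extDeriv₁ (α : OneForm n M) (x : M) (v : TangentSpace (𝓡 n) x) :
    TangentSpace (𝓡 n) x →L[ℝ] ℝ :=
  let φ : TangentSpace (𝓡 n) x →L[ℝ] Model n :=
    mfderiv (𝓡 n) 𝓘(ℝ, Model n) (extChartAt (𝓡 n) x) x
  let B : Model n →L[ℝ] Model n →L[ℝ] ℝ :=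
    fderiv ℝ (oneFormInChart α x) (extChartAt (𝓡 n) x x)
  (B (φ v) - B.flip (φ v)).comp φ

/-- The Lie derivative of a one-form, `L_X α = i_X dα + d(α(X))`. -/
def lieDeriv₁ (X : VField n M) (α : OneForm n M) : OneForm n M :=
  fun x => extDeriv₁ α x (X x) + mvfderiv (𝓡 n) (fun y => α y (X y)) x

/-- The bracket of one-forms `[α, β]_P = L_{Pα} β - L_{Pβ} α - d(P(α, β))`. -/
def koszul (P : BiField n M) (α β : OneForm n M) : OneForm n M :=
  fun x => lieDeriv₁ (fun y => P y (α y)) β x - lieDeriv₁ (fun y => P y (β y)) α x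
    - mvfderiv (𝓡 n) (fun y => β y (P y (α y))) x

/-- The deformed bracket of vector fields `[X, Y]_N = [NX, Y] + [X, NY] - N[X, Y]`. -/
def deformedBracket (N : EndField n M) (X Y : VField n M) : VField n M :=
  fun x => VectorField.mlieBracket (𝓡 n) (fun y => N y (X y)) Y x
    + VectorField.mlieBracket (𝓡 n) X (fun y => N y (Y y)) x
    - N x (VectorField.mlieBracket (𝓡 n) X Y x)

/-- The hamiltonian vector field `H^P_f = P df`. -/
def hamiltonian (P : BiField n M) (f : M → ℝ) : VField n M :=
  fun x => P x (mvfderiv (𝓡 n) f x)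

/-- The bracket of functions `{f, g} = ⟨dg, P df⟩`. -/
def poissonBracket (P : BiField n M) (f g : M → ℝ) : M → ℝ :=
  fun x => mvfderiv (𝓡 n) g x (hamiltonian P f x)

/-- The transpose `ᵗN : T*M → T*M`. -/
def transpose (N : EndField n M) (x : M) :
    (TangentSpace (𝓡 n) x →L[ℝ] ℝ) →L[ℝ] (TangentSpace (𝓡 n) x →L[ℝ] ℝ) :=
  ContinuousLinearMap.precomp ℝ (N x)

/-- The power `N^k`. -/
def npow (N : EndField n M) (k : ℕ) : EndField n M := fun x => N x ^ k

/-- The hierarchy `P_k = N^k P`. -/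
def hierarchy (N : EndField n M) (P : BiField n M) (k : ℕ) : BiField n M :=
  fun x => (npow N k x).comp (P x)

/-- `N` is a Nijenhuis tensor: a smooth `(1,1)`-tensor with vanishing torsion. -/
structure IsNijenhuis [IsManifold (𝓡 n) ∞ M] (N : EndField n M) : Prop where
  smooth : SmoothSection n (Model n →L[ℝ] Model n) N
  torsion : ∀ X Y : VField n M, SmoothVField n X → SmoothVField n Y → ∀ x,
    VectorField.mlieBracket (𝓡 n) (fun y => N y (X y)) (fun y => N y (Y y)) x
      = N x (deformedBracket N X Y x)

/-- `P` is a Poisson bivector: smooth, skew-symmetric, and its bracket of functions satisfies the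
Jacobi identity. -/
structure IsPoisson [IsManifold (𝓡 n) ∞ M] (P : BiField n M) : Prop where
  smooth : SmoothSection n ((Model n →L[ℝ] ℝ) →L[ℝ] Model n) P
  skew : ∀ x (α β : TangentSpace (𝓡 n) x →L[ℝ] ℝ), β (P x α) = - α (P x β)
  jacobi : ∀ f g h : M → ℝ, SmoothFun n f → SmoothFun n g → SmoothFun n h → ∀ x,
    poissonBracket P f (poissonBracket P g h) x + poissonBracket P g (poissonBracket P h f) x
      + poissonBracket P h (poissonBracket P f g) x = 0

/-- `(P, N)` is a Poisson-Nijenhuis structure: `P` is Poisson, `N` is Nijenhuis, `NP = P ᵗN` and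
`C(P, N) = 0`. -/
structure IsPoissonNijenhuis [IsManifold (𝓡 n) ∞ M] (P : BiField n M) (N : EndField n M) :
    Prop where
  poisson : IsPoisson P
  nijenhuis : IsNijenhuis N
  comm : ∀ x, (N x).comp (P x) = (P x).comp (transpose N x)
  compat : ∀ α β : OneForm n M, SmoothOneForm n α → SmoothOneForm n β → ∀ x,
    koszul (fun y => (N y).comp (P y)) α β x
      = koszul P (fun y => transpose N y (α y)) β x
        + koszul P α (fun y => transpose N y (β y)) x - transpose N x (koszul P α β x)

/-- `(TM, N, [ , ]_N)`. -/
def tangentAlgebroid (N : EndField n M) :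
    AlgebroidData n (fun x : M => TangentSpace (𝓡 n) x) where
  anchor := N
  bracket := deformedBracket N

/-- `(T*M, P, [ , ]_P)`. -/
def cotangentAlgebroid (P : BiField n M) :
    AlgebroidData n (fun x : M => TangentSpace (𝓡 n) x →L[ℝ] ℝ) where
  anchor := P
  bracket := koszul P

/-- A vector field seen as a section of the dual of `T*M`. -/
def evalField (X : VField n M) (x : M) : (TangentSpace (𝓡 n) x →L[ℝ] ℝ) →L[ℝ] ℝ where
  toFun α := α (X x)
  map_add' _ _ := rfl
  map_smul' _ _ := rfl
  cont := continuous_eval_const (X x)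

/-- `-Pα`, for a one-form `α`. -/
def negSharp (P : BiField n M) (α : OneForm n M) : VField n M := fun x => - P x (α x)

/-- The function `I_k = Tr(N^k / k)`. -/
def traceFun (N : EndField n M) (k : ℕ) : M → ℝ :=
  fun x => LinearMap.trace ℝ (TangentSpace (𝓡 n) x) (npow N k x).toLinearMap / k

/-- `μ` is a volume form: a smooth nowhere vanishing `n`-form. -/
def IsVolumeForm [IsManifold (𝓡 n) ∞ M] (μ : Π x : M, TangentSpace (𝓡 n) x [⋀^Fin n]→ₗ[ℝ] ℝ) :
    Prop :=
  (∀ x, μ x ≠ 0) ∧ ∀ Y : Fin n → VField n M, (∀ j, SmoothVField n (Y j)) →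
    SmoothFun n (fun x => μ x (fun j => Y j x))

/-- The value `(L_Z μ)(Y₁, …, Yₙ)`. -/
def lieDerivTop (Z : VField n M) (μ : Π x : M, TangentSpace (𝓡 n) x [⋀^Fin n]→ₗ[ℝ] ℝ)
    (Y : Fin n → VField n M) (x : M) : ℝ :=
  mvfderiv (𝓡 n) (fun y => μ y (fun j => Y j y)) x (Z x)
    - ∑ j, μ x (Function.update (fun j => Y j x) j (VectorField.mlieBracket (𝓡 n) Z (Y j) x))

/-- `X` is the modular vector field of `P` with respect to `μ`: `⟨X, df⟩ μ = L_{H^P_f} μ`. -/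
def IsModularVField [IsManifold (𝓡 n) ∞ M] (P : BiField n M)
    (μ : Π x : M, TangentSpace (𝓡 n) x [⋀^Fin n]→ₗ[ℝ] ℝ) (X : VField n M) : Prop :=
  SmoothVField n X ∧ ∀ (f : M → ℝ) (Y : Fin n → VField n M), SmoothFun n f →
    (∀ j, SmoothVField n (Y j)) → ∀ x,
    mvfderiv (𝓡 n) f x (X x) * μ x (fun j => Y j x) = lieDerivTop (hamiltonian P f) μ Y x

end PN

end

end PNModular

open PNModular

/-!
The modular classes are computed by one formula, valid for a Lie algebroid `A` (anchor `ρ`) whose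
underlying vector bundle is isomorphic to `TM`. Fix such an isomorphism `G : TM → A`
(`TangentIso`): the identity for `TM`, a Riemannian metric for `T*M` (`exists_cotangentIso`). It
gives a nowhere vanishing section `η = det (θᵢ(G Yⱼ))` of `⋀^top A ⊗ ⋀^top T*M`
(`TangentIso.topForm`), even if `M` is not orientable. For a section `X` of `A`, the operations
`Y ↦ G⁻¹[X, G Y]` and `Y ↦ [ρ(X), Y]` on vector fields are derivations along `ρ(X)`, so they differ
by a field of endomorphisms `T_X` (`TangentIso.IsTorsion`), and Jacobi's formula for the derivative
of a determinant yields `L_X η = Tr(T_X) η` (`TangentIso.lieDeriv_topForm`). Hence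
`ζ : X ↦ Tr T_X` (`TangentIso.IsTraceForm`) is a modular cocycle. It is closed because
`Tr [D, S] = V · Tr S` for a derivation `D` along `V` and a field of endomorphisms `S`
(`IsDerivationAlong.trace_commutator`); replacing `η` by `h η` adds `d log |h| ∘ ρ`, which is exact
(`TangentIso.IsTraceForm.isModularForm_iff`). The modular class of a morphism `Φ` is thus the class
of `ζ - ζ' ∘ Φ` (`IsLieAlgebroidMorphism.exists_modularClass`).

When the bracket of `A` is deformed by an endomorphism `Φ`, with the same `G`, the new cocycle `ζ'`
satisfies `ζ'(X) = ζ(Φ X) + ρ(X) · Tr Φ` (`TangentIso.IsTraceForm.deform`). The bracket of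
`N^{k+1}` is the deformation by `N` of that of `N^k`, and the bracket of `N^{k+1} P` is the
deformation by `ᵗN` of that of `N^k P`. On `TM` the cocycle of `N^k` is `d Tr N^k`
(`IsNijenhuisField.isTraceForm`), so the comparison reads
`d Tr N^{k+1} = d Tr N^k ∘ N + d Tr N ∘ N^k`, whence `d Tr N^{k+1} = (k+1) d Tr N ∘ N^k`
(`IsNijenhuisField.mvfderiv_traceField_npow`). On `T*M` it gives
`ζ_{k+1} - ζ_k ∘ ᵗN = d Tr N ∘ N^k P = d Tr(N^{k+1}/(k+1)) ∘ P`
(`IsPoissonNijenhuis.traceForm_succ'`), and `θ ∘ P` is the vector field `-P θ` because `P` is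
skew-symmetric. So the modular classes of `N` and `ᵗN` between consecutive members of the hierarchy
are represented by `d Tr(N^{k+1}/(k+1))` and its image under `-P`, and those of `N^k` and `ᵗN^k` by
`d Tr N^k` and its image. The map `-P` sends coboundaries `df ∘ N^k` to coboundaries `df ∘ N^k P`
(`IsPoissonNijenhuis.represents_negSharp`), which gives the relation for all representatives.

For a volume form `μ`, the modular section of `μ ⊗ μ` for `(T*M, N^k P)` is twice the modular
vector field of `N^k P` (`IsVolumeForm.two_mul_lieDerivTop`). The function that compares `μ ⊗ μ`
with `η` does not depend on `k`, so it contributes nothing to `X^{k+1} - N X^k`, and the last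
formula follows from the comparison of `ζ_{k+1}` with `ζ_k` (`IsPoissonNijenhuis.exists_modularVField`).

That the brackets in question define Lie algebroids, and that `N` and `ᵗN` are morphisms between
them, are identities in a Lie ring acting on an additive group of functions (`deform_jacobi`,
`mixedTorsion`, `IsKoszul`). They apply to vector fields by Cartan's formula (`extDeriv₁_apply`);
for a Poisson bivector, the compatibility of `P` with the brackets is checked on exact one-forms,
where it is the Jacobi identity, and extended by tensoriality (`IsPoisson.isPoissonBivector`).
-/

namespace PNModular

open Bundle Set Filter Topology

set_option linter.unusedSectionVars false

section

variable {n : ℕ} {M : Type*} [TopologicalSpace M] [ChartedSpace (Model n) M]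
  [IsManifold (𝓡 n) ∞ M]

/-! ### Smooth functions, vector fields and one-forms; cut-off frames -/

theorem smoothVField_endField_apply {N : EndField n M}
    (hN : SmoothSection n (Model n →L[ℝ] Model n) N) {X : VField n M} (hX : SmoothVField n X) :
    SmoothVField n (fun x => N x (X x)) := ContMDiff.clm_bundle_apply hN hX

theorem smoothVField_biField_apply {P : BiField n M}
    (hP : SmoothSection n ((Model n →L[ℝ] ℝ) →L[ℝ] Model n) P) {α : OneForm n M}
    (hα : SmoothOneForm n α) : SmoothVField n (fun x => P x (α x)) :=
  ContMDiff.clm_bundle_apply hP hα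

theorem SmoothOneForm.apply {α : OneForm n M} (hα : SmoothOneForm n α) {X : VField n M}
    (hX : SmoothVField n X) : SmoothFun n (fun x => α x (X x)) := by
  have h := ContMDiff.clm_bundle_apply (E₂ := fun _ : M => ℝ) hα hX
  intro x
  have hx := h x
  rw [contMDiffAt_section] at hx
  exact hx

theorem SmoothFun.mvfderiv_apply {f : M → ℝ} (hf : SmoothFun n f) {X : VField n M}
    (hX : SmoothVField n X) : SmoothFun n (fun x => mvfderiv (𝓡 n) f x (X x)) := by
  have h := (hf.contMDiff_tangentMap (m := ∞) (by simp)).comp hX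
  exact (contMDiff_snd_tangentBundle_modelSpace (n := ∞) ℝ 𝓘(ℝ, ℝ)).comp h

theorem SmoothFun.mdiff {f : M → ℝ} (hf : SmoothFun n f) (x : M) :
    MDifferentiableAt (𝓡 n) 𝓘(ℝ, ℝ) f x := hf.mdifferentiableAt (by simp)

theorem mvfderiv_congr {f g : M → ℝ} {x : M} (h : f =ᶠ[𝓝 x] g) :
    mvfderiv (𝓡 n) f x = mvfderiv (𝓡 n) g x := by
  ext v
  exact congrArg (fun L : Model n →L[ℝ] ℝ => L v) h.mfderiv_eq

/-- Global smooth objects that restrict to a coordinate system near `x₀`: cut-off coordinate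
functions `f i`, cut-off coordinate fields `E i` and a cut-off function `ψ` with
`∑ i, df i ⊗ E i = ψ • id` on all of `M`. -/
structure CutoffFrame (n : ℕ) {M : Type*} [TopologicalSpace M] [ChartedSpace (Model n) M]
    [IsManifold (𝓡 n) ∞ M] (x₀ : M) where
  f : Fin n → M → ℝ
  E : Fin n → VField n M
  ψ : M → ℝ
  smooth_f : ∀ i, SmoothFun n (f i)
  smooth_E : ∀ i, SmoothVField n (E i)
  smooth_ψ : SmoothFun n ψ
  eventually_one : ∀ᶠ y in 𝓝 x₀, ψ y = 1
  sum_eq : ∀ {y : M} (v : TangentSpace (𝓡 n) y),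
    ∑ i, mvfderiv (𝓡 n) (f i) y v • E i y = ψ y • v

section Frame

variable [T2Space M]

theorem exists_cutoffFrame (x₀ : M) : Nonempty (CutoffFrame n x₀) := by
  obtain ⟨c, -, -⟩ :=
    (SmoothBumpFunction.nhds_basis_tsupport (I := 𝓡 n) x₀).mem_iff.1 Filter.univ_mem
  have hU : {y | c y = 1} ∈ 𝓝 x₀ := c.eventuallyEq_one
  obtain ⟨V, hVU, hVo, hxV⟩ := mem_nhds_iff.1 hU
  -- `d` is supported where `c = 1`, so that the cut-off coordinates are coordinates there.
  obtain ⟨d, -, hd⟩ :=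
    (SmoothBumpFunction.nhds_basis_tsupport (I := 𝓡 n) x₀).mem_iff.1 (hVo.mem_nhds hxV)
  let t := trivializationAt (Model n) (TangentSpace (𝓡 n) : M → Type _) x₀
  let b := (EuclideanSpace.basisFun (Fin n) ℝ).toBasis
  let f : Fin n → M → ℝ := fun i y => c y • (extChartAt (𝓡 n) x₀ y) i
  have hf : ∀ i, SmoothFun n (f i) := fun i => by
    apply c.contMDiff_smul
    have h1 : ContMDiffOn (𝓡 n) 𝓘(ℝ, Model n) ∞ (extChartAt (𝓡 n) x₀)
        (chartAt (Model n) x₀).source :=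
      contMDiffOn_extChartAt
    have h2 : ContMDiff 𝓘(ℝ, Model n) 𝓘(ℝ, ℝ) ∞ (EuclideanSpace.proj (𝕜 := ℝ) i : Model n → ℝ) :=
      (EuclideanSpace.proj (𝕜 := ℝ) i : Model n →L[ℝ] ℝ).contMDiff
    exact h2.comp_contMDiffOn h1
  let E : Fin n → VField n M := fun i => (d : M → ℝ) • t.localFrame b i
  refine ⟨f, E, d, hf, fun i => ?_, d.contMDiff, d.eventuallyEq_one, fun {y} v => ?_⟩
  · refine ContMDiffOn.smul_section_of_tsupport d.contMDiff.contMDiffOn t.open_baseSet ?_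
      (t.contMDiffOn_localFrame_baseSet ∞ b i)
    exact d.tsupport_subset_chartAt_source
  · by_cases hy : d y = 0
    · simp [E, hy]
    have hyV : y ∈ V := hd (subset_tsupport _ hy)
    have hys : y ∈ (chartAt (Model n) x₀).source :=
      d.tsupport_subset_chartAt_source (subset_tsupport _ hy)
    have hyt : y ∈ t.baseSet := hys
    have hfy : ∀ i, mvfderiv (𝓡 n) (f i) y v = (t.continuousLinearMapAt ℝ y v) i := by
      intro i
      have h1 : f i =ᶠ[𝓝 y] (fun z => EuclideanSpace.proj (𝕜 := ℝ) i (extChartAt (𝓡 n) x₀ z)) := by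
        filter_upwards [hVo.mem_nhds hyV] with z hz
        have : c z = 1 := hVU hz
        simp [f, this]
      rw [TangentBundle.continuousLinearMapAt_trivializationAt hys]
      have hd1 : MDifferentiableAt (𝓡 n) 𝓘(ℝ, Model n) (extChartAt (𝓡 n) x₀) y :=
        mdifferentiableAt_extChartAt hys
      have hd2 : MDifferentiableAt 𝓘(ℝ, Model n) 𝓘(ℝ, ℝ)
          (EuclideanSpace.proj (𝕜 := ℝ) i : Model n → ℝ) (extChartAt (𝓡 n) x₀ y) :=
        (EuclideanSpace.proj (𝕜 := ℝ) i : Model n →L[ℝ] ℝ).mdifferentiableAt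
      have := mfderiv_comp y hd2 hd1
      rw [ContinuousLinearMap.mfderiv_eq] at this
      have h3 : mfderiv (𝓡 n) 𝓘(ℝ, ℝ) (f i) y = _ := h1.mfderiv_eq.trans this
      show mfderiv (𝓡 n) 𝓘(ℝ, ℝ) (f i) y v = _
      rw [h3]; rfl
    have : v = ∑ i, (t.continuousLinearMapAt ℝ y v) i • t.localFrame b i y := by
      have hcoe : ∀ i, t.localFrame b i y = t.symmL ℝ y (b i) := by
        intro i
        rw [t.localFrame_apply_of_mem_baseSet b hyt]
        simp [Trivialization.basisAt]
        exact (t.symmL_apply (R := ℝ) hyt (b i)).symm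
      simp_rw [hcoe, ← map_smul, ← map_sum]
      have : ∑ i, (t.continuousLinearMapAt ℝ y v) i • b i = t.continuousLinearMapAt ℝ y v := by
        simpa [b] using b.sum_repr (t.continuousLinearMapAt ℝ y v)
      rw [this, t.symmL_continuousLinearMapAt hyt]
    simp_rw [hfy, E, Pi.smul_apply']
    conv_rhs => rw [this]
    rw [Finset.smul_sum]
    refine Finset.sum_congr rfl fun i _ => ?_
    rw [smul_comm]

/-- A one-form is smooth if its values on smooth vector fields are smooth functions. -/
theorem smoothOneForm_of_apply {α : OneForm n M}
    (h : ∀ X : VField n M, SmoothVField n X → SmoothFun n (fun x => α x (X x))) :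
    SmoothOneForm n α := by
  intro x₀
  obtain ⟨d, -, -⟩ :=
    (SmoothBumpFunction.nhds_basis_tsupport (I := 𝓡 n) x₀).mem_iff.1 Filter.univ_mem
  let t := trivializationAt (Model n) (TangentSpace (𝓡 n) : M → Type _) x₀
  let b := (EuclideanSpace.basisFun (Fin n) ℝ).toBasis
  have hE : ∀ i, SmoothVField n ((d : M → ℝ) • t.localFrame b i) := fun i =>
    ContMDiffOn.smul_section_of_tsupport d.contMDiff.contMDiffOn t.open_baseSet
      d.tsupport_subset_chartAt_source (t.contMDiffOn_localFrame_baseSet ∞ b i)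
  rw [contMDiffAt_hom_bundle]
  refine ⟨contMDiffAt_id, ?_⟩
  -- The components of `α` in the trivialization at `x₀` are its values on the cut-off frame.
  have key : ∀ᶠ y in 𝓝 x₀, ContinuousLinearMap.inCoordinates (Model n)
      (TangentSpace (𝓡 n) : M → Type _) ℝ (fun _ : M => ℝ) x₀ y x₀ y (α y) =
        ∑ i, α y (d y • t.localFrame b i y) •
        (EuclideanSpace.proj (𝕜 := ℝ) i : Model n →L[ℝ] ℝ) := by
    filter_upwards [d.eventuallyEq_one, t.open_baseSet.mem_nhds
      (FiberBundle.mem_baseSet_trivializationAt' (F := Model n) (E := TangentSpace (𝓡 n)) x₀)]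
      with y hy hyt
    have hcoe : ∀ i, t.localFrame b i y = t.symmL ℝ y (b i) := by
      intro i
      rw [t.localFrame_apply_of_mem_baseSet b hyt]
      simp only [Trivialization.basisAt]
      exact (t.symmL_apply (R := ℝ) hyt (b i)).symm
    ext v
    have hv : v = ∑ i, v i • b i := by simpa [b] using (b.sum_repr v).symm
    have hy' : d y = 1 := hy
    rw [ContinuousLinearMap.inCoordinates]
    simp only [hy', one_smul, hcoe]
    conv_lhs => rw [hv]
    simp [map_sum, t, mul_comm]
  refine ContMDiffAt.congr_of_eventuallyEq ?_ key
  have : ∀ i ∈ (Finset.univ : Finset (Fin n)), ContMDiffAt (𝓡 n) 𝓘(ℝ, Model n →L[ℝ] ℝ) ∞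
      (fun y => α y (d y • t.localFrame b i y) •
        (EuclideanSpace.proj (𝕜 := ℝ) i : Model n →L[ℝ] ℝ)) x₀ := fun i _ =>
    ((h _ (hE i)) x₀).smul contMDiffAt_const
  exact ContMDiffAt.sum this

theorem smoothOneForm_mvfderiv {f : M → ℝ} (hf : SmoothFun n f) :
    SmoothOneForm n (mvfderiv (𝓡 n) f) :=
  smoothOneForm_of_apply fun _ hX => hf.mvfderiv_apply hX

end Frame

namespace CutoffFrame

variable {x₀ : M} (c : CutoffFrame n x₀)

theorem ψ_self : c.ψ x₀ = 1 := c.eventually_one.self_of_nhds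

theorem sum_self (v : TangentSpace (𝓡 n) x₀) :
    ∑ i, mvfderiv (𝓡 n) (c.f i) x₀ v • c.E i x₀ = v := by
  rw [c.sum_eq, c.ψ_self, one_smul]

/-- Where `ψ = 1`, the `n` fields `E i` span the tangent space, hence are a basis, and the `df i`
are the dual basis. -/
theorem dual {y : M} (hy : c.ψ y = 1) (i j : Fin n) :
    mvfderiv (𝓡 n) (c.f i) y (c.E j y) = if j = i then 1 else 0 := by
  have hs : ∀ v : TangentSpace (𝓡 n) y, ∑ i, mvfderiv (𝓡 n) (c.f i) y v • c.E i y = v := by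
    intro v; rw [c.sum_eq, hy, one_smul]
  have hspan : ⊤ ≤ Submodule.span ℝ (Set.range fun i => c.E i y) := by
    intro v _
    rw [← hs v]
    exact Submodule.sum_mem _ fun i _ => Submodule.smul_mem _ _ (Submodule.subset_span ⟨i, rfl⟩)
  have hfr : Module.finrank ℝ (TangentSpace (𝓡 n) y) = n := finrank_euclideanSpace_fin
  have hli : LinearIndependent ℝ (fun i => c.E i y) :=
    linearIndependent_of_top_le_span_of_card_eq_finrank hspan (by simp [hfr])
  have h := hs (c.E j y)
  have h2 : ∑ i, (mvfderiv (𝓡 n) (c.f i) y (c.E j y) - if j = i then 1 else 0) • c.E i y = 0 := by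
    simp only [sub_smul, Finset.sum_sub_distrib, h]
    simp
  have := Fintype.linearIndependent_iff.1 hli _ h2 i
  linarith

theorem eq_sum_form (α : TangentSpace (𝓡 n) x₀ →L[ℝ] ℝ) :
    α = ∑ i, α (c.E i x₀) • mvfderiv (𝓡 n) (c.f i) x₀ := by
  ext v
  conv_lhs => rw [← c.sum_self v]
  simp [map_sum, mul_comm]

end CutoffFrame

section Frame

variable [T2Space M]

/-- Every tangent vector extends to a smooth vector field. -/
theorem exists_smoothVField_eq (x : M) (v : TangentSpace (𝓡 n) x) :
    ∃ X : VField n M, SmoothVField n X ∧ X x = v := by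
  obtain ⟨c⟩ := exists_cutoffFrame (n := n) x
  refine ⟨fun y => ∑ i, mvfderiv (𝓡 n) (c.f i) x v • c.E i y, ?_, c.sum_self v⟩
  exact ContMDiff.sum_section fun i _ => (c.smooth_E i).const_smul_section

/-- Every cotangent vector is the differential of a smooth function. -/
theorem exists_mvfderiv_eq (x : M) (α : TangentSpace (𝓡 n) x →L[ℝ] ℝ) :
    ∃ f : M → ℝ, SmoothFun n f ∧ mvfderiv (𝓡 n) f x = α := by
  obtain ⟨c⟩ := exists_cutoffFrame (n := n) x
  have hs : ∀ s : Finset (Fin n), SmoothFun n (fun y => ∑ i ∈ s, α (c.E i x) * c.f i y) ∧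
      mvfderiv (𝓡 n) (fun y => ∑ i ∈ s, α (c.E i x) * c.f i y) x =
        ∑ i ∈ s, α (c.E i x) • mvfderiv (𝓡 n) (c.f i) x := by
    intro s
    induction s using Finset.induction_on with
    | empty => exact ⟨contMDiff_const (c := (0 : ℝ)), by simp [mvfderiv_const]⟩
    | insert a s ha ih =>
      simp only [Finset.sum_insert ha]
      have h1 : SmoothFun n (fun y => α (c.E a x) * c.f a y) := contMDiff_const.mul (c.smooth_f a)
      exact ⟨h1.add ih.1, by
        rw [mvfderiv_add_of_smooth h1 ih.1, ih.2, mvfderiv_const_mul_of_smooth _ (c.smooth_f a)]⟩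
  exact ⟨_, (hs Finset.univ).1, (hs Finset.univ).2.trans (c.eq_sum_form α).symm⟩

/-- A vector field is smooth if it maps smooth functions to smooth functions. -/
theorem smoothVField_of_apply {X : VField n M}
    (h : ∀ f : M → ℝ, SmoothFun n f → SmoothFun n (fun x => mvfderiv (𝓡 n) f x (X x))) :
    SmoothVField n X := by
  intro x₀
  obtain ⟨c⟩ := exists_cutoffFrame (n := n) x₀
  have h1 : SmoothVField n (fun y => ∑ i, mvfderiv (𝓡 n) (c.f i) y (X y) • c.E i y) :=
    ContMDiff.sum_section fun i _ => (h _ (c.smooth_f i)).smul_section (c.smooth_E i)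
  refine (h1 x₀).congr_of_eventuallyEq ?_
  filter_upwards [c.eventually_one] with y hy
  rw [c.sum_eq, hy, one_smul]

theorem tangentVector_ext {x : M} {u v : TangentSpace (𝓡 n) x}
    (h : ∀ f : M → ℝ, SmoothFun n f → mvfderiv (𝓡 n) f x u = mvfderiv (𝓡 n) f x v) : u = v := by
  obtain ⟨c⟩ := exists_cutoffFrame (n := n) x
  rw [← c.sum_self u, ← c.sum_self v]
  exact Finset.sum_congr rfl fun i _ => by rw [h _ (c.smooth_f i)]

theorem oneForm_ext {α β : OneForm n M} {x : M}
    (h : ∀ X : VField n M, SmoothVField n X → α x (X x) = β x (X x)) : α x = β x := by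
  ext v
  obtain ⟨X, hX, rfl⟩ := exists_smoothVField_eq x v
  exact h X hX

end Frame

/-! ### Cartan's formula for the exterior derivative, and the Lie bracket -/

section Cartan

/-- The vector field `X` read in the preferred chart at `x`. -/
noncomputable def fieldInChart (X : VField n M) (x : M) : Model n → Model n :=
  VectorField.mpullbackWithin 𝓘(ℝ, Model n) (𝓡 n) (extChartAt (𝓡 n) x).symm X (range (𝓡 n))

/-- The Lie bracket at `x`, computed in the preferred chart at `x`, whose derivative at `x` is the
identity by the definition of the tangent space. -/
theorem mlieBracket_eq_fieldInChart (X Y : VField n M) (x : M) :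
    VectorField.mlieBracket (𝓡 n) X Y x =
      fderiv ℝ (fieldInChart Y x) (extChartAt (𝓡 n) x x) (fieldInChart X x (extChartAt (𝓡 n) x x))
      - fderiv ℝ (fieldInChart X x) (extChartAt (𝓡 n) x x)
        (fieldInChart Y x (extChartAt (𝓡 n) x x)) := by
  rw [← VectorField.mlieBracketWithin_univ, VectorField.mlieBracketWithin_apply,
    mfderiv_extChartAt_self]
  erw [ContinuousLinearMap.inverse_id]
  change VectorField.lieBracketWithin ℝ (fieldInChart X x) (fieldInChart Y x)
    (univ ∩ range (𝓡 n)) (extChartAt (𝓡 n) x x) = _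
  rw [univ_inter, ModelWithCorners.range_eq_univ, VectorField.lieBracketWithin_univ]
  rfl

theorem fieldInChart_self (X : VField n M) (x : M) :
    fieldInChart X x (extChartAt (𝓡 n) x x) = X x := by
  have h := VectorField.mfderiv_extChartAt_inverse_comp_mfderivWithin_extChartAT_symm (I := 𝓡 n)
    (x := x) (X x)
  rw [mfderiv_extChartAt_self] at h
  erw [ContinuousLinearMap.inverse_id] at h
  rw [fieldInChart, VectorField.mpullbackWithin_apply]
  refine Eq.trans ?_ h
  change _ = (mfderivWithin 𝓘(ℝ, Model n) (𝓡 n) (extChartAt (𝓡 n) x).symm (range (𝓡 n))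
    (extChartAt (𝓡 n) x x)).inverse (X x)
  congr 1
  rw [extChartAt_to_inv]

theorem oneFormInChart_fieldInChart (α : OneForm n M) (X : VField n M) (x : M) {u : Model n}
    (hu : u ∈ (extChartAt (𝓡 n) x).target) :
    oneFormInChart α x u (fieldInChart X x u) =
      α ((extChartAt (𝓡 n) x).symm u) (X ((extChartAt (𝓡 n) x).symm u)) := by
  have h := isInvertible_mfderivWithin_extChartAt_symm (I := 𝓡 n) hu
  rw [oneFormInChart, fieldInChart, VectorField.mpullbackWithin_apply, ← mfderivWithin_univ,
    ← ModelWithCorners.range_eq_univ (𝓡 n)]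
  exact congrArg (α ((extChartAt (𝓡 n) x).symm u)) (h.self_apply_inverse _)

theorem differentiableAt_fieldInChart {X : VField n M} (hX : SmoothVField n X) (x : M) :
    DifferentiableAt ℝ (fieldInChart X x) (extChartAt (𝓡 n) x x) := by
  have h := MDifferentiableWithinAt.differentiableWithinAt_mpullbackWithin_vectorField
    (s := univ) ((hX.mdifferentiableAt (x := x) (by simp)).mdifferentiableWithinAt)
  change DifferentiableWithinAt ℝ (fieldInChart X x) _ _ at h
  rwa [preimage_univ, univ_inter, ModelWithCorners.range_eq_univ,
    differentiableWithinAt_univ] at h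

theorem differentiableAt_oneFormInChart {α : OneForm n M} (hα : SmoothOneForm n α) (x : M) :
    DifferentiableAt ℝ (oneFormInChart α x) (extChartAt (𝓡 n) x x) := by
  have h1 := ((contMDiffAt_hom_bundle _).1 (hα x)).2
  have h2 : ContMDiffAt 𝓘(ℝ, Model n) (𝓡 n) ∞ (extChartAt (𝓡 n) x).symm (extChartAt (𝓡 n) x x) :=
    contMDiffWithinAt_univ.1 (by
      simpa using contMDiffWithinAt_extChartAt_symm_range (I := 𝓡 n) (n := ∞) x
        (mem_extChartAt_target x))
  have h3 := ContMDiffAt.comp_of_eq (x := extChartAt (𝓡 n) x x) h1 h2 (by simp)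
  have h4 := (h3.contDiffAt).differentiableAt (by simp)
  refine h4.congr_of_eventuallyEq ?_
  filter_upwards [(isOpen_extChartAt_target x).mem_nhds (mem_extChartAt_target x)] with u hu
  have hs : (extChartAt (𝓡 n) x).symm u ∈ (chartAt (Model n) x).source := by
    simpa using (extChartAt (𝓡 n) x).map_target hu
  have h5 := TangentBundle.symmL_trivializationAt (I := 𝓡 n) hs
  rw [(extChartAt (𝓡 n) x).right_inv hu] at h5
  simp only [Function.comp, ContinuousLinearMap.inCoordinates]
  rw [h5]
  ext v
  simp [oneFormInChart]

theorem mvfderiv_eq_fderiv_chart {f : M → ℝ} (hf : SmoothFun n f) (x : M) :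
    mvfderiv (𝓡 n) f x =
      fderiv ℝ (fun u => f ((extChartAt (𝓡 n) x).symm u)) (extChartAt (𝓡 n) x x) := by
  have := (hf.mdiff x).mfderiv
  ext v
  have h2 := congrArg (fun L : Model n →L[ℝ] ℝ => L v) this
  rw [ModelWithCorners.range_eq_univ, fderivWithin_univ] at h2
  exact h2

/-- Cartan's formula for the exterior derivative of a one-form, `extDeriv₁` being defined in the
preferred chart at each point. -/
theorem extDeriv₁_apply {α : OneForm n M} (hα : SmoothOneForm n α) {X Y : VField n M}
    (hX : SmoothVField n X) (hY : SmoothVField n Y) (x : M) :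
    extDeriv₁ α x (X x) (Y x) = mvfderiv (𝓡 n) (fun y => α y (Y y)) x (X x)
      - mvfderiv (𝓡 n) (fun y => α y (X y)) x (Y x)
      - α x (VectorField.mlieBracket (𝓡 n) X Y x) := by
  have key : ∀ {Z : VField n M}, SmoothVField n Z → mvfderiv (𝓡 n) (fun y => α y (Z y)) x =
      (fderiv ℝ (oneFormInChart α x) (extChartAt (𝓡 n) x x)).flip
        (fieldInChart Z x (extChartAt (𝓡 n) x x)) +
      (oneFormInChart α x (extChartAt (𝓡 n) x x)).comp
        (fderiv ℝ (fieldInChart Z x) (extChartAt (𝓡 n) x x)) := by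
    intro Z hZ
    rw [mvfderiv_eq_fderiv_chart (hα.apply hZ)]
    have : (fun u => α ((extChartAt (𝓡 n) x).symm u) (Z ((extChartAt (𝓡 n) x).symm u))) =ᶠ[
        𝓝 (extChartAt (𝓡 n) x x)] fun u => oneFormInChart α x u (fieldInChart Z x u) := by
      filter_upwards [(isOpen_extChartAt_target x).mem_nhds (mem_extChartAt_target x)] with u hu
      exact (oneFormInChart_fieldInChart α Z x hu).symm
    rw [this.fderiv_eq, fderiv_clm_apply (differentiableAt_oneFormInChart hα x)
      (differentiableAt_fieldInChart hZ x), add_comm]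
  have hα0 : oneFormInChart α x (extChartAt (𝓡 n) x x) = α x := by
    ext v
    -- No regularity of `X` is needed, so a vector may be extended by a constant of `Model n`.
    obtain ⟨X, rfl⟩ : ∃ X : VField n M, X x = v := ⟨fun _ => v, rfl⟩
    have h := oneFormInChart_fieldInChart α X x (mem_extChartAt_target x)
    rw [fieldInChart_self, extChartAt_to_inv] at h
    exact h
  rw [key hX, key hY, mlieBracket_eq_fieldInChart, extDeriv₁, mfderiv_extChartAt_self, hα0]
  simp only [fieldInChart_self]
  erw [map_sub]
  -- From here on the computation takes place in `Model n`, the tangent space at `x`.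
  let B : Model n →L[ℝ] Model n →L[ℝ] ℝ :=
    fderiv ℝ (oneFormInChart α x) (extChartAt (𝓡 n) x x)
  let a : Model n →L[ℝ] ℝ := α x
  let DX : Model n →L[ℝ] Model n := fderiv ℝ (fieldInChart X x) (extChartAt (𝓡 n) x x)
  let DY : Model n →L[ℝ] Model n := fderiv ℝ (fieldInChart Y x) (extChartAt (𝓡 n) x x)
  let u : Model n := X x
  let v : Model n := Y x
  change B u v - B v u = B u v + a (DY u) - (B v u + a (DX v)) - (a (DY u) - a (DX v))
  ring

/-- `d² = 0` on functions, by the symmetry of second derivatives. -/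
theorem extDeriv₁_mvfderiv {f : M → ℝ} (hf : SmoothFun n f) (x : M) :
    extDeriv₁ (mvfderiv (𝓡 n) f) x = 0 := by
  let g : Model n → ℝ := fun u => f ((extChartAt (𝓡 n) x).symm u)
  have hsm : ContDiffOn ℝ ∞ g (extChartAt (𝓡 n) x).target := by
    rw [← contMDiffOn_iff_contDiffOn]
    exact hf.comp_contMDiffOn (contMDiffOn_extChartAt_symm x)
  have hg : ContDiffAt ℝ ∞ g (extChartAt (𝓡 n) x x) :=
    hsm.contDiffAt ((isOpen_extChartAt_target x).mem_nhds (mem_extChartAt_target x))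
  have hsymm := (hg.isSymmSndFDerivAt (by simpa using ENat.LEInfty.out))
  have key : oneFormInChart (mvfderiv (𝓡 n) f) x =ᶠ[𝓝 (extChartAt (𝓡 n) x x)] fderiv ℝ g := by
    filter_upwards [(isOpen_extChartAt_target x).mem_nhds (mem_extChartAt_target x)] with u hu
    have h1 : MDifferentiableAt 𝓘(ℝ, Model n) (𝓡 n) (extChartAt (𝓡 n) x).symm u :=
      ((contMDiffOn_extChartAt_symm (I := 𝓡 n) (n := 1) x).contMDiffAt
        ((isOpen_extChartAt_target x).mem_nhds hu)).mdifferentiableAt (by simp)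
    have h2 := mfderiv_comp u (hf.mdiff _) h1
    have h3 : mfderiv 𝓘(ℝ, Model n) 𝓘(ℝ, ℝ) g u = _ := h2
    rw [mfderiv_eq_fderiv] at h3
    exact h3.symm
  ext v w
  have h : fderiv ℝ (oneFormInChart (mvfderiv (𝓡 n) f) x) (extChartAt (𝓡 n) x x) =
    fderiv ℝ (fderiv ℝ g) (extChartAt (𝓡 n) x x) := key.fderiv_eq
  rw [extDeriv₁, h, mfderiv_extChartAt_self]
  let B : Model n →L[ℝ] Model n →L[ℝ] ℝ := fderiv ℝ (fderiv ℝ g) (extChartAt (𝓡 n) x x)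
  let v' : Model n := v
  let w' : Model n := w
  change B v' w' - B w' v' = 0
  rw [sub_eq_zero]
  exact hsymm v' w'

variable [T2Space M]

/-- The Lie bracket of vector fields is the commutator of derivations: Cartan's formula for `df`. -/
theorem mvfderiv_mlieBracket {f : M → ℝ} (hf : SmoothFun n f) {X Y : VField n M}
    (hX : SmoothVField n X) (hY : SmoothVField n Y) (x : M) :
    mvfderiv (𝓡 n) f x (VectorField.mlieBracket (𝓡 n) X Y x) =
      mvfderiv (𝓡 n) (fun y => mvfderiv (𝓡 n) f y (Y y)) x (X x)
      - mvfderiv (𝓡 n) (fun y => mvfderiv (𝓡 n) f y (X y)) x (Y x) := by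
  have h := extDeriv₁_apply (smoothOneForm_mvfderiv hf) hX hY x
  rw [extDeriv₁_mvfderiv hf] at h
  have h0 : (0 : ℝ) = _ := h
  linarith

theorem SmoothVField.mlieBracket {X Y : VField n M}
    (hX : SmoothVField n X) (hY : SmoothVField n Y) :
    SmoothVField n (VectorField.mlieBracket (𝓡 n) X Y) :=
  smoothVField_of_apply fun f hf => by
    simp_rw [mvfderiv_mlieBracket hf hX hY]
    exact ((hf.mvfderiv_apply hY).mvfderiv_apply hX).sub
      ((hf.mvfderiv_apply hX).mvfderiv_apply hY)

end Cartan

end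

section

/-! ### Deformed brackets and Koszul brackets in a Lie ring with an additive module of functions -/

section LieRing

variable {L : Type*} [LieRing L]

/-- The bracket `[X, Y]_A = [AX, Y] + [X, AY] - A[X, Y]`. -/
def deform (A : L →+ L) (X Y : L) : L := ⁅A X, Y⁆ + ⁅X, A Y⁆ - A ⁅X, Y⁆

/-- The mixed torsion of two additive endomorphisms; for `A = B` it is the Nijenhuis torsion `[AX,
AY] - A [X, Y]_A`. -/
def mixedTorsion (A B : L →+ L) (X Y : L) : L :=
  ⁅A X, B Y⁆ - A ⁅X, B Y⁆ - B ⁅A X, Y⁆ + A (B ⁅X, Y⁆)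

/-- The mixed torsion with `B` is multiplicative in `A`, up to endomorphisms, if `A` and `B`
commute; this passes the vanishing of the torsion to powers. -/
theorem mixedTorsion_comp_left {A A' B : L →+ L} (h : ∀ X Y, mixedTorsion A B X Y = 0)
    (h' : ∀ X Y, mixedTorsion A' B X Y = 0) (hAB : ∀ X, A (B X) = B (A X)) (X Y : L) :
    mixedTorsion (A.comp A') B X Y = 0 := by
  have e : mixedTorsion (A.comp A') B X Y =
      mixedTorsion A B (A' X) Y + A (mixedTorsion A' B X Y) := by
    simp only [mixedTorsion, AddMonoidHom.comp_apply, map_sub, map_add, hAB]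
    abel
  rw [e, h, h', map_zero, add_zero]

theorem mixedTorsion_swap {A B : L →+ L} (hAB : ∀ X, A (B X) = B (A X)) (X Y : L) :
    mixedTorsion A B X Y = - mixedTorsion B A Y X := by
  simp only [mixedTorsion]
  rw [← lie_skew (A X) (B Y), ← lie_skew X (B Y), ← lie_skew (A X) Y, ← lie_skew X Y]
  simp only [map_neg, hAB]
  abel

/-- The deformed bracket of an endomorphism without torsion satisfies the Jacobi identity: after the
torsion is used once in each term, the cyclic sum is a combination of Jacobi identities of `L`. -/
theorem deform_jacobi {A : L →+ L} (h : ∀ X Y, ⁅A X, A Y⁆ = A (deform A X Y)) (X Y Z : L) :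
    deform A X (deform A Y Z) + deform A Y (deform A Z X) + deform A Z (deform A X Y) = 0 := by
  have e : ∀ X Y Z : L, deform A X (deform A Y Z) =
      ⁅A X, ⁅A Y, Z⁆⁆ + ⁅A X, ⁅Y, A Z⁆⁆ + ⁅X, ⁅A Y, A Z⁆⁆ - A ⁅A X, ⁅Y, Z⁆⁆ - A ⁅X, ⁅A Y, Z⁆⁆
        - A ⁅X, ⁅Y, A Z⁆⁆ + A (A ⁅X, ⁅Y, Z⁆⁆) := by
    intro X Y Z
    have h1 := h X ⁅Y, Z⁆
    rw [h Y Z]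
    simp only [deform, lie_add, lie_sub, map_add, map_sub] at h1 ⊢
    rw [h1]
    abel
  have j := lie_jacobi X Y Z
  have j1 := lie_jacobi (A X) (A Y) Z
  have j2 := lie_jacobi (A X) Y (A Z)
  have j3 := lie_jacobi X (A Y) (A Z)
  have k1 := lie_jacobi (A X) Y Z
  have k2 := lie_jacobi X (A Y) Z
  have k3 := lie_jacobi X Y (A Z)
  have e2 : deform A X (deform A Y Z) + deform A Y (deform A Z X) + deform A Z (deform A X Y) =
      (⁅A X, ⁅A Y, Z⁆⁆ + ⁅A Y, ⁅Z, A X⁆⁆ + ⁅Z, ⁅A X, A Y⁆⁆)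
      + (⁅A X, ⁅Y, A Z⁆⁆ + ⁅Y, ⁅A Z, A X⁆⁆ + ⁅A Z, ⁅A X, Y⁆⁆)
      + (⁅X, ⁅A Y, A Z⁆⁆ + ⁅A Y, ⁅A Z, X⁆⁆ + ⁅A Z, ⁅X, A Y⁆⁆)
      - A (⁅A X, ⁅Y, Z⁆⁆ + ⁅Y, ⁅Z, A X⁆⁆ + ⁅Z, ⁅A X, Y⁆⁆)
      - A (⁅X, ⁅A Y, Z⁆⁆ + ⁅A Y, ⁅Z, X⁆⁆ + ⁅Z, ⁅X, A Y⁆⁆)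
      - A (⁅X, ⁅Y, A Z⁆⁆ + ⁅Y, ⁅A Z, X⁆⁆ + ⁅A Z, ⁅X, Y⁆⁆)
      + A (A (⁅X, ⁅Y, Z⁆⁆ + ⁅Y, ⁅Z, X⁆⁆ + ⁅Z, ⁅X, Y⁆⁆)) := by
    rw [e X Y Z, e Y Z X, e Z X Y]
    simp only [map_add]
    abel
  rw [e2, j, j1, j2, j3, k1, k2, k3]
  simp

end LieRing

section Koszul

variable {L R Ω : Type*} [LieRing L] [AddCommGroup R] [LieRingModule L R] [AddCommGroup Ω]
  {p : Ω →+ L →+ R}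

variable (p) in
/-- `K` is the bracket of one-forms `[α, β]_Q = L_{Qα} β - L_{Qβ} α - d⟨β, Qα⟩` defined by
`Q : Ω → L`, in terms of the pairing `p` of one-forms with vector fields. The elements of `R` play
the role of functions, on which vector fields act; no product of functions is needed. -/
def IsKoszul (Q : Ω →+ L) (K : Ω → Ω → Ω) : Prop := ∀ α β X,
  p (K α β) X = ⁅Q α, p β X⁆ - ⁅Q β, p α X⁆ - ⁅X, p β (Q α)⁆ - p β ⁅Q α, X⁆ + p α ⁅Q β, X⁆

variable {Q Q' : Ω →+ L} {K K' : Ω → Ω → Ω} {A : L →+ L} {A' : Ω →+ Ω}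

/-- The failure of `[α, β]_{AQ} = [ᵗA α, β]_Q + [α, ᵗA β]_Q - ᵗA [α, β]_Q`, written in terms of `Q`
and `A` only. -/
theorem IsKoszul.compat_apply (hK : IsKoszul p Q K) (hK' : IsKoszul p Q' K')
    (hA : ∀ α X, p (A' α) X = p α (A X)) (hQ : ∀ α, Q' α = A (Q α)) (hQ' : ∀ α, Q' α = Q (A' α))
    (α β : Ω) (X : L) :
    p (K' α β - (K (A' α) β + K α (A' β) - A' (K α β))) X =
      ⁅X, p β (A (Q α))⁆ - ⁅A X, p β (Q α)⁆ - p β (⁅Q α, A X⁆ - A ⁅Q α, X⁆)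
        + p α (⁅Q β, A X⁆ - A ⁅Q β, X⁆) := by
  simp only [map_sub, map_add, AddMonoidHom.sub_apply, AddMonoidHom.add_apply, hA, hK _ _ _,
    hK' _ _ _, ← hQ', hQ]
  abel

/-- For `A` without torsion, the compatibility of `A` with `Q` implies that of `A` with `A Q`: the
failures for `(A Q, α, β)` and for `(Q, α, ᵗA β)` are equal. -/
theorem IsKoszul.compat_step (hp : Function.Injective p) {Q'' : Ω →+ L} {K'' : Ω → Ω → Ω}
    (hK : IsKoszul p Q K) (hK' : IsKoszul p Q' K') (hK'' : IsKoszul p Q'' K'')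
    (hA : ∀ α X, p (A' α) X = p α (A X)) (hQ : ∀ α, Q' α = A (Q α)) (hQ' : ∀ α, Q' α = Q (A' α))
    (hQ2 : ∀ α, Q'' α = A (Q' α)) (hQ2' : ∀ α, Q'' α = Q' (A' α))
    (ht : ∀ X Y, ⁅A X, A Y⁆ = A (deform A X Y))
    (hc : ∀ α β, K' α β = K (A' α) β + K α (A' β) - A' (K α β)) (α β : Ω) :
    K'' α β = K' (A' α) β + K' α (A' β) - A' (K' α β) := by
  rw [← sub_eq_zero]
  refine hp (AddMonoidHom.ext fun X => ?_)
  have h := hK.compat_apply hK' hA hQ hQ' α (A' β) X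
  rw [hc α (A' β), sub_self, map_zero, AddMonoidHom.zero_apply] at h
  rw [hK'.compat_apply hK'' hA hQ2 hQ2', map_zero, AddMonoidHom.zero_apply, h, ← hQ']
  simp only [hA, hQ, map_sub, ht, deform, map_add]
  abel

/-- If `A` is compatible with `Q' = A Q`, then `ᵗA` maps the bracket of `Q'` to the bracket of `Q`.
-/
theorem IsKoszul.transpose_bracket (hp : Function.Injective p) {Q'' : Ω →+ L} {K'' : Ω → Ω → Ω}
    (hK : IsKoszul p Q K) (hK' : IsKoszul p Q' K') (hK'' : IsKoszul p Q'' K'')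
    (hA : ∀ α X, p (A' α) X = p α (A X)) (hQ' : ∀ α, Q' α = Q (A' α))
    (hQ2 : ∀ α, Q'' α = A (Q' α)) (hQ2' : ∀ α, Q'' α = Q' (A' α))
    (hc : ∀ α β, K'' α β = K' (A' α) β + K' α (A' β) - A' (K' α β)) (α β : Ω) :
    A' (K' α β) = K (A' α) (A' β) := by
  refine hp (AddMonoidHom.ext fun X => ?_)
  have h := hK'.compat_apply hK'' hA hQ2 hQ2' α β X
  rw [hc α β, sub_self, map_zero, AddMonoidHom.zero_apply] at h
  rw [← sub_eq_zero]
  rw [h]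
  simp only [hA, hK _ _ _, hK' _ _ _, ← hQ', map_sub]
  abel

/-- If `Q` is compatible with the brackets, so is `Q' = A Q`, for `A` without torsion and compatible
with `Q`. -/
theorem IsKoszul.anchor_step (ht : ∀ X Y, ⁅A X, A Y⁆ = A (deform A X Y))
    (hQ : ∀ α, Q' α = A (Q α)) (hQ' : ∀ α, Q' α = Q (A' α))
    (hc : ∀ α β, K' α β = K (A' α) β + K α (A' β) - A' (K α β))
    (ha : ∀ α β, Q (K α β) = ⁅Q α, Q β⁆) (α β : Ω) : Q' (K' α β) = ⁅Q' α, Q' β⁆ := by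
  rw [hQ (K' α β), hc, map_sub, map_add, ← hQ', hQ (K α β), ha, ha, ha, ← hQ', ← hQ', hQ, hQ, ht]
  rfl

theorem IsKoszul.skew (hp : Function.Injective p) (hK : IsKoszul p Q K)
    (hs : ∀ α β, p β (Q α) = - p α (Q β)) (α β : Ω) : K α β = - K β α := by
  refine hp (AddMonoidHom.ext fun X => ?_)
  rw [map_neg, AddMonoidHom.neg_apply, hK, hK, hs α β, lie_neg]
  abel

theorem IsKoszul.add_left (hp : Function.Injective p) (hK : IsKoszul p Q K) (α β γ : Ω) :
    K (α + β) γ = K α γ + K β γ := by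
  refine hp (AddMonoidHom.ext fun X => ?_)
  simp only [map_add, AddMonoidHom.add_apply, hK _ _ _, add_lie, lie_add]
  abel

/-- The Jacobi identity for the bracket of one-forms, when `Q` is skew-symmetric and compatible with
the brackets. -/
theorem IsKoszul.jacobi (hp : Function.Injective p) (hK : IsKoszul p Q K)
    (hs : ∀ α β, p β (Q α) = - p α (Q β)) (ha : ∀ α β, Q (K α β) = ⁅Q α, Q β⁆) (α β γ : Ω) :
    K α (K β γ) + K β (K γ α) + K γ (K α β) = 0 := by
  refine hp (AddMonoidHom.ext fun X => ?_)
  have s1 := hs α β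
  have s2 := hs β γ
  have s3 := hs γ α
  have h := hs (K α β) γ
  have hX := congrArg (fun r => ⁅X, r⁆) h
  simp only [ha, hK _ _ _, s1, s3, lie_add, lie_sub, lie_neg] at hX
  have e1 : ⁅Q α, Q γ⁆ = -⁅Q γ, Q α⁆ := (lie_skew _ _).symm
  have e2 : ⁅Q β, Q α⁆ = -⁅Q α, Q β⁆ := (lie_skew _ _).symm
  have e3 : ⁅Q γ, Q β⁆ = -⁅Q β, Q γ⁆ := (lie_skew _ _).symm
  simp only [map_add, AddMonoidHom.add_apply, hK _ _ _, ha, lie_add, lie_sub, lie_lie, map_zero,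
    AddMonoidHom.zero_apply, map_sub, s1, s2, s3, lie_neg] at hX ⊢
  simp only [e1, e2, e3, map_neg, lie_neg] at hX ⊢
  linear_combination (norm := module) (-2 : ℤ) • hX

end Koszul

end

section

variable {n : ℕ} {M : Type*} [TopologicalSpace M] [ChartedSpace (Model n) M]
  [IsManifold (𝓡 n) ∞ M]

/-! ### The Lie ring of smooth vector fields and its modules of functions and one-forms -/

section

variable (n M)

/-- The smooth vector fields. -/
def smoothFields : AddSubgroup (VField n M) where
  carrier := {X | SmoothVField n X}
  add_mem' hX hY := ContMDiff.add_section hX hY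
  zero_mem' := Bundle.contMDiff_zeroSection ℝ _
  neg_mem' hX := ContMDiff.neg_section hX

/-- The smooth one-forms. -/
def smoothForms : AddSubgroup (OneForm n M) where
  carrier := {α | SmoothOneForm n α}
  add_mem' hX hY := ContMDiff.add_section hX hY
  zero_mem' := Bundle.contMDiff_zeroSection ℝ _
  neg_mem' hX := ContMDiff.neg_section hX

/-- The smooth functions. -/
def smoothFuns : AddSubgroup (M → ℝ) where
  carrier := {f | SmoothFun n f}
  add_mem' hX hY := ContMDiff.add hX hY
  zero_mem' := contMDiff_const
  neg_mem' hX := ContMDiff.neg hX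

end

variable [T2Space M]

/-- The Lie bracket of vector fields. -/
noncomputable instance : LieRing (smoothFields n M) where
  bracket X Y := ⟨VectorField.mlieBracket (𝓡 n) X.1 Y.1, SmoothVField.mlieBracket X.2 Y.2⟩
  add_lie X Y Z := by
    ext x
    exact VectorField.mlieBracket_add_left (X.2.mdifferentiableAt (by simp))
      (Y.2.mdifferentiableAt (by simp))
  lie_add X Y Z := by
    ext x
    exact VectorField.mlieBracket_add_right (Y.2.mdifferentiableAt (by simp))
      (Z.2.mdifferentiableAt (by simp))
  lie_self X := by
    ext x
    exact congrFun VectorField.mlieBracket_self x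
  leibniz_lie X Y Z := by
    ext x
    have h3 : minSmoothness ℝ 3 ≤ (∞ : WithTop ℕ∞) := by simpa using ENat.LEInfty.out
    have h2 : minSmoothness ℝ 2 ≤ (∞ : WithTop ℕ∞) := by simpa using ENat.LEInfty.out
    have : IsManifold (𝓡 n) (minSmoothness ℝ 3) M := IsManifold.of_le h3
    exact VectorField.leibniz_identity_mlieBracket_apply ((X.2 x).of_le h2) ((Y.2 x).of_le h2)
      ((Z.2 x).of_le h2)

/-- Vector fields act on functions by derivations. -/
noncomputable instance : LieRingModule (smoothFields n M) (smoothFuns n M) where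
  bracket X f := ⟨fun x => mvfderiv (𝓡 n) f.1 x (X.1 x), SmoothFun.mvfderiv_apply f.2 X.2⟩
  add_lie X Y f := by
    ext x
    exact map_add (mvfderiv (𝓡 n) f.1 x) (X.1 x) (Y.1 x)
  lie_add X f g := by
    ext x
    exact congrArg (fun L => L (X.1 x)) (mvfderiv_add_of_smooth f.2 g.2 x)
  leibniz_lie X Y f := by
    ext x
    have := mvfderiv_mlieBracket f.2 X.2 Y.2 x
    exact (sub_eq_iff_eq_add.1 this.symm)

/-- The pairing of smooth one-forms with smooth vector fields. -/
noncomputable def pairing : smoothForms n M →+ smoothFields n M →+ smoothFuns n M :=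
  AddMonoidHom.mk' (fun α => AddMonoidHom.mk'
    (fun X => ⟨fun x => α.1 x (X.1 x), SmoothOneForm.apply α.2 X.2⟩)
    fun X Y => by ext x; exact map_add (α.1 x) (X.1 x) (Y.1 x)) fun α β => rfl

theorem pairing_injective : Function.Injective (pairing (n := n) (M := M)) := by
  intro α β h
  ext1
  funext x
  refine oneForm_ext fun X hX => ?_
  exact congrFun (congrArg Subtype.val (congrArg (fun φ => φ ⟨X, hX⟩) h)) x

/-- A field of endomorphisms acts on smooth vector fields. -/
noncomputable def EndField.onFields (A : EndField n M)
    (hA : ∀ X : VField n M, SmoothVField n X → SmoothVField n (fun x => A x (X x))) :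
    smoothFields n M →+ smoothFields n M :=
  AddMonoidHom.mk' (fun X => ⟨fun x => A x (X.1 x), hA _ X.2⟩)
    fun X Y => by ext x; exact map_add (A x) (X.1 x) (Y.1 x)

/-- The transpose of a field of endomorphisms acts on smooth one-forms. -/
noncomputable def EndField.onForms (A : EndField n M)
    (hA : ∀ X : VField n M, SmoothVField n X → SmoothVField n (fun x => A x (X x))) :
    smoothForms n M →+ smoothForms n M :=
  AddMonoidHom.mk' (fun α => ⟨fun x => transpose A x (α.1 x),
    smoothOneForm_of_apply fun X hX => SmoothOneForm.apply α.2 (hA X hX)⟩)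
    fun α β => by ext x; rfl

/-- A contravariant 2-tensor maps smooth one-forms to smooth vector fields. -/
noncomputable def BiField.onForms (Q : BiField n M)
    (hQ : ∀ α : OneForm n M, SmoothOneForm n α → SmoothVField n (fun x => Q x (α x))) :
    smoothForms n M →+ smoothFields n M :=
  AddMonoidHom.mk' (fun α => ⟨fun x => Q x (α.1 x), hQ _ α.2⟩)
    fun α β => by ext x; exact map_add (Q x) (α.1 x) (β.1 x)

/-- The bracket of one-forms in terms of Lie brackets of vector fields, by Cartan's formula. It is
the identity that defines `IsKoszul`. -/
theorem koszul_apply {Q : BiField n M}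
    (hQ : ∀ α : OneForm n M, SmoothOneForm n α → SmoothVField n (fun x => Q x (α x)))
    {α β : OneForm n M} (hα : SmoothOneForm n α) (hβ : SmoothOneForm n β) {X : VField n M}
    (hX : SmoothVField n X) (x : M) :
    koszul Q α β x (X x) = mvfderiv (𝓡 n) (fun y => β y (X y)) x (Q x (α x))
      - mvfderiv (𝓡 n) (fun y => α y (X y)) x (Q x (β x))
      - mvfderiv (𝓡 n) (fun y => β y (Q y (α y))) x (X x)
      - β x (VectorField.mlieBracket (𝓡 n) (fun y => Q y (α y)) X x)
      + α x (VectorField.mlieBracket (𝓡 n) (fun y => Q y (β y)) X x) := by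
  have h1 := extDeriv₁_apply hβ (hQ α hα) hX x
  have h2 := extDeriv₁_apply hα (hQ β hβ) hX x
  have e2 : koszul Q α β x (X x) = extDeriv₁ β x (Q x (α x)) (X x)
      + mvfderiv (𝓡 n) (fun y => β y (Q y (α y))) x (X x)
      - (extDeriv₁ α x (Q x (β x)) (X x) + mvfderiv (𝓡 n) (fun y => α y (Q y (β y))) x (X x))
      - mvfderiv (𝓡 n) (fun y => β y (Q y (α y))) x (X x) := rfl
  rw [e2, h1, h2]
  ring

/-- The smooth bivectors: contravariant 2-tensors that are skew-symmetric and map smooth one-forms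
to smooth vector fields. -/
structure IsBivector (Q : BiField n M) : Prop where
  smooth : ∀ α : OneForm n M, SmoothOneForm n α → SmoothVField n (fun x => Q x (α x))
  skew : ∀ x (α β : TangentSpace (𝓡 n) x →L[ℝ] ℝ), β (Q x α) = - α (Q x β)

theorem IsBivector.smooth_koszul {Q : BiField n M} (hQ : IsBivector Q) {α β : OneForm n M}
    (hα : SmoothOneForm n α) (hβ : SmoothOneForm n β) : SmoothOneForm n (koszul Q α β) := by
  refine smoothOneForm_of_apply fun X hX => ?_
  simp_rw [koszul_apply hQ.smooth hα hβ hX]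
  have h1 := hQ.smooth α hα
  have h2 := hQ.smooth β hβ
  exact (((((hβ.apply hX).mvfderiv_apply h1).sub ((hα.apply hX).mvfderiv_apply h2)).sub
    ((hβ.apply h1).mvfderiv_apply hX)).sub (hβ.apply (h1.mlieBracket hX))).add
    (hα.apply (h2.mlieBracket hX))

/-- The Koszul bracket on smooth one-forms. -/
noncomputable def IsBivector.bracket {Q : BiField n M} (hQ : IsBivector Q) (α β : smoothForms n M) :
    smoothForms n M := ⟨koszul Q α.1 β.1, hQ.smooth_koszul α.2 β.2⟩

theorem IsBivector.isKoszul {Q : BiField n M} (hQ : IsBivector Q) :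
    IsKoszul pairing (Q.onForms hQ.smooth) hQ.bracket := by
  intro α β X
  ext x
  exact koszul_apply hQ.smooth α.2 β.2 X.2 x

theorem IsBivector.onForms_skew {Q : BiField n M} (hQ : IsBivector Q) (α β : smoothForms n M) :
    pairing β (Q.onForms hQ.smooth α) = - pairing α (Q.onForms hQ.smooth β) := by
  ext x
  exact hQ.skew x _ _

end

section

variable {n : ℕ} {M : Type*} [TopologicalSpace M] [ChartedSpace (Model n) M]
  [IsManifold (𝓡 n) ∞ M]

/-! ### Tensorial operations on smooth sections -/

section Tensorial

variable {F : Type*} [NormedAddCommGroup F] [NormedSpace ℝ F] {A : M → Type*}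
  [TopologicalSpace (TotalSpace F A)] [∀ x, TopologicalSpace (A x)]
  [∀ x, AddCommGroup (A x)] [∀ x, Module ℝ (A x)] [FiberBundle F A]
  {W : Type*} [AddCommGroup W] [Module ℝ W]

variable (n F) in
/-- The operation `Φ` on smooth sections of `A` is additive, and linear over smooth functions at
the point `x`. -/
structure IsTensorialAt (Φ : (Π x, A x) → W) (x : M) : Prop where
  add : ∀ s t, SmoothSection n F s → SmoothSection n F t → Φ (s + t) = Φ s + Φ t
  smul : ∀ (f : M → ℝ) s, SmoothFun n f → SmoothSection n F s → Φ (f • s) = f x • Φ s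

variable [VectorBundle ℝ F A]

theorem IsTensorialAt.sum {Φ : (Π x, A x) → W} {x : M} (h : IsTensorialAt n F Φ x) {ι : Type*}
    (t : Finset ι) (f : ι → M → ℝ) (s : ι → Π x, A x) (hf : ∀ i, SmoothFun n (f i))
    (hs : ∀ i, SmoothSection n F (s i)) :
    Φ (fun y => ∑ i ∈ t, f i y • s i y) = ∑ i ∈ t, f i x • Φ (s i) := by
  classical
  induction t using Finset.induction_on with
  | empty =>
    simp only [Finset.sum_empty]
    have h0 := h.smul (fun _ => 0) (fun _ => 0) contMDiff_const (Bundle.contMDiff_zeroSection ℝ _)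
    rw [zero_smul] at h0
    convert h0 using 2
    funext y
    simp
  | insert a t ha ih =>
    simp only [Finset.sum_insert ha]
    rw [← ih, ← h.smul _ _ (hf a) (hs a)]
    exact h.add _ _ (ContMDiff.smul_section (hf a) (hs a))
      (ContMDiff.sum_section fun i _ => ContMDiff.smul_section (hf i) (hs i))

end Tensorial

section TensorialFrame

variable {W : Type*} [AddCommGroup W] [Module ℝ W] {x : M}

theorem IsTensorialAt.vField_eq {Φ : VField n M → W} (h : IsTensorialAt n (Model n) Φ x)
    (c : CutoffFrame n x) {X : VField n M} (hX : SmoothVField n X) :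
    Φ X = ∑ i, mvfderiv (𝓡 n) (c.f i) x (X x) • Φ (c.E i) := by
  rw [← h.sum _ (fun i y => mvfderiv (𝓡 n) (c.f i) y (X y)) _
    (fun i => (c.smooth_f i).mvfderiv_apply hX) c.smooth_E]
  have h1 := h.smul c.ψ X c.smooth_ψ hX
  rw [c.ψ_self, one_smul] at h1
  rw [← h1]
  congr 1
  funext y
  exact (c.sum_eq (X y)).symm

theorem IsTensorialAt.oneForm_eq [T2Space M] {Φ : OneForm n M → W}
    (h : IsTensorialAt n (Model n →L[ℝ] ℝ) Φ x)
    (c : CutoffFrame n x) {α : OneForm n M} (hα : SmoothOneForm n α) :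
    Φ α = ∑ i, α x (c.E i x) • Φ (mvfderiv (𝓡 n) (c.f i)) := by
  rw [← h.sum _ (fun i y => α y (c.E i y)) _
    (fun i => hα.apply (c.smooth_E i)) (fun i => smoothOneForm_mvfderiv (c.smooth_f i))]
  have h1 := h.smul c.ψ α c.smooth_ψ hα
  rw [c.ψ_self, one_smul] at h1
  rw [← h1]
  congr 1
  funext y
  ext v
  have h2 := congrArg (α y) (c.sum_eq v)
  rw [map_smul, map_sum] at h2
  simp only [map_smul] at h2
  change c.ψ y • α y v = _
  rw [← h2]
  simp [mul_comm]

/-- A tensorial operation at `x` depends linearly on the value of the section at `x`. -/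
theorem IsTensorialAt.exists_clm [T2Space M] [TopologicalSpace W] [IsTopologicalAddGroup W]
    [ContinuousSMul ℝ W] {Φ : VField n M → W} (h : IsTensorialAt n (Model n) Φ x) :
    ∃ T : TangentSpace (𝓡 n) x →L[ℝ] W, ∀ X, SmoothVField n X → T (X x) = Φ X := by
  obtain ⟨c⟩ := exists_cutoffFrame (n := n) x
  refine ⟨∑ i, (mvfderiv (𝓡 n) (c.f i) x).smulRight (Φ (c.E i)), fun X hX => ?_⟩
  rw [h.vField_eq c hX, _root_.sum_apply]
  rfl

end TensorialFrame

/-! ### The Lie algebroids defined by a Nijenhuis tensor and by a Poisson bivector -/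

variable [T2Space M]

theorem mlieBracket_smul_right {f : M → ℝ} (hf : SmoothFun n f) {X Y : VField n M}
    (hY : SmoothVField n Y) (x : M) :
    VectorField.mlieBracket (𝓡 n) X (fun y => f y • Y y) x =
      mvfderiv (𝓡 n) f x (X x) • Y x + f x • VectorField.mlieBracket (𝓡 n) X Y x :=
  VectorField.mlieBracket_smul_right (hf.mdiff x) (hY.mdifferentiableAt (by simp))

theorem mvfderiv_mul_of_smooth {f g : M → ℝ} (hf : SmoothFun n f) (hg : SmoothFun n g) (x : M) :
    mvfderiv (𝓡 n) (fun y => f y * g y) x = f x • mvfderiv (𝓡 n) g x + g x • mvfderiv (𝓡 n) f x :=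
  mvfderiv_mul (hf.mdiff x) (hg.mdiff x)

/-- A field of endomorphisms that preserves smoothness of vector fields and whose Nijenhuis torsion
vanishes. -/
structure IsNijenhuisField (A : EndField n M) : Prop where
  smooth : ∀ X : VField n M, SmoothVField n X → SmoothVField n (fun x => A x (X x))
  torsion : ∀ X Y : smoothFields n M,
    ⁅A.onFields smooth X, A.onFields smooth Y⁆ = A.onFields smooth (deform (A.onFields smooth) X Y)

/-- `TM` with anchor `A` and the deformed bracket is a Lie algebroid if `A` has no torsion. -/
theorem IsNijenhuisField.isLieAlgebroid {A : EndField n M} (hA : IsNijenhuisField A) :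
    IsLieAlgebroid (Model n) (tangentAlgebroid A) where
  smooth_anchor := hA.smooth
  smooth_bracket X Y hX hY :=
    (deform (A.onFields hA.smooth) (⟨X, hX⟩ : smoothFields n M) ⟨Y, hY⟩).2
  add_bracket X Y Z hX hY hZ := by
    let X' : smoothFields n M := ⟨X, hX⟩
    let Y' : smoothFields n M := ⟨Y, hY⟩
    let Z' : smoothFields n M := ⟨Z, hZ⟩
    have h : deform (A.onFields hA.smooth) (X' + Y') Z' =
        deform (A.onFields hA.smooth) X' Z' + deform (A.onFields hA.smooth) Y' Z' := by
      simp only [deform, map_add, add_lie]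
      abel
    exact congrArg Subtype.val h
  skew X Y hX hY := by
    let X' : smoothFields n M := ⟨X, hX⟩
    let Y' : smoothFields n M := ⟨Y, hY⟩
    have h : deform (A.onFields hA.smooth) X' Y' = - deform (A.onFields hA.smooth) Y' X' := by
      simp only [deform]
      rw [← lie_skew _ Y', ← lie_skew X' (A.onFields hA.smooth Y'), ← lie_skew X' Y', map_neg]
      abel
    exact congrArg Subtype.val h
  jacobi X Y Z hX hY hZ :=
    congrArg Subtype.val (deform_jacobi hA.torsion (⟨X, hX⟩ : smoothFields n M) ⟨Y, hY⟩ ⟨Z, hZ⟩)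
  leibniz X Y f hX hY hf := by
    funext x
    change deformedBracket A X (fun x => f x • Y x) x = f x • deformedBracket A X Y x +
      mvfderiv (𝓡 n) f x (A x (X x)) • Y x
    have e : (fun y => A y (f y • Y y)) = fun y => f y • A y (Y y) :=
      funext fun y => map_smul (A y) _ _
    simp only [deformedBracket, e]
    rw [mlieBracket_smul_right hf hY, mlieBracket_smul_right hf (hA.smooth Y hY),
      mlieBracket_smul_right hf hY, map_add, map_smul, map_smul]
    module
  anchor_bracket X Y hX hY :=
    (congrArg Subtype.val (hA.torsion (⟨X, hX⟩ : smoothFields n M) ⟨Y, hY⟩)).symm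

/-- A bivector whose map from one-forms to vector fields is compatible with the brackets. -/
structure IsPoissonBivector (Q : BiField n M) : Prop extends IsBivector Q where
  anchor : ∀ α β : smoothForms n M, Q.onForms smooth (toIsBivector.bracket α β) =
    ⁅Q.onForms smooth α, Q.onForms smooth β⁆

theorem IsBivector.koszul_smul_right {Q : BiField n M} (hQ : IsBivector Q) {α β : OneForm n M}
    (hα : SmoothOneForm n α) (hβ : SmoothOneForm n β) {f : M → ℝ} (hf : SmoothFun n f) (x : M) :
    koszul Q α (fun y => f y • β y) x =
      f x • koszul Q α β x + mvfderiv (𝓡 n) f x (Q x (α x)) • β x := by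
  have hfβ : SmoothOneForm n (fun y => f y • β y) := ContMDiff.smul_section hf hβ
  ext v
  obtain ⟨X, hX, rfl⟩ := exists_smoothVField_eq x v
  have hb := hQ.smooth β hβ
  have ha := hQ.smooth α hα
  have e : (fun y => Q y (f y • β y)) = fun y => f y • Q y (β y) :=
    funext fun y => map_smul (Q y) _ _
  have e1 : (fun y => (f y • β y) (X y)) = fun y => f y * β y (X y) := rfl
  have e2 : (fun y => (f y • β y) (Q y (α y))) = fun y => f y * β y (Q y (α y)) := rfl
  change koszul Q α (fun y => f y • β y) x (X x) =
    f x * koszul Q α β x (X x) + mvfderiv (𝓡 n) f x (Q x (α x)) * β x (X x)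
  rw [koszul_apply hQ.smooth hα hfβ hX, koszul_apply hQ.smooth hα hβ hX, e1, e2,
    mvfderiv_mul_of_smooth hf (hβ.apply hX), mvfderiv_mul_of_smooth hf (hβ.apply ha), e]
  have e3 := VectorField.mlieBracket_smul_left (I := 𝓡 n) (W := X) (hf.mdiff x)
    (hb.mdifferentiableAt (x := x) (by simp))
  have e4 : VectorField.mlieBracket (𝓡 n) (fun y => f y • Q y (β y)) X x = _ := e3
  rw [e4]
  simp only [map_add, map_smul, map_neg, smul_eq_mul, _root_.add_apply, _root_.smul_apply,
    hQ.skew x (β x) (α x), neg_smul]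
  ring

theorem IsBivector.koszul_skew {Q : BiField n M} (hQ : IsBivector Q) {α β : OneForm n M}
    (hα : SmoothOneForm n α) (hβ : SmoothOneForm n β) : koszul Q α β = - koszul Q β α := by
  have h := hQ.isKoszul.skew pairing_injective hQ.onForms_skew (⟨α, hα⟩ : smoothForms n M) ⟨β, hβ⟩
  funext x
  exact congrFun (congrArg Subtype.val h) x

theorem IsBivector.koszul_add_left {Q : BiField n M} (hQ : IsBivector Q) {α β γ : OneForm n M}
    (hα : SmoothOneForm n α) (hβ : SmoothOneForm n β) (hγ : SmoothOneForm n γ) :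
    koszul Q (α + β) γ = koszul Q α γ + koszul Q β γ := by
  have h := hQ.isKoszul.add_left pairing_injective (⟨α, hα⟩ : smoothForms n M) ⟨β, hβ⟩ ⟨γ, hγ⟩
  exact congrArg Subtype.val h

theorem IsPoissonBivector.koszul_jacobi {Q : BiField n M} (hQ : IsPoissonBivector Q)
    {α β γ : OneForm n M}
    (hα : SmoothOneForm n α) (hβ : SmoothOneForm n β) (hγ : SmoothOneForm n γ) :
    koszul Q α (koszul Q β γ) + koszul Q β (koszul Q γ α) + koszul Q γ (koszul Q α β) = 0 := by
  have h := hQ.isKoszul.jacobi pairing_injective hQ.onForms_skew hQ.anchor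
    (⟨α, hα⟩ : smoothForms n M) ⟨β, hβ⟩ ⟨γ, hγ⟩
  exact congrArg Subtype.val h

/-- `T*M` with anchor `Q` and the bracket of one-forms is a Lie algebroid. -/
theorem IsPoissonBivector.isLieAlgebroid {Q : BiField n M} (hQ : IsPoissonBivector Q) :
    IsLieAlgebroid (Model n →L[ℝ] ℝ) (cotangentAlgebroid Q) where
  smooth_anchor := hQ.smooth
  smooth_bracket X Y hX hY := hQ.smooth_koszul hX hY
  add_bracket X Y Z hX hY hZ := hQ.koszul_add_left hX hY hZ
  skew X Y hX hY := hQ.koszul_skew hX hY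
  jacobi X Y Z hX hY hZ := hQ.koszul_jacobi hX hY hZ
  leibniz X Y f hX hY hf := by
    funext x
    exact hQ.koszul_smul_right hX hY hf x
  anchor_bracket X Y hX hY := by
    have h := hQ.anchor (⟨X, hX⟩ : smoothForms n M) ⟨Y, hY⟩
    exact congrArg Subtype.val h

end

section

variable {n : ℕ} {M : Type*} [TopologicalSpace M] [ChartedSpace (Model n) M]
  [IsManifold (𝓡 n) ∞ M] [T2Space M]

/-! ### The hierarchy of a Poisson-Nijenhuis structure -/

theorem IsBivector.smooth_hamiltonian {Q : BiField n M} (hQ : IsBivector Q) {f : M → ℝ}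
    (hf : SmoothFun n f) : SmoothVField n (hamiltonian Q f) :=
  hQ.smooth _ (smoothOneForm_mvfderiv hf)

theorem IsBivector.poissonBracket_skew {Q : BiField n M} (hQ : IsBivector Q) (f g : M → ℝ) (x : M) :
    poissonBracket Q f g x = - poissonBracket Q g f x := hQ.skew x _ _

/-- `[df, dg]_Q = d{f, g}`. -/
theorem IsBivector.koszul_mvfderiv {Q : BiField n M} (hQ : IsBivector Q) {f g : M → ℝ}
    (hf : SmoothFun n f) (hg : SmoothFun n g) :
    koszul Q (mvfderiv (𝓡 n) f) (mvfderiv (𝓡 n) g) = mvfderiv (𝓡 n) (poissonBracket Q f g) := by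
  funext x
  refine oneForm_ext (β := mvfderiv (𝓡 n) (poissonBracket Q f g)) fun X hX => ?_
  have hb : mvfderiv (𝓡 n) g x
      (VectorField.mlieBracket (𝓡 n) (fun y => Q y (mvfderiv (𝓡 n) f y)) X x) = _ :=
    mvfderiv_mlieBracket hg (hQ.smooth_hamiltonian hf) hX x
  have hb' : mvfderiv (𝓡 n) f x
      (VectorField.mlieBracket (𝓡 n) (fun y => Q y (mvfderiv (𝓡 n) g y)) X x) = _ :=
    mvfderiv_mlieBracket hf (hQ.smooth_hamiltonian hg) hX x
  rw [koszul_apply hQ.smooth (smoothOneForm_mvfderiv hf) (smoothOneForm_mvfderiv hg) hX, hb, hb']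
  have e : (fun y => mvfderiv (𝓡 n) f y (hamiltonian Q g y)) =
      -(poissonBracket Q f g) := funext fun y => by
    rw [Pi.neg_apply, hQ.poissonBracket_skew, neg_neg]; rfl
  have e2 : mvfderiv (𝓡 n) (-(poissonBracket Q f g)) x = -mvfderiv (𝓡 n) (poissonBracket Q f g) x :=
    mvfderiv_neg
  rw [e, e2]
  change mvfderiv (𝓡 n) (fun y => mvfderiv (𝓡 n) g y (X y)) x (hamiltonian Q f x) -
    mvfderiv (𝓡 n) (fun y => mvfderiv (𝓡 n) f y (X y)) x (hamiltonian Q g x) -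
    mvfderiv (𝓡 n) (poissonBracket Q f g) x (X x) -
    (_ - mvfderiv (𝓡 n) (poissonBracket Q f g) x (X x)) +
    (_ - - mvfderiv (𝓡 n) (poissonBracket Q f g) x (X x)) = _
  ring

/-- `Q` is compatible with the brackets on exact one-forms: this is the Jacobi identity of the
Poisson bracket. -/
theorem IsBivector.bracket_hamiltonian {Q : BiField n M} (hQ : IsBivector Q)
    (hj : ∀ f g h : M → ℝ, SmoothFun n f → SmoothFun n g → SmoothFun n h → ∀ x,
      poissonBracket Q f (poissonBracket Q g h) x + poissonBracket Q g (poissonBracket Q h f) x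
        + poissonBracket Q h (poissonBracket Q f g) x = 0) {f g : M → ℝ}
    (hf : SmoothFun n f) (hg : SmoothFun n g) (x : M) :
    Q x (koszul Q (mvfderiv (𝓡 n) f) (mvfderiv (𝓡 n) g) x) =
      VectorField.mlieBracket (𝓡 n) (hamiltonian Q f) (hamiltonian Q g) x := by
  rw [hQ.koszul_mvfderiv hf hg]
  refine tangentVector_ext fun h hh => ?_
  rw [mvfderiv_mlieBracket hh (hQ.smooth_hamiltonian hf) (hQ.smooth_hamiltonian hg)]
  have h1 := hj f g h hf hg hh x
  have h2 := hQ.poissonBracket_skew h (poissonBracket Q f g) x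
  have e : poissonBracket Q h f = -(poissonBracket Q f h) := funext fun y =>
    hQ.poissonBracket_skew h f y
  have h3 : poissonBracket Q g (poissonBracket Q h f) x =
      -poissonBracket Q g (poissonBracket Q f h) x := by
    rw [e, poissonBracket, mvfderiv_neg]; rfl
  change poissonBracket Q (poissonBracket Q f g) h x =
    poissonBracket Q f (poissonBracket Q g h) x - poissonBracket Q g (poissonBracket Q f h) x
  linarith

/-- The obstruction to `Q` being compatible with the brackets is tensorial in the right argument. -/
theorem IsBivector.isTensorialAt_right {Q : BiField n M} (hQ : IsBivector Q) {α : OneForm n M}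
    (hα : SmoothOneForm n α) (x : M) :
    IsTensorialAt n (Model n →L[ℝ] ℝ) (fun β : OneForm n M => Q x (koszul Q α β x) -
      VectorField.mlieBracket (𝓡 n) (fun y => Q y (α y)) (fun y => Q y (β y)) x) x where
  add β γ hβ hγ := by
    have h1 : koszul Q α (β + γ) x = koszul Q α β x + koszul Q α γ x := by
      rw [hQ.koszul_skew hα (ContMDiff.add_section hβ hγ), hQ.koszul_add_left hβ hγ hα,
        hQ.koszul_skew hα hβ, hQ.koszul_skew hα hγ, neg_add]
      rfl
    have h2 : VectorField.mlieBracket (𝓡 n) (fun y => Q y (α y)) (fun y => Q y ((β + γ) y)) x =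
        VectorField.mlieBracket (𝓡 n) (fun y => Q y (α y)) (fun y => Q y (β y)) x +
        VectorField.mlieBracket (𝓡 n) (fun y => Q y (α y)) (fun y => Q y (γ y)) x := by
      have e : (fun y => Q y ((β + γ) y)) = (fun y => Q y (β y)) + fun y => Q y (γ y) :=
        funext fun y => map_add (Q y) _ _
      rw [e]
      exact VectorField.mlieBracket_add_right ((hQ.smooth β hβ).mdifferentiableAt (by simp))
        ((hQ.smooth γ hγ).mdifferentiableAt (by simp))
    simp only [h1, h2, map_add]
    abel
  smul f β hf hβ := by
    have h1 := hQ.koszul_smul_right hα hβ hf x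
    have e : (fun y => Q y ((f • β) y)) = fun y => f y • Q y (β y) :=
      funext fun y => map_smul (Q y) _ _
    have h2 := mlieBracket_smul_right hf (X := fun y => Q y (α y)) (hQ.smooth β hβ) x
    have h1' : koszul Q α (f • β) x = _ := h1
    simp only [e, h1', h2, map_add, map_smul]
    module

/-- A Poisson bivector is compatible with the brackets of all one-forms, because the obstruction is
tensorial in each argument and one-forms are locally combinations of exact ones. -/
theorem IsPoisson.isPoissonBivector {P : BiField n M} (hP : IsPoisson P) : IsPoissonBivector P := by
  have hQ : IsBivector P := ⟨fun α hα => smoothVField_biField_apply hP.smooth hα, hP.skew⟩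
  refine ⟨hQ, fun α β => ?_⟩
  have key : ∀ α β : OneForm n M, SmoothOneForm n α → SmoothOneForm n β →
      (∀ x, ∀ g, SmoothFun n g → P x (koszul P α (mvfderiv (𝓡 n) g) x) =
        VectorField.mlieBracket (𝓡 n) (fun y => P y (α y)) (hamiltonian P g) x) →
      ∀ x, P x (koszul P α β x) =
        VectorField.mlieBracket (𝓡 n) (fun y => P y (α y)) (fun y => P y (β y)) x := by
    intro α β hα hβ h x
    obtain ⟨c⟩ := exists_cutoffFrame (n := n) x
    have h1 := (hQ.isTensorialAt_right hα x).oneForm_eq c hβ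
    rw [← sub_eq_zero, h1]
    refine Finset.sum_eq_zero fun i _ => ?_
    rw [h x _ (c.smooth_f i)]
    exact (congrArg _ (sub_self _)).trans (smul_zero _)
  apply Subtype.ext
  funext x
  refine key α.1 β.1 α.2 β.2 (fun x g hg => ?_) x
  have hdg := smoothOneForm_mvfderiv hg
  have h2 := key (mvfderiv (𝓡 n) g) α.1 hdg α.2
    (fun x f hf => hQ.bracket_hamiltonian hP.jacobi hg hf x) x
  rw [hQ.koszul_skew α.2 hdg, VectorField.mlieBracket_swap_apply, Pi.neg_apply, map_neg, h2]
  rfl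

section Hierarchy

variable {P : BiField n M} {N : EndField n M}

theorem npow_succ_apply (N : EndField n M) (k : ℕ) (x : M) (v : TangentSpace (𝓡 n) x) :
    npow N (k + 1) x v = N x (npow N k x v) := by
  simp [npow, pow_succ']

theorem npow_succ_apply' (N : EndField n M) (k : ℕ) (x : M) (v : TangentSpace (𝓡 n) x) :
    npow N (k + 1) x v = npow N k x (N x v) := by
  simp [npow, pow_succ]

theorem npow_zero_apply (N : EndField n M) (x : M) (v : TangentSpace (𝓡 n) x) :
    npow N 0 x v = v := by
  simp [npow]

theorem hierarchy_succ_apply (N : EndField n M) (P : BiField n M) (k : ℕ) (x : M)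
    (α : TangentSpace (𝓡 n) x →L[ℝ] ℝ) :
    hierarchy N P (k + 1) x α = N x (hierarchy N P k x α) := npow_succ_apply N k x _

theorem IsNijenhuisField.smooth_npow (hN : IsNijenhuisField N) (k : ℕ) :
    ∀ X : VField n M, SmoothVField n X → SmoothVField n (fun x => npow N k x (X x)) := by
  induction k with
  | zero => intro _ hX; simpa only [npow_zero_apply] using hX
  | succ k ih => intro _ hX; simpa only [npow_succ_apply] using hN.smooth _ (ih _ hX)

theorem IsNijenhuis.isNijenhuisField (hN : IsNijenhuis N) : IsNijenhuisField N where
  smooth _ hX := smoothVField_endField_apply hN.smooth hX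
  torsion X Y := Subtype.ext (funext fun x => hN.torsion X.1 Y.1 X.2 Y.2 x)

/-- The mixed torsion of `N ^ i` and `N ^ j` vanishes. -/
theorem IsNijenhuisField.mixedTorsion_npow (hN : IsNijenhuisField N) (i j : ℕ)
    (X Y : smoothFields n M) :
    mixedTorsion ((npow N i).onFields (hN.smooth_npow i)) ((npow N j).onFields (hN.smooth_npow j))
      X Y = 0 := by
  let A : ℕ → smoothFields n M →+ smoothFields n M := fun i =>
    (npow N i).onFields (hN.smooth_npow i)
  have hA : ∀ i, A (i + 1) = (N.onFields hN.smooth).comp (A i) := fun i => by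
    ext X x : 3
    exact npow_succ_apply N i x _
  have hA0 : A 0 = AddMonoidHom.id _ := by
    ext X x : 3
    exact npow_zero_apply N x _
  have hcomm : ∀ i X, N.onFields hN.smooth (A i X) = A i (N.onFields hN.smooth X) := fun i X => by
    apply Subtype.ext
    funext x
    exact (npow_succ_apply N i x _).symm.trans (npow_succ_apply' N i x _)
  have hNN : ∀ X Y, mixedTorsion (N.onFields hN.smooth) (N.onFields hN.smooth) X Y = 0 := by
    intro X Y
    simp only [mixedTorsion, hN.torsion, deform, map_add, map_sub]
    abel
  have h1 : ∀ i X Y, mixedTorsion (A i) (N.onFields hN.smooth) X Y = 0 := by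
    intro i
    induction i with
    | zero => intro X Y; rw [hA0]; simp [mixedTorsion]
    | succ i ih => rw [hA]; exact mixedTorsion_comp_left hNN ih fun X => rfl
  have h2 : ∀ i X Y, mixedTorsion (N.onFields hN.smooth) (A i) X Y = 0 := fun i X Y => by
    rw [mixedTorsion_swap (hcomm i), h1, neg_zero]
  change mixedTorsion (A i) (A j) X Y = 0
  revert X Y
  induction i with
  | zero => intro X Y; rw [hA0]; simp [mixedTorsion]
  | succ i ih => rw [hA]; exact mixedTorsion_comp_left (h2 j) ih (hcomm j)

theorem IsNijenhuisField.npow (hN : IsNijenhuisField N) (k : ℕ) : IsNijenhuisField (npow N k) where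
  smooth := hN.smooth_npow k
  torsion X Y := by
    have h := hN.mixedTorsion_npow k k X Y
    rw [mixedTorsion] at h
    rw [deform, map_sub, map_add]
    rw [← sub_eq_zero, ← h]
    abel

/-- `N` is a morphism of Lie algebroids from `(TM, N ^ (k + 1))` to `(TM, N ^ k)`. -/
theorem IsNijenhuisField.apply_deformedBracket (hN : IsNijenhuisField N) (k : ℕ)
    (X Y : VField n M) (hX : SmoothVField n X) (hY : SmoothVField n Y) (x : M) :
    N x (deformedBracket (PNModular.npow N (k + 1)) X Y x) =
      deformedBracket (PNModular.npow N k) (fun y => N y (X y)) (fun y => N y (Y y)) x := by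
  let A : ℕ → smoothFields n M →+ smoothFields n M := fun i =>
    (PNModular.npow N i).onFields (hN.smooth_npow i)
  have hA1 : ∀ X, A 1 X = N.onFields hN.smooth X := fun X => by
    apply Subtype.ext
    funext x
    simp [A, EndField.onFields, PNModular.npow]
  have hA : ∀ i X, A (i + 1) X = A i (A 1 X) := fun i X => by
    rw [hA1]
    apply Subtype.ext
    funext x
    exact npow_succ_apply' N i x _
  have hA' : ∀ i X, A (i + 1) X = A 1 (A i X) := fun i X => by
    rw [hA1]
    apply Subtype.ext
    funext x
    exact npow_succ_apply N i x _
  have key : ∀ X Y, A 1 (deform (A (k + 1)) X Y) = deform (A k) (A 1 X) (A 1 Y) := by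
    intro X Y
    have h1 := hN.mixedTorsion_npow (k + 1) 1 X Y
    have h2 := hN.mixedTorsion_npow 1 (k + 1) X Y
    have h3 := hN.mixedTorsion_npow 1 1 X Y
    change mixedTorsion (A (k + 1)) (A 1) X Y = 0 at h1
    change mixedTorsion (A 1) (A (k + 1)) X Y = 0 at h2
    change mixedTorsion (A 1) (A 1) X Y = 0 at h3
    have h4 := congrArg (A k) h3
    simp only [mixedTorsion, map_add, map_sub, map_zero, ← hA, ← hA'] at h1 h2 h4
    simp only [deform, map_add, map_sub, ← hA, ← hA']
    have h5 : A k (A (1 + 1) ⁅X, Y⁆) = A (k + 1 + 1) ⁅X, Y⁆ := by rw [hA 1, hA (k + 1), hA k]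
    rw [h5] at h4
    linear_combination (norm := abel) h4 - h1 - h2
  have h := key ⟨X, hX⟩ ⟨Y, hY⟩
  simp only [hA1] at h
  exact congrFun (congrArg Subtype.val h) x

theorem IsPoissonNijenhuis.isNijenhuisField (h : IsPoissonNijenhuis P N) : IsNijenhuisField N :=
  h.nijenhuis.isNijenhuisField

theorem IsPoissonNijenhuis.hierarchy_succ_apply' (h : IsPoissonNijenhuis P N) (k : ℕ) (x : M)
    (α : TangentSpace (𝓡 n) x →L[ℝ] ℝ) :
    hierarchy N P (k + 1) x α = hierarchy N P k x (transpose N x α) := by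
  have hc : N x (P x α) = P x (transpose N x α) :=
    congrArg (fun L => L α) (h.comm x)
  exact (npow_succ_apply' N k x _).trans (congrArg (npow N k x) hc)

theorem IsPoissonNijenhuis.isBivector (h : IsPoissonNijenhuis P N) (k : ℕ) :
    IsBivector (hierarchy N P k) where
  smooth α hα := h.isNijenhuisField.smooth_npow k _ (smoothVField_biField_apply h.poisson.smooth hα)
  skew x := by
    induction k with
    | zero =>
      intro α β
      exact h.poisson.skew x α β
    | succ k ih =>
      intro α β
      rw [h.hierarchy_succ_apply', hierarchy_succ_apply, ih]
      rfl

/-- The compatibility of `N` with `P` passes to all bivectors `N ^ k P`. -/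
theorem IsPoissonNijenhuis.bracket_succ (h : IsPoissonNijenhuis P N) (k : ℕ)
    (α β : smoothForms n M) :
    (h.isBivector (k + 1)).bracket α β =
      (h.isBivector k).bracket (N.onForms h.isNijenhuisField.smooth α) β
      + (h.isBivector k).bracket α (N.onForms h.isNijenhuisField.smooth β)
      - N.onForms h.isNijenhuisField.smooth ((h.isBivector k).bracket α β) := by
  revert α β
  induction k with
  | zero =>
    intro α β
    apply Subtype.ext
    funext x
    have h0 : hierarchy N P 0 = P := by
      funext x; ext α : 1; exact npow_zero_apply N x _
    have h1 : hierarchy N P (0 + 1) = fun y => (N y).comp (P y) := by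
      funext x; ext α : 1
      rw [hierarchy_succ_apply, h0]; rfl
    have := h.compat α.1 β.1 α.2 β.2 x
    rw [← h1] at this
    change koszul (hierarchy N P (0 + 1)) α.1 β.1 x = koszul (hierarchy N P 0) _ _ x +
      koszul (hierarchy N P 0) _ _ x - transpose N x (koszul (hierarchy N P 0) _ _ x)
    rw [h0]
    exact this
  | succ k ih =>
    refine IsKoszul.compat_step pairing_injective (h.isBivector k).isKoszul
      (h.isBivector (k + 1)).isKoszul (h.isBivector (k + 2)).isKoszul
      (A := N.onFields h.isNijenhuisField.smooth) (fun α X => rfl)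
      (fun α => ?_) (fun α => ?_) (fun α => ?_) (fun α => ?_) h.isNijenhuisField.torsion ih
    · exact Subtype.ext (funext fun x => hierarchy_succ_apply N P k x _)
    · exact Subtype.ext (funext fun x => h.hierarchy_succ_apply' k x _)
    · exact Subtype.ext (funext fun x => hierarchy_succ_apply N P (k + 1) x _)
    · exact Subtype.ext (funext fun x => h.hierarchy_succ_apply' (k + 1) x _)

/-- All `N ^ k P` are Poisson bivectors. -/
theorem IsPoissonNijenhuis.isPoissonBivector (h : IsPoissonNijenhuis P N) (k : ℕ) :
    IsPoissonBivector (hierarchy N P k) := by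
  refine ⟨h.isBivector k, ?_⟩
  induction k with
  | zero =>
    have h0 : hierarchy N P 0 = P := by
      funext x; ext α : 1; exact npow_zero_apply N x _
    have := h.poisson.isPoissonBivector
    rw [← h0] at this
    exact this.anchor
  | succ k ih =>
    refine IsKoszul.anchor_step h.isNijenhuisField.torsion (fun α => ?_) (fun α => ?_)
      (h.bracket_succ k) ih
    · exact Subtype.ext (funext fun x => hierarchy_succ_apply N P k x _)
    · exact Subtype.ext (funext fun x => h.hierarchy_succ_apply' k x _)

/-- The transpose of `N` is a morphism of Lie algebroids from `(T*M, N ^ (k + 1) P)` to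
`(T*M, N ^ k P)`. -/
theorem IsPoissonNijenhuis.transpose_koszul (h : IsPoissonNijenhuis P N) (k : ℕ)
    {α β : OneForm n M} (hα : SmoothOneForm n α) (hβ : SmoothOneForm n β) (x : M) :
    transpose N x (koszul (hierarchy N P (k + 1)) α β x) =
      koszul (hierarchy N P k) (fun y => transpose N y (α y)) (fun y => transpose N y (β y)) x := by
  have key := IsKoszul.transpose_bracket (A := N.onFields h.isNijenhuisField.smooth)
    (A' := N.onForms h.isNijenhuisField.smooth) pairing_injective (h.isBivector k).isKoszul
    (h.isBivector (k + 1)).isKoszul (h.isBivector (k + 2)).isKoszul (fun α X => rfl)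
    (fun α => Subtype.ext (funext fun x => h.hierarchy_succ_apply' k x _))
    (fun α => Subtype.ext (funext fun x => hierarchy_succ_apply N P (k + 1) x _))
    (fun α => Subtype.ext (funext fun x => h.hierarchy_succ_apply' (k + 1) x _))
    (h.bracket_succ (k + 1)) (⟨α, hα⟩ : smoothForms n M) ⟨β, hβ⟩
  exact congrFun (congrArg Subtype.val key) x

end Hierarchy

end

section

variable {n : ℕ} {M : Type*} [TopologicalSpace M] [ChartedSpace (Model n) M]
  [IsManifold (𝓡 n) ∞ M]

/-! ### Traces and derivations along vector fields -/

/-- The trace of a field of endomorphisms. -/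
noncomputable def traceField (S : EndField n M) : M → ℝ := fun x =>
  LinearMap.trace ℝ (TangentSpace (𝓡 n) x) (S x).toLinearMap

theorem mvfderiv_sum_of_smooth {ι : Type*} (s : Finset ι) {f : ι → M → ℝ}
    (hf : ∀ i, SmoothFun n (f i)) (x : M) :
    SmoothFun n (fun y => ∑ i ∈ s, f i y) ∧
      mvfderiv (𝓡 n) (fun y => ∑ i ∈ s, f i y) x = ∑ i ∈ s, mvfderiv (𝓡 n) (f i) x := by
  classical
  induction s using Finset.induction_on with
  | empty => exact ⟨contMDiff_const (c := (0 : ℝ)), by simp [mvfderiv_const]⟩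
  | insert a s ha ih =>
    simp only [Finset.sum_insert ha]
    exact ⟨(hf a).add ih.1, by rw [mvfderiv_add_of_smooth (hf a) ih.1, ih.2]⟩

/-- The trace in terms of any resolution `∑ φ i ⊗ e i` of the identity. -/
theorem trace_eq_sum_of_frame {V ι : Type*} [AddCommGroup V] [Module ℝ V] [Fintype ι]
    (φ : ι → V →ₗ[ℝ] ℝ) (e : ι → V) (h : ∀ v, ∑ i, φ i v • e i = v) (S : V →ₗ[ℝ] V) :
    LinearMap.trace ℝ V S = ∑ i, φ i (S (e i)) := by
  have hfin : Module.Finite ℝ V := by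
    refine Module.Finite.of_surjective
      (∑ i, (LinearMap.toSpanSingleton ℝ V (e i)).comp (LinearMap.proj i) : (ι → ℝ) →ₗ[ℝ] V)
      fun v => ⟨fun i => φ i v, ?_⟩
    simpa using h v
  have hS : S = ∑ i, (φ i).smulRight (S (e i)) := by
    ext v
    conv_lhs => rw [← h v]
    simp
  conv_lhs => rw [hS]
  simp [LinearMap.trace_smulRight]

theorem CutoffFrame.trace_eq {x₀ : M} (c : CutoffFrame n x₀) {y : M} (hy : c.ψ y = 1)
    (S : EndField n M) :
    traceField S y = ∑ i, mvfderiv (𝓡 n) (c.f i) y (S y (c.E i y)) :=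
  trace_eq_sum_of_frame (fun i => (mvfderiv (𝓡 n) (c.f i) y).toLinearMap) (fun i => c.E i y)
    (fun v => (c.sum_eq v).trans (by rw [hy, one_smul])) _

variable [T2Space M]

theorem smoothFun_traceField {S : EndField n M}
    (hS : ∀ X : VField n M, SmoothVField n X → SmoothVField n (fun x => S x (X x))) :
    SmoothFun n (traceField S) := by
  intro x₀
  obtain ⟨c⟩ := exists_cutoffFrame (n := n) x₀
  have h := (mvfderiv_sum_of_smooth Finset.univ
    (fun i => (c.smooth_f i).mvfderiv_apply (hS _ (c.smooth_E i))) x₀).1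
  refine (h x₀).congr_of_eventuallyEq ?_
  filter_upwards [c.eventually_one] with y hy using c.trace_eq hy S

/-- `D` is a derivation of the module of smooth vector fields along the vector field `V`. -/
structure IsDerivationAlong (D : VField n M → VField n M) (V : VField n M) : Prop where
  smooth : ∀ Y, SmoothVField n Y → SmoothVField n (D Y)
  add : ∀ Y Z, SmoothVField n Y → SmoothVField n Z → D (Y + Z) = D Y + D Z
  leibniz : ∀ (f : M → ℝ) Y, SmoothFun n f → SmoothVField n Y → ∀ x,
    D (f • Y) x = f x • D Y x + mvfderiv (𝓡 n) f x (V x) • Y x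

/-- The derivative of a one-form `α` by a derivation of vector fields, `Y ↦ V · α(Y) - α(D Y)`, is a
one-form. -/
theorem IsDerivationAlong.isTensorialAt_dual {D : VField n M → VField n M} {V : VField n M}
    (hD : IsDerivationAlong D V) {α : OneForm n M} (hα : SmoothOneForm n α) (x : M) :
    IsTensorialAt n (Model n) (fun Y : VField n M =>
      mvfderiv (𝓡 n) (fun y => α y (Y y)) x (V x) - α x (D Y x)) x where
  add Y Z hY hZ := by
    have e : (fun y => α y ((Y + Z) y)) = fun y => α y (Y y) + α y (Z y) :=
      funext fun y => map_add (α y) _ _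
    have e2 : α x (D (Y + Z) x) = α x (D Y x) + α x (D Z x) := by
      rw [hD.add Y Z hY hZ]
      exact map_add (α x) _ _
    rw [e, e2, mvfderiv_add_of_smooth (hα.apply hY) (hα.apply hZ), _root_.add_apply]
    ring
  smul f Y hf hY := by
    have e : (fun y => α y ((f • Y) y)) = fun y => f y * α y (Y y) :=
      funext fun y => map_smul (α y) _ _
    rw [e, hD.leibniz f Y hf hY, mvfderiv_mul_of_smooth hf (hα.apply hY)]
    simp only [map_add, map_smul, smul_eq_mul, _root_.add_apply, _root_.smul_apply]
    ring

/-- The trace is natural for derivations: `Tr [D, S] = V · Tr S` for a derivation `D` along `V`. -/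
theorem IsDerivationAlong.trace_commutator {D : VField n M → VField n M} {V : VField n M}
    (hD : IsDerivationAlong D V) {S T : EndField n M}
    (hS : ∀ X : VField n M, SmoothVField n X → SmoothVField n (fun x => S x (X x)))
    (hT : ∀ Y : VField n M, SmoothVField n Y → ∀ x,
      T x (Y x) = D (fun y => S y (Y y)) x - S x (D Y x)) (x : M) :
    traceField T x = mvfderiv (𝓡 n) (traceField S) x (V x) := by
  obtain ⟨c⟩ := exists_cutoffFrame (n := n) x
  have e1 : mvfderiv (𝓡 n) (traceField S) x (V x) =
      ∑ i, mvfderiv (𝓡 n) (fun y => mvfderiv (𝓡 n) (c.f i) y (S y (c.E i y))) x (V x) := by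
    have h1 : traceField S =ᶠ[𝓝 x] fun y => ∑ i, mvfderiv (𝓡 n) (c.f i) y (S y (c.E i y)) := by
      filter_upwards [c.eventually_one] with y hy using c.trace_eq hy S
    rw [mvfderiv_congr h1, (mvfderiv_sum_of_smooth Finset.univ
      (fun i => (c.smooth_f i).mvfderiv_apply (hS _ (c.smooth_E i))) x).2, _root_.sum_apply]
  have e2 : ∀ i, mvfderiv (𝓡 n) (fun y => mvfderiv (𝓡 n) (c.f i) y (S y (c.E i y))) x (V x) =
      mvfderiv (𝓡 n) (c.f i) x (D (fun y => S y (c.E i y)) x) -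
      ∑ j, mvfderiv (𝓡 n) (c.f j) x (S x (c.E i x)) *
        mvfderiv (𝓡 n) (c.f i) x (D (c.E j) x) := by
    intro i
    have h1 := (hD.isTensorialAt_dual (smoothOneForm_mvfderiv (c.smooth_f i)) x).vField_eq c
      (hS _ (c.smooth_E i))
    have h2 : ∀ j, mvfderiv (𝓡 n) (fun y => mvfderiv (𝓡 n) (c.f i) y (c.E j y)) x = 0 := by
      intro j
      have h3 : (fun y => mvfderiv (𝓡 n) (c.f i) y (c.E j y)) =ᶠ[𝓝 x]
          fun _ => if j = i then (1 : ℝ) else 0 := by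
        filter_upwards [c.eventually_one] with y hy using c.dual hy i j
      rw [mvfderiv_congr h3, mvfderiv_const]
    simp only [h2, _root_.zero_apply, zero_sub, smul_eq_mul, mul_neg,
      Finset.sum_neg_distrib] at h1
    linarith
  have e3 : ∀ j, mvfderiv (𝓡 n) (c.f j) x (S x (D (c.E j) x)) =
      ∑ i, mvfderiv (𝓡 n) (c.f j) x (S x (c.E i x)) *
        mvfderiv (𝓡 n) (c.f i) x (D (c.E j) x) := by
    intro j
    conv_lhs => rw [← c.sum_self (D (c.E j) x)]
    simp only [map_sum, map_smul, smul_eq_mul]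
    exact Finset.sum_congr rfl fun i _ => mul_comm _ _
  rw [e1, c.trace_eq c.ψ_self]
  simp only [hT _ (c.smooth_E _), e2, map_sub, e3, Finset.sum_sub_distrib]
  congr 1
  exact Finset.sum_comm

end

section

/-! ### Determinants and traces -/

section LinearAlgebra

variable {m : ℕ}

/-- The derivative of the determinant at `A` in the direction `B`, expanded along rows. -/
theorem sum_det_updateRow (A B : Matrix (Fin m) (Fin m) ℝ) :
    ∑ i, (A.updateRow i (B i)).det = (A.adjugate * B).trace := by
  have h : ∀ i, (A.updateRow i (B i)).det = ∑ k, A.adjugate k i * B i k := by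
    intro i
    rw [← Matrix.cramer_transpose_apply, Matrix.cramer_eq_adjugate_mulVec,
      ← Matrix.adjugate_transpose]
    rfl
  simp only [h, Matrix.trace, Matrix.diag_apply, Matrix.mul_apply]
  exact Finset.sum_comm

/-- The same derivative, expanded along columns. -/
theorem sum_det_updateCol (A B : Matrix (Fin m) (Fin m) ℝ) :
    ∑ j, (A.updateCol j (fun i => B i j)).det = (A.adjugate * B).trace := by
  simp only [← Matrix.cramer_apply, Matrix.cramer_eq_adjugate_mulVec, Matrix.trace,
    Matrix.diag_apply, Matrix.mul_apply]
  rfl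

/-- The determinant of the matrix of pairings changes by the trace under an infinitesimal
endomorphism. -/
theorem trace_adjugate_mul_pairing {V : Type*} [AddCommGroup V] [Module ℝ V]
    (b : Module.Basis (Fin m) ℝ V) (φ : Fin m → V →ₗ[ℝ] ℝ) (Y : Fin m → V) (T : V →ₗ[ℝ] V) :
    ((Matrix.of fun i j => φ i (Y j)).adjugate * Matrix.of fun i j => φ i (T (Y j))).trace =
      LinearMap.trace ℝ V T * (Matrix.of fun i j => φ i (Y j)).det := by
  let Φ : Matrix (Fin m) (Fin m) ℝ := Matrix.of fun i j => φ i (b j)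
  let U : Matrix (Fin m) (Fin m) ℝ := Matrix.of fun i j => b.repr (Y j) i
  have e1 : ∀ (L : V →ₗ[ℝ] ℝ) (v : V), L v = ∑ k, L (b k) * b.repr v k := by
    intro L v
    conv_lhs => rw [← b.sum_repr v, map_sum]
    exact Finset.sum_congr rfl fun k _ => by rw [map_smul, smul_eq_mul, mul_comm]
  have h1 : (Matrix.of fun i j => φ i (Y j)) = Φ * U := by
    ext i j
    exact e1 (φ i) (Y j)
  have h2 : (Matrix.of fun i j => φ i (T (Y j))) = Φ * (LinearMap.toMatrix b b T * U) := by
    ext i j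
    rw [Matrix.of_apply, e1 (φ i), Matrix.mul_apply]
    refine Finset.sum_congr rfl fun k _ => ?_
    rw [Matrix.mul_apply]
    refine congrArg (φ i (b k) * ·) ?_
    refine (e1 ((b.coord k).comp T) (Y j)).trans ?_
    simp [U, LinearMap.toMatrix_apply]
  rw [h1, h2, Matrix.adjugate_mul_distrib, ← Matrix.mul_assoc, Matrix.mul_assoc U.adjugate,
    Matrix.adjugate_mul, Matrix.mul_smul, Matrix.mul_one, Matrix.smul_mul, Matrix.trace_smul,
    Matrix.trace_mul_comm, Matrix.mul_assoc, Matrix.mul_adjugate, Matrix.mul_smul, Matrix.mul_one,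
    Matrix.trace_smul, LinearMap.trace_eq_matrix_trace ℝ b, Matrix.det_mul]
  simp only [smul_eq_mul]
  ring

/-- Alternating forms of top degree are proportional. -/
theorem alternating_mul_eq {V ι : Type*} [AddCommGroup V] [Module ℝ V] [Fintype ι] [DecidableEq ι]
    (b : Module.Basis ι ℝ V) (f g : V [⋀^ι]→ₗ[ℝ] ℝ) (v w : ι → V) : f v * g w = f w * g v := by
  rw [f.eq_smul_basis_det b, g.eq_smul_basis_det b]
  simp only [AlternatingMap.smul_apply, smul_eq_mul]
  ring

end LinearAlgebra

section DetDeriv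

variable {n : ℕ} {M : Type*} [TopologicalSpace M] [ChartedSpace (Model n) M] {m : ℕ}

/-- The determinant as a continuous multilinear function of the rows. -/
noncomputable def detCMM (m : ℕ) : ContinuousMultilinearMap ℝ (fun _ : Fin m => Fin m → ℝ) ℝ where
  toMultilinearMap := (Matrix.detRowAlternating (n := Fin m) (R := ℝ)).toMultilinearMap
  cont := Continuous.matrix_det continuous_id

theorem smooth_matrix {A : M → Matrix (Fin m) (Fin m) ℝ}
    (hA : ∀ i j, SmoothFun n (fun y => A y i j)) :
    ContMDiff (𝓡 n) 𝓘(ℝ, Fin m → Fin m → ℝ) ∞ (fun y i j => A y i j) :=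
  contMDiff_pi_space.2 fun i => contMDiff_pi_space.2 fun j => hA i j

theorem smoothFun_det {A : M → Matrix (Fin m) (Fin m) ℝ}
    (hA : ∀ i j, SmoothFun n (fun y => A y i j)) : SmoothFun n (fun y => (A y).det) :=
  ((detCMM m).contDiff (n := ∞)).contMDiff.comp (smooth_matrix hA)

theorem mvfderiv_comp_of_hasFDerivAt {E G : Type*} [NormedAddCommGroup E] [NormedSpace ℝ E]
    [NormedAddCommGroup G] [NormedSpace ℝ G] {g : M → E} {f : E → G} {f' : E →L[ℝ] G} {x : M}
    (hf : HasFDerivAt f f' (g x)) (hg : MDifferentiableAt (𝓡 n) 𝓘(ℝ, E) g x)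
    (v : TangentSpace (𝓡 n) x) :
    mvfderiv (𝓡 n) (fun y => f (g y)) x v = f' (mvfderiv (𝓡 n) g x v) := by
  have h1 := (hf.hasMFDerivAt.comp x hg.hasMFDerivAt).mfderiv
  exact congrArg (fun L => L v) h1

/-- Jacobi's formula. -/
theorem mvfderiv_det {A : M → Matrix (Fin m) (Fin m) ℝ}
    (hA : ∀ i j, SmoothFun n (fun y => A y i j)) (x : M) (v : TangentSpace (𝓡 n) x) :
    mvfderiv (𝓡 n) (fun y => (A y).det) x v =
      ((A x).adjugate * Matrix.of fun i j => mvfderiv (𝓡 n) (fun y => A y i j) x v).trace := by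
  let g : M → Fin m → Fin m → ℝ := fun y i j => A y i j
  have hg : MDifferentiableAt (𝓡 n) 𝓘(ℝ, Fin m → Fin m → ℝ) g x :=
    (smooth_matrix hA).mdifferentiableAt (by simp)
  have h2 : mvfderiv (𝓡 n) (fun y => (A y).det) x v =
      (detCMM m).linearDeriv (g x) (mvfderiv (𝓡 n) g x v) :=
    mvfderiv_comp_of_hasFDerivAt ((detCMM m).hasFDerivAt (g x)) hg v
  have h3 : ∀ i j, mvfderiv (𝓡 n) g x v i j = mvfderiv (𝓡 n) (fun y => A y i j) x v := by
    intro i j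
    let L : (Fin m → Fin m → ℝ) →L[ℝ] ℝ :=
      (ContinuousLinearMap.proj (R := ℝ) (φ := fun _ : Fin m => ℝ) j).comp
        (ContinuousLinearMap.proj (R := ℝ) (φ := fun _ : Fin m => Fin m → ℝ) i)
    exact (mvfderiv_comp_of_hasFDerivAt (g := g) (f := L) L.hasFDerivAt hg v).symm
  rw [h2, ContinuousMultilinearMap.linearDeriv_apply, ← sum_det_updateRow]
  refine Finset.sum_congr rfl fun i _ => ?_
  change Matrix.det _ = Matrix.det _
  refine congrArg Matrix.det (congrArg (Function.update (g x) i) ?_)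
  exact funext fun j => h3 i j

end DetDeriv

end

section

variable {n : ℕ} {M : Type*} [TopologicalSpace M] [ChartedSpace (Model n) M]
  [IsManifold (𝓡 n) ∞ M]
  {F : Type*} [NormedAddCommGroup F] [NormedSpace ℝ F] {A : M → Type*}
  [TopologicalSpace (TotalSpace F A)] [∀ x, TopologicalSpace (A x)]
  [∀ x, AddCommGroup (A x)] [∀ x, Module ℝ (A x)] [FiberBundle F A]

/-! ### Vector bundles isomorphic to the tangent bundle -/

variable (n F A) in
/-- An isomorphism from `TM` onto the vector bundle `A`, smooth in the sense that it exchanges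
smooth vector fields and smooth sections of `A`. -/
structure TangentIso where
  G : Π x : M, TangentSpace (𝓡 n) x ≃L[ℝ] A x
  smooth : ∀ Y : VField n M, SmoothVField n Y → SmoothSection n F (fun x => G x (Y x))
  smooth_symm : ∀ X : Π x, A x, SmoothSection n F X → SmoothVField n (fun x => (G x).symm (X x))
  finrank_eq : Module.finrank ℝ F = n

namespace TangentIso

variable (G : TangentIso n F A)

/-- The matrix of the pairings `θᵢ(G Yⱼ)`. The forms `θ` are indexed by the rank of `A`, which is
`n`, and are re-indexed by `Fin n`. -/
noncomputable def pairingMatrix (x : M) (θ : Fin (Module.finrank ℝ F) → A x →L[ℝ] ℝ)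
    (Y : Fin n → TangentSpace (𝓡 n) x) : Matrix (Fin n) (Fin n) ℝ :=
  Matrix.of fun i j => θ (finCongr G.finrank_eq.symm i) (G.G x (Y j))

theorem pairingMatrix_update_left [DecidableEq (Fin (Module.finrank ℝ F))] (x : M)
    (θ : Fin (Module.finrank ℝ F) → A x →L[ℝ] ℝ) (Y : Fin n → TangentSpace (𝓡 n) x)
    (i : Fin (Module.finrank ℝ F)) (α : A x →L[ℝ] ℝ) :
    G.pairingMatrix x (Function.update θ i α) Y =
      (G.pairingMatrix x θ Y).updateRow (finCongr G.finrank_eq i) (fun j => α (G.G x (Y j))) := by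
  ext k j
  by_cases h : k = finCongr G.finrank_eq i
  · subst h
    rw [Matrix.updateRow_self]
    have : finCongr G.finrank_eq.symm (finCongr G.finrank_eq i) = i := rfl
    rw [pairingMatrix, Matrix.of_apply, this, Function.update_self]
  · rw [Matrix.updateRow_ne h]
    have : finCongr G.finrank_eq.symm k ≠ i := fun e => h (by rw [← e]; rfl)
    rw [pairingMatrix, pairingMatrix, Matrix.of_apply, Matrix.of_apply, Function.update_of_ne this]

theorem pairingMatrix_update_right (x : M)
    (θ : Fin (Module.finrank ℝ F) → A x →L[ℝ] ℝ) (Y : Fin n → TangentSpace (𝓡 n) x)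
    (j : Fin n) (v : TangentSpace (𝓡 n) x) :
    G.pairingMatrix x θ (Function.update Y j v) = (G.pairingMatrix x θ Y).updateCol j
      (fun i => θ (finCongr G.finrank_eq.symm i) (G.G x v)) := by
  ext i k
  by_cases h : k = j
  · subst h
    rw [Matrix.updateCol_self, pairingMatrix, Matrix.of_apply, Function.update_self]
  · rw [Matrix.updateCol_ne h, pairingMatrix, pairingMatrix, Matrix.of_apply, Matrix.of_apply,
      Function.update_of_ne h]

/-- For fixed `θ`, the alternating form `Y ↦ det (θᵢ(G Yⱼ))`. -/
noncomputable def detForm (x : M) (θ : Fin (Module.finrank ℝ F) → A x →L[ℝ] ℝ) :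
    TangentSpace (𝓡 n) x [⋀^Fin n]→ₗ[ℝ] ℝ :=
  (Matrix.detRowAlternating (n := Fin n) (R := ℝ)).compLinearMap
    (LinearMap.pi fun i => (θ (finCongr G.finrank_eq.symm i)).toLinearMap ∘ₗ
      (G.G x).toLinearEquiv.toLinearMap)

theorem detForm_apply (x : M) (θ : Fin (Module.finrank ℝ F) → A x →L[ℝ] ℝ)
    (Y : Fin n → TangentSpace (𝓡 n) x) :
    G.detForm x θ Y = (G.pairingMatrix x θ Y).det :=
  Matrix.det_transpose _

/-- The nowhere vanishing section `(θ, Y) ↦ det (θᵢ(G Yⱼ))` of `⋀^top A ⊗ ⋀^top T*M`. -/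
noncomputable def topForm : TopField n F A := fun x =>
  { toFun := G.detForm x
    map_update_add' := by
      intro _ θ i a b
      ext Y
      rw [AlternatingMap.add_apply, detForm_apply, detForm_apply, detForm_apply,
        pairingMatrix_update_left, pairingMatrix_update_left, pairingMatrix_update_left,
        ← Matrix.det_updateRow_add]
      rfl
    map_update_smul' := by
      intro _ θ i c a
      ext Y
      rw [AlternatingMap.smul_apply, detForm_apply, detForm_apply, pairingMatrix_update_left,
        pairingMatrix_update_left, smul_eq_mul, ← Matrix.det_updateRow_smul]
      rfl
    map_eq_zero_of_eq' := by
      intro θ i j h hij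
      ext Y
      refine (G.detForm_apply x θ Y).trans ?_
      refine Matrix.det_zero_of_row_eq (i := finCongr G.finrank_eq i)
        (j := finCongr G.finrank_eq j) (fun e => hij ((finCongr G.finrank_eq).injective e)) ?_
      funext k
      exact congrArg (fun α => α (G.G x (Y k))) h }

theorem topForm_apply (x : M) (θ : Fin (Module.finrank ℝ F) → A x →L[ℝ] ℝ)
    (Y : Fin n → TangentSpace (𝓡 n) x) :
    G.topForm x θ Y = (G.pairingMatrix x θ Y).det :=
  G.detForm_apply x θ Y

/-- The coframe of `A` dual to the image of a frame of `TM`. -/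
noncomputable def coframe {x₀ : M} (c : CutoffFrame n x₀) (i : Fin (Module.finrank ℝ F)) (x : M) :
    A x →L[ℝ] ℝ :=
  (mvfderiv (𝓡 n) (c.f (finCongr G.finrank_eq i)) x).comp ((G.G x).symm : A x →L[ℝ] _)

theorem smoothDual_comp_symm {α : OneForm n M} (hα : SmoothOneForm n α) :
    SmoothDual n F (fun x => (α x).comp ((G.G x).symm : A x →L[ℝ] TangentSpace (𝓡 n) x)) :=
  fun X hX => hα.apply (G.smooth_symm X hX)

variable [T2Space M]

theorem smoothDual_coframe {x₀ : M} (c : CutoffFrame n x₀) (i : Fin (Module.finrank ℝ F)) :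
    SmoothDual n F (G.coframe c i) :=
  G.smoothDual_comp_symm (smoothOneForm_mvfderiv (c.smooth_f _))

theorem topForm_coframe {x₀ : M} (c : CutoffFrame n x₀) {y : M} (hy : c.ψ y = 1) :
    G.topForm y (fun i => G.coframe c i y) (fun j => c.E j y) = 1 := by
  rw [topForm_apply]
  have : G.pairingMatrix y (fun i => G.coframe c i y) (fun j => c.E j y) = 1 := by
    ext i j
    have h := c.dual hy i j
    rw [Matrix.one_apply]
    refine Eq.trans ?_ (h.trans (by simp only [eq_comm]))
    exact congrArg (mvfderiv (𝓡 n) (c.f i) y) ((G.G y).symm_apply_apply _)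
  rw [this, Matrix.det_one]

theorem smooth_pairing {θ : Π x, A x →L[ℝ] ℝ} (hθ : SmoothDual n F θ) {Y : VField n M}
    (hY : SmoothVField n Y) : SmoothFun n (fun x => θ x (G.G x (Y x))) :=
  hθ _ (G.smooth Y hY)

theorem smoothOneForm_comp {θ : Π x, A x →L[ℝ] ℝ} (hθ : SmoothDual n F θ) :
    SmoothOneForm n (fun x => (θ x).comp (G.G x : TangentSpace (𝓡 n) x →L[ℝ] A x)) :=
  smoothOneForm_of_apply fun _ hY => G.smooth_pairing hθ hY

theorem isNonvanishingTop_topForm : IsNonvanishingTop F G.topForm := by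
  refine ⟨fun x h => ?_, fun θ Y hθ hY => ?_⟩
  · obtain ⟨c⟩ := exists_cutoffFrame (n := n) x
    have h1 := G.topForm_coframe c c.ψ_self
    rw [h] at h1
    exact zero_ne_one h1
  · simp only [topForm_apply]
    exact smoothFun_det fun i j => G.smooth_pairing (hθ _) (hY j)

/-- A nowhere vanishing section of `⋀^top A ⊗ ⋀^top T*M` is the product of `G.topForm` by a
smooth nowhere vanishing function. -/
theorem exists_eq_smul_topForm {η : TopField n F A} (hη : IsNonvanishingTop F η) :
    ∃ h : M → ℝ, SmoothFun n h ∧ (∀ x, h x ≠ 0) ∧ ∀ x θ Y, η x θ Y = h x * G.topForm x θ Y := by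
  -- At each point both are elements of a line; the quotient `h` is smooth because `h = η(θ, Y)`
  -- for the frames `θ`, `Y` on which `G.topForm` is `1`.
  have h1 : ∀ x, ∃ a : ℝ, ∀ θ Y, η x θ Y = a * G.topForm x θ Y := by
    intro x
    obtain ⟨c⟩ := exists_cutoffFrame (n := n) x
    let b : Module.Basis (Fin n) ℝ (TangentSpace (𝓡 n) x) :=
      (EuclideanSpace.basisFun (Fin n) ℝ).toBasis
    let e : (A x →L[ℝ] ℝ) ≃ₗ[ℝ] Module.Dual ℝ (TangentSpace (𝓡 n) x) :=
      { toFun := fun α => (α.comp (G.G x : TangentSpace (𝓡 n) x →L[ℝ] A x)).toLinearMap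
        map_add' := fun _ _ => rfl
        map_smul' := fun _ _ => rfl
        invFun := fun β =>
          (LinearMap.toContinuousLinearMap (𝕜 := ℝ) (E := Model n) (F' := ℝ) β).comp
          ((G.G x).symm : A x →L[ℝ] TangentSpace (𝓡 n) x)
        left_inv := fun α => by
          ext a
          exact congrArg α ((G.G x).apply_symm_apply a)
        right_inv := fun β => by
          ext v
          exact congrArg β ((G.G x).symm_apply_apply v) }
    let b' : Module.Basis (Fin (Module.finrank ℝ F)) ℝ (A x →L[ℝ] ℝ) :=
      (b.dualBasis.map e.symm).reindex (finCongr G.finrank_eq.symm)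
    let θ₀ := fun i => G.coframe c i x
    let Y₀ := fun j => c.E j x
    have hone : G.topForm x θ₀ Y₀ = 1 := G.topForm_coframe c c.ψ_self
    refine ⟨η x θ₀ Y₀, fun θ Y => ?_⟩
    let evL : (Fin n → TangentSpace (𝓡 n) x) → (TangentSpace (𝓡 n) x [⋀^Fin n]→ₗ[ℝ] ℝ) →ₗ[ℝ] ℝ :=
      fun v => { toFun := fun f => f v, map_add' := fun _ _ => rfl, map_smul' := fun _ _ => rfl }
    have e1 := alternating_mul_eq b' ((evL Y).compAlternatingMap (η x))
      ((evL Y₀).compAlternatingMap (G.topForm x)) θ θ₀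
    have e2 := alternating_mul_eq b (η x θ₀) (G.topForm x θ) Y Y₀
    change η x θ Y * G.topForm x θ₀ Y₀ = η x θ₀ Y * G.topForm x θ Y₀ at e1
    rw [hone, mul_one] at e1
    rw [e1, e2]
  choose h hh using h1
  refine ⟨h, fun x₀ => ?_, fun x hx => hη.1 x ?_, hh⟩
  · obtain ⟨c⟩ := exists_cutoffFrame (n := n) x₀
    refine (hη.2 (G.coframe c) c.E (G.smoothDual_coframe c) c.smooth_E
      x₀).congr_of_eventuallyEq ?_
    filter_upwards [c.eventually_one] with y hy
    rw [hh, G.topForm_coframe c hy, mul_one]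
  · ext θ Y
    rw [hh, hx, zero_mul]
    rfl

end TangentIso

end

section

variable {n : ℕ} {M : Type*} [TopologicalSpace M] [ChartedSpace (Model n) M]
  [IsManifold (𝓡 n) ∞ M] [T2Space M]

/-! ### Differences and commutators of derivations -/

/-- An operation on vector fields that is tensorial at every point is given by a field of
endomorphisms. -/
theorem exists_endField {Φ : VField n M → VField n M}
    (h : ∀ x, IsTensorialAt n (Model n) (fun Y => Φ Y x) x) :
    ∃ T : EndField n M, ∀ Y, SmoothVField n Y → ∀ x, T x (Y x) = Φ Y x := by
  have h1 : ∀ x, ∃ T : TangentSpace (𝓡 n) x →L[ℝ] TangentSpace (𝓡 n) x,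
      ∀ Y, SmoothVField n Y → T (Y x) = Φ Y x := fun x => (h x).exists_clm
  choose T hT using h1
  exact ⟨T, fun Y hY x => hT x Y hY⟩

theorem endField_ext {S T : EndField n M} {x : M}
    (h : ∀ Y : VField n M, SmoothVField n Y → S x (Y x) = T x (Y x)) : S x = T x := by
  ext v
  obtain ⟨Y, hY, rfl⟩ := exists_smoothVField_eq x v
  exact h Y hY

/-- Two derivations along the same vector field differ by a field of endomorphisms. -/
theorem IsDerivationAlong.exists_sub {D D' : VField n M → VField n M} {V : VField n M}
    (hD : IsDerivationAlong D V) (hD' : IsDerivationAlong D' V) :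
    ∃ T : EndField n M, ∀ Y, SmoothVField n Y → ∀ x, T x (Y x) = D Y x - D' Y x :=
  exists_endField fun x =>
    { add := fun Y Z hY hZ => by
        rw [hD.add Y Z hY hZ, hD'.add Y Z hY hZ, Pi.add_apply, Pi.add_apply]
        abel
      smul := fun f Y hf hY => by
        rw [hD.leibniz f Y hf hY, hD'.leibniz f Y hf hY, smul_sub]
        abel }

/-- The commutator of a derivation and a field of endomorphisms is a field of endomorphisms. -/
theorem IsDerivationAlong.exists_commutator {D : VField n M → VField n M} {V : VField n M}
    (hD : IsDerivationAlong D V) {S : EndField n M}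
    (hS : ∀ X : VField n M, SmoothVField n X → SmoothVField n (fun x => S x (X x))) :
    ∃ T : EndField n M, ∀ Y, SmoothVField n Y → ∀ x,
      T x (Y x) = D (fun y => S y (Y y)) x - S x (D Y x) :=
  exists_endField fun x =>
    { add := fun Y Z hY hZ => by
        have e : (fun y => S y ((Y + Z) y)) = (fun y => S y (Y y)) + fun y => S y (Z y) :=
          funext fun y => map_add (S y) _ _
        rw [e, hD.add _ _ (hS Y hY) (hS Z hZ), hD.add Y Z hY hZ, Pi.add_apply, Pi.add_apply,
          map_add]
        abel
      smul := fun f Y hf hY => by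
        have e : (fun y => S y ((f • Y) y)) = f • fun y => S y (Y y) :=
          funext fun y => map_smul (S y) _ _
        rw [e, hD.leibniz f _ hf (hS Y hY), hD.leibniz f Y hf hY, map_add, map_smul, map_smul,
          smul_sub]
        abel }

theorem isDerivationAlong_mlieBracket {V : VField n M} (hV : SmoothVField n V) :
    IsDerivationAlong (VectorField.mlieBracket (𝓡 n) V) V where
  smooth Y hY := SmoothVField.mlieBracket hV hY
  add Y Z hY hZ := funext fun x => VectorField.mlieBracket_add_right
    (hY.mdifferentiableAt (by simp)) (hZ.mdifferentiableAt (by simp))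
  leibniz f Y hf hY x := by
    rw [add_comm]
    exact mlieBracket_smul_right hf hY x

variable {F : Type*} [NormedAddCommGroup F] [NormedSpace ℝ F] {A : M → Type*}
  [TopologicalSpace (TotalSpace F A)] [∀ x, TopologicalSpace (A x)]
  [∀ x, AddCommGroup (A x)] [∀ x, Module ℝ (A x)] [FiberBundle F A]

namespace TangentIso

/-! ### The characteristic cocycle of a Lie algebroid -/

variable (G : TangentIso n F A) {D : AlgebroidData n A}

/-- The operation `Y ↦ G⁻¹[X, G Y]` on vector fields. -/
noncomputable def nabla (D : AlgebroidData n A) (X : Π x, A x) (Y : VField n M) : VField n M :=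
  fun x => (G.G x).symm (D.bracket X (fun y => G.G y (Y y)) x)

theorem bracket_add (hD : IsLieAlgebroid F D) {X Y Z : Π x, A x} (hX : SmoothSection n F X)
    (hY : SmoothSection n F Y) (hZ : SmoothSection n F Z) (hYZ : SmoothSection n F (Y + Z)) :
    D.bracket X (Y + Z) = D.bracket X Y + D.bracket X Z := by
  rw [hD.skew _ _ hX hYZ, hD.add_bracket _ _ _ hY hZ hX, hD.skew _ _ hX hY, hD.skew _ _ hX hZ,
    neg_add]

theorem apply_nabla (X : Π x, A x) (Y : VField n M) :
    (fun x => G.G x (G.nabla D X Y x)) = D.bracket X (fun y => G.G y (Y y)) :=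
  funext fun x => (G.G x).apply_symm_apply _

theorem isDerivationAlong_nabla (hD : IsLieAlgebroid F D) {X : Π x, A x}
    (hX : SmoothSection n F X) : IsDerivationAlong (G.nabla D X) (D.anchorField X) where
  smooth Y hY := G.smooth_symm _ (hD.smooth_bracket _ _ hX (G.smooth Y hY))
  add Y Z hY hZ := by
    have e : (fun y => G.G y ((Y + Z) y)) = (fun y => G.G y (Y y)) + fun y => G.G y (Z y) :=
      funext fun y => map_add (G.G y) _ _
    funext x
    have h := G.smooth (Y + Z) (ContMDiff.add_section hY hZ)
    rw [e] at h
    rw [nabla, e, bracket_add hD hX (G.smooth Y hY) (G.smooth Z hZ) h]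
    exact map_add (G.G x).symm _ _
  leibniz f Y hf hY x := by
    have e : (fun y => G.G y ((f • Y) y)) = fun y => f y • G.G y (Y y) :=
      funext fun y => map_smul (G.G y) _ _
    rw [nabla, e, hD.leibniz X _ f hX (G.smooth Y hY) hf, map_add, map_smul, map_smul,
      (G.G x).symm_apply_apply]
    rfl

/-- `T` is the field of endomorphisms `Y ↦ G⁻¹[X, G Y] - [ρ(X), Y]`, the difference of two
derivations along `ρ(X)`. -/
def IsTorsion (D : AlgebroidData n A) (X : Π x, A x) (T : EndField n M) : Prop :=
  ∀ Y, SmoothVField n Y → ∀ x, T x (Y x) =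
    G.nabla D X Y x - VectorField.mlieBracket (𝓡 n) (D.anchorField X) Y x

theorem exists_isTorsion (hD : IsLieAlgebroid F D) {X : Π x, A x} (hX : SmoothSection n F X) :
    ∃ T, G.IsTorsion D X T :=
  (G.isDerivationAlong_nabla hD hX).exists_sub
    (isDerivationAlong_mlieBracket (hD.smooth_anchor X hX))

theorem IsTorsion.smooth {G : TangentIso n F A} (hD : IsLieAlgebroid F D) {X : Π x, A x}
    (hX : SmoothSection n F X) {T : EndField n M} (hT : G.IsTorsion D X T) (Y : VField n M)
    (hY : SmoothVField n Y) : SmoothVField n (fun x => T x (Y x)) := by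
  simp only [hT Y hY]
  exact ContMDiff.sub_section ((G.isDerivationAlong_nabla hD hX).smooth Y hY)
    ((isDerivationAlong_mlieBracket (hD.smooth_anchor X hX)).smooth Y hY)

/-- `ξ` is the section `X ↦ Tr (Y ↦ G⁻¹[X, G Y] - [ρ(X), Y])` of `A*`. -/
def IsTraceForm (D : AlgebroidData n A) (ξ : Π x, A x →L[ℝ] ℝ) : Prop :=
  ∀ X, SmoothSection n F X → ∀ T, G.IsTorsion D X T → ∀ x, ξ x (X x) = traceField T x

/-- The trace of the endomorphism `T_X` attached to `X` is linear over functions in `X`, although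
`T_X` is not: for `V = G⁻¹X`, `T_{fX} = f T_X - (df ∘ ρ ∘ G) ⊗ V + df ⊗ ρ(X)`, and the two rank-one
terms have the same trace. -/
theorem exists_isTraceForm (hD : IsLieAlgebroid F D) : ∃ ξ, G.IsTraceForm D ξ := by
  have h1 : ∀ V : VField n M, ∃ T : EndField n M, SmoothVField n V →
      G.IsTorsion D (fun y => G.G y (V y)) T := by
    intro V
    by_cases hV : SmoothVField n V
    · obtain ⟨T, hT⟩ := G.exists_isTorsion hD (G.smooth V hV)
      exact ⟨T, fun _ => hT⟩
    · exact ⟨fun _ => 0, fun h => absurd h hV⟩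
  choose T hT using h1
  have h2 : ∀ x, IsTensorialAt n (Model n) (fun V => traceField (T V) x) x := by
    intro x
    refine ⟨fun V W hV hW => ?_, fun f V hf hV => ?_⟩
    · have hVW : SmoothVField n (V + W) := ContMDiff.add_section hV hW
      have e : T (V + W) x = T V x + T W x := by
        refine endField_ext (S := T (V + W)) (T := T V + T W) fun Y hY => ?_
        have e1 : (fun y => G.G y ((V + W) y)) = (fun y => G.G y (V y)) + fun y => G.G y (W y) :=
          funext fun y => map_add (G.G y) _ _
        have hGY := G.smooth Y hY
        have e2 := hD.add_bracket _ _ _ (G.smooth V hV) (G.smooth W hW) hGY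
        have e3 : D.anchorField (fun y => G.G y ((V + W) y)) =
            D.anchorField (fun y => G.G y (V y)) + D.anchorField (fun y => G.G y (W y)) := by
          funext y
          rw [e1]
          exact map_add (D.anchor y) _ _
        have e4 := VectorField.mlieBracket_add_left (I := 𝓡 n) (W := Y) (x := x)
          ((hD.smooth_anchor _ (G.smooth V hV)).mdifferentiableAt (by simp))
          ((hD.smooth_anchor _ (G.smooth W hW)).mdifferentiableAt (by simp))
        have e5 : G.nabla D (fun y => G.G y ((V + W) y)) Y x =
            G.nabla D (fun y => G.G y (V y)) Y x + G.nabla D (fun y => G.G y (W y)) Y x := by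
          rw [nabla, e1, e2]
          exact map_add (G.G x).symm _ _
        rw [hT _ hVW Y hY, e3, e4, e5]
        change _ = T V x (Y x) + T W x (Y x)
        rw [hT V hV Y hY, hT W hW Y hY]
        abel
      rw [traceField, e]
      exact map_add (LinearMap.trace ℝ (TangentSpace (𝓡 n) x)) _ _
    · have hfV : SmoothVField n (f • V) := ContMDiff.smul_section hf hV
      let ρ : TangentSpace (𝓡 n) x →L[ℝ] TangentSpace (𝓡 n) x :=
        (D.anchor x).comp (G.G x : TangentSpace (𝓡 n) x →L[ℝ] A x)
      let S : TangentSpace (𝓡 n) x →L[ℝ] TangentSpace (𝓡 n) x :=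
        f x • T V x - ((mvfderiv (𝓡 n) f x).comp ρ).smulRight (V x) +
          (mvfderiv (𝓡 n) f x).smulRight (ρ (V x))
      have e : T (f • V) x = S := by
        ext v
        obtain ⟨Y, hY, rfl⟩ := exists_smoothVField_eq x v
        have e1 : (fun y => G.G y ((f • V) y)) = fun y => f y • G.G y (V y) :=
          funext fun y => map_smul (G.G y) _ _
        have hGY := G.smooth Y hY
        have hGV := G.smooth V hV
        have hGfV := G.smooth _ hfV
        rw [e1] at hGfV
        have e2 : G.nabla D (fun y => G.G y ((f • V) y)) Y x =
            f x • G.nabla D (fun y => G.G y (V y)) Y x -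
              mvfderiv (𝓡 n) f x (ρ (Y x)) • V x := by
          rw [nabla, e1, hD.skew _ _ hGfV hGY, hD.leibniz _ _ f hGY hGV hf, nabla,
            hD.skew _ _ hGV hGY, Pi.neg_apply, Pi.neg_apply, map_neg, map_neg, map_add, map_smul,
            map_smul, (G.G x).symm_apply_apply, smul_neg]
          rw [neg_add]
          rfl
        have e3 : D.anchorField (fun y => G.G y ((f • V) y)) =
            fun y => f y • D.anchorField (fun y => G.G y (V y)) y := by
          funext y
          rw [e1]
          exact map_smul (D.anchor y) _ _
        have e4 : VectorField.mlieBracket (𝓡 n)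
            (fun y => f y • D.anchorField (fun y => G.G y (V y)) y) Y x =
            f x • VectorField.mlieBracket (𝓡 n) (D.anchorField (fun y => G.G y (V y))) Y x -
              mvfderiv (𝓡 n) f x (Y x) • ρ (V x) := by
          rw [VectorField.mlieBracket_swap_apply,
            mlieBracket_smul_right hf (hD.smooth_anchor _ hGV),
            VectorField.mlieBracket_swap_apply (V := Y), smul_neg, neg_add, neg_neg]
          exact (neg_add_eq_sub _ _)
        rw [hT _ hfV Y hY, e3, e4, e2]
        change _ = f x • T V x (Y x) - mvfderiv (𝓡 n) f x (ρ (Y x)) • V x +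
          mvfderiv (𝓡 n) f x (Y x) • ρ (V x)
        rw [hT V hV Y hY, smul_sub]
        abel
      have : Module.Finite ℝ (TangentSpace (𝓡 n) x) := inferInstanceAs (Module.Finite ℝ (Model n))
      have : Module.Free ℝ (TangentSpace (𝓡 n) x) := inferInstanceAs (Module.Free ℝ (Model n))
      have e6 : S.toLinearMap = f x • (T V x).toLinearMap -
          ((mvfderiv (𝓡 n) f x).comp ρ).toLinearMap.smulRight (V x) +
          (mvfderiv (𝓡 n) f x).toLinearMap.smulRight (ρ (V x)) := rfl
      rw [traceField, e, e6, map_add, map_sub, map_smul, LinearMap.trace_smulRight,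
        LinearMap.trace_smulRight]
      exact sub_add_cancel _ _
  choose ζ hζ using fun x => (h2 x).exists_clm
  refine ⟨fun x => (ζ x).comp ((G.G x).symm : A x →L[ℝ] TangentSpace (𝓡 n) x),
    fun X hX T' hT' x => ?_⟩
  have hV := G.smooth_symm X hX
  have e : (fun y => G.G y ((G.G y).symm (X y))) = X :=
    funext fun y => (G.G y).apply_symm_apply _
  have h3 := hT _ hV
  rw [e] at h3
  refine (hζ x _ hV).trans ?_
  have h4 : T (fun y => (G.G y).symm (X y)) x = T' x := endField_ext fun Y hY => by
    rw [h3 Y hY, hT' Y hY]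
  rw [traceField, traceField, h4]

end TangentIso

end

section

variable {n : ℕ} {M : Type*} [TopologicalSpace M] [ChartedSpace (Model n) M]
  [IsManifold (𝓡 n) ∞ M] [T2Space M]

theorem IsDerivationAlong.sub {D : VField n M → VField n M} {V : VField n M}
    (hD : IsDerivationAlong D V) {Y Z : VField n M} (hY : SmoothVField n Y)
    (hZ : SmoothVField n Z) : D (Y - Z) = D Y - D Z := by
  have h := hD.add (Y - Z) Z (ContMDiff.sub_section hY hZ) hZ
  rw [sub_add_cancel] at h
  rw [h, add_sub_cancel_right]

theorem mlieBracket_jacobi {X Y Z : VField n M} (hX : SmoothVField n X) (hY : SmoothVField n Y)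
    (hZ : SmoothVField n Z) (x : M) :
    VectorField.mlieBracket (𝓡 n) (VectorField.mlieBracket (𝓡 n) X Y) Z x =
      VectorField.mlieBracket (𝓡 n) X (VectorField.mlieBracket (𝓡 n) Y Z) x -
      VectorField.mlieBracket (𝓡 n) Y (VectorField.mlieBracket (𝓡 n) X Z) x := by
  let X' : smoothFields n M := ⟨X, hX⟩
  let Y' : smoothFields n M := ⟨Y, hY⟩
  let Z' : smoothFields n M := ⟨Z, hZ⟩
  exact congrFun (congrArg Subtype.val (lie_lie X' Y' Z')) x

theorem smoothFun_log {h : M → ℝ} (hh : SmoothFun n h) (h0 : ∀ x, h x ≠ 0) :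
    SmoothFun n (fun x => Real.log (h x)) := fun x =>
  (Real.contDiffAt_log.2 (h0 x)).contMDiffAt.comp x (hh x)

/-- `h · d log |h| = dh`; `Real.log` of a negative number is the logarithm of its absolute value. -/
theorem mvfderiv_log {h : M → ℝ} (hh : SmoothFun n h) (h0 : ∀ x, h x ≠ 0) (x : M)
    (v : TangentSpace (𝓡 n) x) :
    h x * mvfderiv (𝓡 n) (fun y => Real.log (h y)) x v = mvfderiv (𝓡 n) h x v := by
  rw [mvfderiv_comp_of_hasFDerivAt (Real.hasDerivAt_log (h0 x)).hasFDerivAt (hh.mdiff x) v]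
  simp [mul_comm, h0 x]

variable {F : Type*} [NormedAddCommGroup F] [NormedSpace ℝ F] {A : M → Type*}
  [TopologicalSpace (TotalSpace F A)] [∀ x, TopologicalSpace (A x)]
  [∀ x, AddCommGroup (A x)] [∀ x, Module ℝ (A x)] [FiberBundle F A]

theorem IsLieAlgebroid.bracket_bracket {D : AlgebroidData n A} (hD : IsLieAlgebroid F D)
    {X Y Z : Π x, A x} (hX : SmoothSection n F X) (hY : SmoothSection n F Y)
    (hZ : SmoothSection n F Z) :
    D.bracket (D.bracket X Y) Z = D.bracket X (D.bracket Y Z) - D.bracket Y (D.bracket X Z) := by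
  have h1 := hD.jacobi X Y Z hX hY hZ
  have hXZ' := hD.smooth_bracket X Z hX hZ
  have h0 : D.bracket Y (- D.bracket X Z) = - D.bracket Y (D.bracket X Z) := by
    have e : (- D.bracket X Z) = fun x => (-1 : ℝ) • D.bracket X Z x := by
      funext x
      exact (neg_one_smul ℝ _).symm
    have h2 := hD.leibniz Y (D.bracket X Z) (fun _ => -1) hY hXZ' contMDiff_const
    rw [e, h2]
    funext x
    simp [AlgebroidData.act, mvfderiv_const]
  rw [hD.skew _ _ hZ hX, h0, hD.skew _ _ hZ (hD.smooth_bracket _ _ hX hY)] at h1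
  linear_combination (norm := abel) -h1

namespace TangentIso

/-! ### The modular class of a Lie algebroid -/

variable {G : TangentIso n F A} {D : AlgebroidData n A} {ζ : Π x, A x →L[ℝ] ℝ}

/-- The characteristic cocycle is closed: on sections of `A`, the endomorphism attached to
`[X, Y]` is `[∇_X, T_Y] - [L_{ρ(Y)}, T_X]`. -/
theorem IsTraceForm.mem_Z1 (hζ : G.IsTraceForm D ζ) (hD : IsLieAlgebroid F D) : ζ ∈ Z1 F D := by
  have hsm : ∀ {X : Π x, A x} (_ : SmoothSection n F X) {T : EndField n M},
      G.IsTorsion D X T → SmoothFun n (traceField T) := fun hX _ hT =>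
    smoothFun_traceField (hT.smooth hD hX)
  refine ⟨fun X hX => ?_, fun X Y hX hY x => ?_⟩
  · obtain ⟨T, hT⟩ := G.exists_isTorsion hD hX
    rw [funext (hζ X hX T hT)]
    exact hsm hX hT
  obtain ⟨TX, hTX⟩ := G.exists_isTorsion hD hX
  obtain ⟨TY, hTY⟩ := G.exists_isTorsion hD hY
  obtain ⟨TZ, hTZ⟩ := G.exists_isTorsion hD (hD.smooth_bracket X Y hX hY)
  have hnX := G.isDerivationAlong_nabla hD hX
  have hnY := G.isDerivationAlong_nabla hD hY
  have haX := hD.smooth_anchor X hX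
  have haY := hD.smooth_anchor Y hY
  have hlX := isDerivationAlong_mlieBracket haX
  have hlY := isDerivationAlong_mlieBracket haY
  obtain ⟨S₁, hS₁⟩ := hnX.exists_commutator (hTY.smooth hD hY)
  obtain ⟨S₂, hS₂⟩ := hlY.exists_commutator (hTX.smooth hD hX)
  have e1 := hnX.trace_commutator (hTY.smooth hD hY) hS₁ x
  have e2 := hlY.trace_commutator (hTX.smooth hD hX) hS₂ x
  have e3 : TZ x = S₁ x - S₂ x := by
    refine endField_ext (S := TZ) (T := S₁ - S₂) fun V hV => ?_
    change _ = S₁ x (V x) - S₂ x (V x)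
    have hGV := G.smooth V hV
    have e4 : (fun y => TY y (V y)) =
        G.nabla D Y V - VectorField.mlieBracket (𝓡 n) (D.anchorField Y) V :=
      funext (hTY V hV)
    have e5 : (fun y => TX y (V y)) =
        G.nabla D X V - VectorField.mlieBracket (𝓡 n) (D.anchorField X) V :=
      funext (hTX V hV)
    have e6 : G.nabla D (D.bracket X Y) V x =
        G.nabla D X (G.nabla D Y V) x - G.nabla D Y (G.nabla D X V) x := by
      rw [nabla, hD.bracket_bracket hX hY hGV, nabla, nabla, G.apply_nabla, G.apply_nabla]
      exact map_sub (G.G x).symm _ _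
    rw [hTZ V hV, hS₁ V hV, hS₂ V hV, e4, e5, hnX.sub (hnY.smooth V hV) (hlY.smooth V hV),
      hlY.sub (hnX.smooth V hV) (hlX.smooth V hV), hTY _ (hnX.smooth V hV),
      hTX _ (hlY.smooth V hV), hD.anchor_bracket X Y hX hY, mlieBracket_jacobi haX haY hV, e6]
    simp only [Pi.sub_apply]
    abel
  have e7 : traceField TZ x = traceField S₁ x - traceField S₂ x := by
    rw [traceField, e3]
    exact map_sub (LinearMap.trace ℝ (TangentSpace (𝓡 n) x)) _ _
  rw [hζ _ (hD.smooth_bracket X Y hX hY) TZ hTZ, e7, e1, e2]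
  rw [funext (hζ X hX TX hTX), funext (hζ Y hY TY hTY)]
  exact sub_self _

/-- The Lie derivative along a section of `A` is defined on sections of `A*`. -/
theorem exists_isLieDerivDual (G : TangentIso n F A) (hD : IsLieAlgebroid F D) {X : Π x, A x}
    (hX : SmoothSection n F X) {θ : Π x, A x →L[ℝ] ℝ} (hθ : SmoothDual n F θ) :
    ∃ θ', IsLieDerivDual F D X θ θ' := by
  have hn := G.isDerivationAlong_nabla hD hX
  have hα := G.smoothOneForm_comp hθ
  choose β hβ using fun x => (hn.isTensorialAt_dual hα x).exists_clm
  have key : ∀ Z, SmoothSection n F Z → ∀ x,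
      β x ((G.G x).symm (Z x)) = D.act X (fun y => θ y (Z y)) x - θ x (D.bracket X Z x) := by
    intro Z hZ x
    rw [hβ x _ (G.smooth_symm Z hZ)]
    have e : (fun y => G.G y ((G.G y).symm (Z y))) = Z :=
      funext fun y => (G.G y).apply_symm_apply _
    have e1 : (fun y => ((θ y).comp (G.G y : TangentSpace (𝓡 n) y →L[ℝ] A y))
        ((G.G y).symm (Z y))) = fun y => θ y (Z y) :=
      funext fun y => congrArg (θ y) ((G.G y).apply_symm_apply _)
    have e2 : ((θ x).comp (G.G x : TangentSpace (𝓡 n) x →L[ℝ] A x))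
        (G.nabla D X (fun y => (G.G y).symm (Z y)) x) = θ x (D.bracket X Z x) := by
      rw [nabla, e]
      exact congrArg (θ x) ((G.G x).apply_symm_apply _)
    rw [e1, e2]
    rfl
  refine ⟨fun x => (β x).comp ((G.G x).symm : A x →L[ℝ] TangentSpace (𝓡 n) x),
    fun Z hZ => ?_, key⟩
  have h1 : SmoothFun n (fun x => D.act X (fun y => θ y (Z y)) x - θ x (D.bracket X Z x)) :=
    ((hθ Z hZ).mvfderiv_apply (hD.smooth_anchor X hX)).sub (hθ _ (hD.smooth_bracket X Z hX hZ))
  exact h1.congr (key Z hZ)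

/-- `L_X η = Tr(T_X) η` for the reference section `η = G.topForm`. By Jacobi's formula the
derivative of `det (θᵢ(G Yⱼ))` is linear in the derivative of the matrix, which is `⟨L_X θᵢ, G Yⱼ⟩ +
⟨θᵢ, G[ρ(X), Yⱼ]⟩ + ⟨θᵢ, G T_X Yⱼ⟩`; the first two terms are the ones that `L_X η` subtracts. -/
theorem lieDeriv_topForm {X : Π x, A x} {T : EndField n M} (hT : G.IsTorsion D X T)
    {θ θ' : Fin (Module.finrank ℝ F) → Π x, A x →L[ℝ] ℝ} {Y : Fin n → VField n M}
    (hθ : ∀ i, SmoothDual n F (θ i)) (hθ' : ∀ i, IsLieDerivDual F D X (θ i) (θ' i))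
    (hY : ∀ j, SmoothVField n (Y j)) (x : M) :
    D.act X (fun y => G.topForm y (fun i => θ i y) (fun j => Y j y)) x
      - ∑ i, G.topForm x (Function.update (fun i => θ i x) i (θ' i x)) (fun j => Y j x)
      - ∑ j, G.topForm x (fun i => θ i x) (Function.update (fun j => Y j x) j
          (VectorField.mlieBracket (𝓡 n) (D.anchorField X) (Y j) x)) =
      traceField T x * G.topForm x (fun i => θ i x) (fun j => Y j x) := by
  let e := finCongr G.finrank_eq.symm
  let B : Matrix (Fin n) (Fin n) ℝ := G.pairingMatrix x (fun i => θ i x) (fun j => Y j x)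
  let C₁ : Matrix (Fin n) (Fin n) ℝ := Matrix.of fun i j => θ' (e i) x (G.G x (Y j x))
  let C₂ : Matrix (Fin n) (Fin n) ℝ := Matrix.of fun i j => θ (e i) x (G.G x
    (VectorField.mlieBracket (𝓡 n) (D.anchorField X) (Y j) x))
  let C₃ : Matrix (Fin n) (Fin n) ℝ := Matrix.of fun i j => θ (e i) x (G.G x (T x (Y j x)))
  have h0 : D.act X (fun y => G.topForm y (fun i => θ i y) (fun j => Y j y)) x =
      (B.adjugate * (C₁ + C₂ + C₃)).trace := by
    have h := mvfderiv_det
      (A := fun y => G.pairingMatrix y (fun i => θ i y) (fun j => Y j y))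
      (fun i j => G.smooth_pairing (hθ (e i)) (hY j)) x (D.anchor x (X x))
    refine Eq.trans ?_ (h.trans ?_)
    · rw [AlgebroidData.act]
      simp only [topForm_apply]
    · refine congrArg (fun C => (B.adjugate * C).trace) ?_
      ext i j
      have h1 := (hθ' (e i)).2 _ (G.smooth (Y j) (hY j)) x
      have h2 := congrFun (G.apply_nabla (D := D) X (Y j)) x
      have h3 : θ (e i) x (G.G x (T x (Y j x))) = θ (e i) x (G.G x (G.nabla D X (Y j) x)) -
          θ (e i) x (G.G x (VectorField.mlieBracket (𝓡 n) (D.anchorField X) (Y j) x)) := by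
        rw [hT _ (hY j), map_sub, map_sub]
      have h4 : θ (e i) x (G.G x (G.nabla D X (Y j) x)) =
        θ (e i) x (D.bracket X (fun y => G.G y (Y j y)) x) := congrArg _ h2
      change mvfderiv (𝓡 n) (fun y => θ (e i) y (G.G y (Y j y))) x (D.anchor x (X x)) =
        θ' (e i) x (G.G x (Y j x)) + θ (e i) x (G.G x
          (VectorField.mlieBracket (𝓡 n) (D.anchorField X) (Y j) x)) +
          θ (e i) x (G.G x (T x (Y j x)))
      rw [AlgebroidData.act] at h1
      linarith
  have h1 : ∑ i, G.topForm x (Function.update (fun i => θ i x) i (θ' i x)) (fun j => Y j x) =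
      (B.adjugate * C₁).trace := by
    rw [← sum_det_updateRow, ← Equiv.sum_comp e]
    refine Finset.sum_congr rfl fun i _ => ?_
    rw [topForm_apply, pairingMatrix_update_left]
    rfl
  have h2 : ∑ j, G.topForm x (fun i => θ i x) (Function.update (fun j => Y j x) j
      (VectorField.mlieBracket (𝓡 n) (D.anchorField X) (Y j) x)) = (B.adjugate * C₂).trace := by
    rw [← sum_det_updateCol]
    refine Finset.sum_congr rfl fun j _ => ?_
    rw [topForm_apply, pairingMatrix_update_right]
    rfl
  have h3 : (B.adjugate * C₃).trace = traceField T x * B.det := by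
    let b : Module.Basis (Fin n) ℝ (TangentSpace (𝓡 n) x) :=
      (EuclideanSpace.basisFun (Fin n) ℝ).toBasis
    exact trace_adjugate_mul_pairing b
      (fun i => ((θ (e i) x).comp (G.G x : TangentSpace (𝓡 n) x →L[ℝ] A x)).toLinearMap)
      (fun j => Y j x) (T x).toLinearMap
  rw [h0, h1, h2, topForm_apply, ← h3, Matrix.mul_add, Matrix.mul_add, Matrix.trace_add,
    Matrix.trace_add]
  ring

/-- The section `ξ` with `⟨ξ, X⟩ η = L_X η` is `ζ + d_A log |h|` if `η` is `h` times the reference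
section. (`Real.log h` is `log |h|`.) -/
theorem IsTraceForm.isModularForm_iff (hζ : G.IsTraceForm D ζ) (hD : IsLieAlgebroid F D)
    {η : TopField n F A} {h : M → ℝ} (hh : SmoothFun n h) (h0 : ∀ x, h x ≠ 0)
    (hη : ∀ x θ Y, η x θ Y = h x * G.topForm x θ Y) {ξ : Π x, A x →L[ℝ] ℝ} :
    IsModularForm F D η ξ ↔ ∀ x, ξ x =
      ζ x + (mvfderiv (𝓡 n) (fun y => Real.log (h y)) x).comp (D.anchor x) := by
  have key : ∀ (X : Π x, A x) (θ θ' : Fin (Module.finrank ℝ F) → Π x, A x →L[ℝ] ℝ)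
      (Y : Fin n → VField n M), SmoothSection n F X → (∀ i, SmoothDual n F (θ i)) →
      (∀ i, IsLieDerivDual F D X (θ i) (θ' i)) → (∀ j, SmoothVField n (Y j)) → ∀ x,
      D.act X (fun y => η y (fun i => θ i y) (fun j => Y j y)) x
      - ∑ i, η x (Function.update (fun i => θ i x) i (θ' i x)) (fun j => Y j x)
      - ∑ j, η x (fun i => θ i x) (Function.update (fun j => Y j x) j
          (VectorField.mlieBracket (𝓡 n) (D.anchorField X) (Y j) x)) =
      (ζ x (X x) + mvfderiv (𝓡 n) (fun y => Real.log (h y)) x (D.anchor x (X x))) *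
        η x (fun i => θ i x) (fun j => Y j x) := by
    intro X θ θ' Y hX hθ hθ' hY x
    obtain ⟨T, hT⟩ := G.exists_isTorsion hD hX
    have h1 := lieDeriv_topForm hT hθ hθ' hY x
    have h2 := mvfderiv_log hh h0 x (D.anchor x (X x))
    have h3 := congrArg (fun L => L (D.anchor x (X x))) (mvfderiv_mul_of_smooth hh
      (G.isNonvanishingTop_topForm.2 θ Y hθ hY) x)
    simp only [_root_.add_apply, _root_.smul_apply, smul_eq_mul] at h3
    simp only [AlgebroidData.act] at h1 ⊢
    simp only [hη, ← Finset.mul_sum]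
    rw [h3, hζ X hX T hT, ← h2]
    linear_combination h x * h1
  constructor
  · intro H x
    ext a
    obtain ⟨V, hV, hVx⟩ := exists_smoothVField_eq x ((G.G x).symm a)
    have hX := G.smooth V hV
    obtain ⟨c⟩ := exists_cutoffFrame (n := n) x
    choose θ' hθ' using fun i => G.exists_isLieDerivDual hD hX (G.smoothDual_coframe c i)
    have h1 := H _ (G.coframe c) θ' c.E hX (G.smoothDual_coframe c) hθ' c.smooth_E x
    rw [key _ (G.coframe c) θ' c.E hX (G.smoothDual_coframe c) hθ' c.smooth_E x, hη,
      G.topForm_coframe c c.ψ_self, mul_one] at h1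
    have h2 := mul_right_cancel₀ (h0 x) h1
    have h3 : G.G x (V x) = a := by rw [hVx, (G.G x).apply_symm_apply]
    rw [h3] at h2
    exact h2
  · intro H X θ θ' Y hX hθ hθ' hY x
    rw [key X θ θ' Y hX hθ hθ' hY x, H]
    rfl

/-- The characteristic cocycle is the modular section of the reference section. -/
theorem IsTraceForm.isModularCocycle (hζ : G.IsTraceForm D ζ) (hD : IsLieAlgebroid F D) :
    IsModularCocycle F D ζ := by
  refine ⟨hζ.mem_Z1 hD, G.topForm, G.isNonvanishingTop_topForm, ?_⟩
  refine (hζ.isModularForm_iff hD (h := fun _ => 1) contMDiff_const (fun _ => one_ne_zero)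
    (fun _ _ _ => (one_mul _).symm)).2 fun x => ?_
  simp [mvfderiv_const]

/-- The modular section of any other top section is cohomologous to the characteristic cocycle. -/
theorem IsTraceForm.sub_mem_B1 (hζ : G.IsTraceForm D ζ) (hD : IsLieAlgebroid F D)
    {ξ : Π x, A x →L[ℝ] ℝ} (hξ : IsModularCocycle F D ξ) : ξ - ζ ∈ B1 D := by
  obtain ⟨-, η, hη, hmod⟩ := hξ
  obtain ⟨h, hh, h0, heq⟩ := G.exists_eq_smul_topForm hη
  refine ⟨_, smoothFun_log hh h0, fun x => ?_⟩
  rw [Pi.sub_apply, (hζ.isModularForm_iff hD hh h0 heq).1 hmod x, add_sub_cancel_left]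

end TangentIso

end

section

variable {n : ℕ} {M : Type*} [TopologicalSpace M] [ChartedSpace (Model n) M]
  [IsManifold (𝓡 n) ∞ M] [T2Space M]

section Comparison

variable {F : Type*} [NormedAddCommGroup F] [NormedSpace ℝ F] {A : M → Type*}
  [TopologicalSpace (TotalSpace F A)] [∀ x, TopologicalSpace (A x)]
  [∀ x, AddCommGroup (A x)] [∀ x, Module ℝ (A x)] [FiberBundle F A]
  {F' : Type*} [NormedAddCommGroup F'] [NormedSpace ℝ F'] {A' : M → Type*}
  [TopologicalSpace (TotalSpace F' A')] [∀ x, TopologicalSpace (A' x)]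
  [∀ x, AddCommGroup (A' x)] [∀ x, Module ℝ (A' x)] [FiberBundle F' A']

/-! ### Modular classes of morphisms -/

theorem IsLieAlgebroid.B1_le_Z1 {D : AlgebroidData n A} (hD : IsLieAlgebroid F D) :
    B1 D ≤ Z1 F D := by
  rintro ξ ⟨f, hf, h⟩
  have e : ∀ X : Π x, A x, (fun x => ξ x (X x)) =
      fun x => mvfderiv (𝓡 n) f x (D.anchorField X x) := fun X =>
    funext fun x => by rw [h]; rfl
  refine ⟨fun X hX => ?_, fun X Y hX hY x => ?_⟩
  · rw [e]
    exact hf.mvfderiv_apply (hD.smooth_anchor X hX)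
  · have h1 := mvfderiv_mlieBracket hf (hD.smooth_anchor X hX) (hD.smooth_anchor Y hY) x
    have h2 : ξ x (D.bracket X Y x) = mvfderiv (𝓡 n) f x (VectorField.mlieBracket (𝓡 n)
        (D.anchorField X) (D.anchorField Y) x) := by
      rw [← hD.anchor_bracket X Y hX hY]
      exact congrFun (e _) x
    rw [h2, h1, e, e]
    exact sub_self _

theorem IsLieAlgebroidMorphism.pullback_mem_Z1 {D : AlgebroidData n A} {D' : AlgebroidData n A'}
    {Φ : Π x, A x →L[ℝ] A' x} (hΦ : IsLieAlgebroidMorphism F F' D D' Φ)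
    {ξ : Π x, A' x →L[ℝ] ℝ} (hξ : ξ ∈ Z1 F' D') : (fun x => (ξ x).comp (Φ x)) ∈ Z1 F D := by
  refine ⟨fun X hX => hξ.1 _ (hΦ.smooth X hX), fun X Y hX hY x => ?_⟩
  have h := hξ.2 _ _ (hΦ.smooth X hX) (hΦ.smooth Y hY) x
  rw [← hΦ.bracket X Y hX hY x] at h
  simp only [AlgebroidData.act, hΦ.anchor] at h
  exact h

theorem IsLieAlgebroidMorphism.pullback_mem_B1 {D : AlgebroidData n A} {D' : AlgebroidData n A'}
    {Φ : Π x, A x →L[ℝ] A' x} (hΦ : IsLieAlgebroidMorphism F F' D D' Φ)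
    {ξ : Π x, A' x →L[ℝ] ℝ} (hξ : ξ ∈ B1 D') : (fun x => (ξ x).comp (Φ x)) ∈ B1 D := by
  obtain ⟨f, hf, h⟩ := hξ
  refine ⟨f, hf, fun x => ?_⟩
  ext a
  change ξ x (Φ x a) = _
  rw [h]
  exact congrArg (mvfderiv (𝓡 n) f x) (hΦ.anchor x a)

/-- The modular class of a morphism is the class of the difference of the characteristic
cocycles. -/
theorem IsLieAlgebroidMorphism.exists_modularClass {D : AlgebroidData n A}
    {D' : AlgebroidData n A'} {Φ : Π x, A x →L[ℝ] A' x}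
    (hΦ : IsLieAlgebroidMorphism F F' D D' Φ) {G : TangentIso n F A} {G' : TangentIso n F' A'}
    {ζ : Π x, A x →L[ℝ] ℝ} {ζ' : Π x, A' x →L[ℝ] ℝ} (hζ : G.IsTraceForm D ζ)
    (hζ' : G'.IsTraceForm D' ζ') :
    ∃ a : H1 F D, (∀ c, IsModularClassOfMorphism F F' D D' Φ c ↔ c = a) ∧
      ∀ θ : Π x, A x →L[ℝ] ℝ, Represents F D θ a ↔
        θ - (fun x => ζ x - (ζ' x).comp (Φ x)) ∈ B1 D := by
  let κ : Π x, A x →L[ℝ] ℝ := fun x => ζ x - (ζ' x).comp (Φ x)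
  have hκ : κ ∈ Z1 F D := Submodule.sub_mem _ (hζ.mem_Z1 hΦ.source)
    (hΦ.pullback_mem_Z1 (hζ'.mem_Z1 hΦ.target))
  have hmk : ∀ θ : Π x, A x →L[ℝ] ℝ, (B1 D).mkQ θ = (B1 D).mkQ κ ↔ θ - κ ∈ B1 D := fun θ =>
    Submodule.Quotient.eq (B1 D)
  refine ⟨⟨(B1 D).mkQ κ, Submodule.mem_map_of_mem hκ⟩, fun c => ⟨?_, ?_⟩, fun θ => ⟨?_, ?_⟩⟩
  · rintro ⟨-, ξ, ξ', hξ, hξ', -, hc⟩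
    refine Subtype.ext ?_
    rw [← hc]
    refine (hmk _).2 ?_
    have h1 := hζ.sub_mem_B1 hΦ.source hξ
    have h2 := hΦ.pullback_mem_B1 (hζ'.sub_mem_B1 hΦ.target hξ')
    have h3 := Submodule.sub_mem _ h1 h2
    convert h3 using 1
    funext x
    ext a
    simp only [κ, Pi.sub_apply, _root_.sub_apply, ContinuousLinearMap.comp_apply]
    ring
  · rintro rfl
    exact ⟨hΦ, ζ, ζ', hζ.isModularCocycle hΦ.source, hζ'.isModularCocycle hΦ.target, hκ, rfl⟩
  · rintro ⟨-, h⟩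
    exact (hmk θ).1 h
  · intro h
    refine ⟨?_, (hmk θ).2 h⟩
    have h1 := Submodule.add_mem _ (hΦ.source.B1_le_Z1 h) hκ
    rwa [sub_add_cancel] at h1

/-- Comparison of the characteristic cocycles of an algebroid and of its deformation by a field of
endomorphisms `Φ` of `A`, both for the same `G`: the endomorphism attached to `X` by the deformed
algebroid is the one attached to `Φ X` by the original one, plus the commutator of `∇_X` with `Φ`,
whose trace is the derivative of `Tr Φ`. -/
theorem TangentIso.IsTraceForm.deform {G : TangentIso n F A} {D D' : AlgebroidData n A}
    (hD : IsLieAlgebroid F D) (hD' : IsLieAlgebroid F D') {ζ ζ' : Π x, A x →L[ℝ] ℝ}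
    (hζ : G.IsTraceForm D ζ) (hζ' : G.IsTraceForm D' ζ') (Φ : Π x, A x →L[ℝ] A x)
    (hΦ : ∀ X, SmoothSection n F X → SmoothSection n F (fun x => Φ x (X x)))
    (hanchor : ∀ x a, D'.anchor x a = D.anchor x (Φ x a))
    (hbracket : ∀ X Y, SmoothSection n F X → SmoothSection n F Y → ∀ x,
      D'.bracket X Y x = D.bracket (fun y => Φ y (X y)) Y x + D.bracket X (fun y => Φ y (Y y)) x -
        Φ x (D.bracket X Y x)) {X : Π x, A x} (hX : SmoothSection n F X) (x : M) :
    ζ' x (X x) = ζ x (Φ x (X x)) + D.act X (traceField fun y =>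
      ((G.G y).symm : A y →L[ℝ] TangentSpace (𝓡 n) y).comp ((Φ y).comp
        (G.G y : TangentSpace (𝓡 n) y →L[ℝ] A y))) x := by
  set S : EndField n M := fun y =>
      ((G.G y).symm : A y →L[ℝ] TangentSpace (𝓡 n) y).comp ((Φ y).comp
        (G.G y : TangentSpace (𝓡 n) y →L[ℝ] A y)) with hSdef
  have hS : ∀ V : VField n M, SmoothVField n V → SmoothVField n (fun x => S x (V x)) :=
    fun V hV => G.smooth_symm _ (hΦ _ (G.smooth V hV))
  have hΦX := hΦ X hX
  obtain ⟨T', hT'⟩ := G.exists_isTorsion hD' hX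
  obtain ⟨T, hT⟩ := G.exists_isTorsion hD hΦX
  have hn := G.isDerivationAlong_nabla hD hX
  obtain ⟨C, hC⟩ := hn.exists_commutator hS
  have e1 := hn.trace_commutator hS hC x
  have e2 : T' x = T x + C x := by
    refine endField_ext (S := T') (T := T + C) fun V hV => ?_
    change _ = T x (V x) + C x (V x)
    have h1 : D'.anchorField X = D.anchorField (fun y => Φ y (X y)) :=
      funext fun y => hanchor y _
    have h2 : G.nabla D' X V x = G.nabla D (fun y => Φ y (X y)) V x +
        G.nabla D X (fun y => S y (V y)) x - S x (G.nabla D X V x) := by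
      have h3 : (fun y => G.G y (S y (V y))) = fun y => Φ y (G.G y (V y)) :=
        funext fun y => (G.G y).apply_symm_apply _
      have h4 : S x (G.nabla D X V x) =
          (G.G x).symm (Φ x (D.bracket X (fun y => G.G y (V y)) x)) :=
        congrArg (fun a => (G.G x).symm (Φ x a)) ((G.G x).apply_symm_apply _)
      rw [h4, TangentIso.nabla, hbracket X _ hX (G.smooth V hV), TangentIso.nabla,
        TangentIso.nabla, h3, map_sub, map_add]
    rw [hT' V hV, hT V hV, hC V hV, h1, h2]
    abel
  rw [hζ' X hX T' hT', hζ _ hΦX T hT, AlgebroidData.act]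
  have e3 : traceField T' x = traceField T x + traceField C x := by
    rw [traceField, e2]
    exact map_add (LinearMap.trace ℝ (TangentSpace (𝓡 n) x)) _ _
  rw [e3, e1]
  rfl

end Comparison

/-! ### Isomorphisms from the tangent bundle onto the tangent and cotangent bundles -/

/-- The identity of the tangent bundle. -/
noncomputable def tangentIsoRefl : TangentIso n (Model n) (fun x : M => TangentSpace (𝓡 n) x) where
  G x := ContinuousLinearEquiv.refl ℝ _
  smooth _ h := h
  smooth_symm _ h := h
  finrank_eq := by simp

/-- A field of endomorphisms and its transpose have the same trace. -/
theorem trace_transpose_eq (N : EndField n M) (x : M) :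
    LinearMap.trace ℝ (TangentSpace (𝓡 n) x →L[ℝ] ℝ) (transpose N x).toLinearMap =
      traceField N x := by
  obtain ⟨c⟩ := exists_cutoffFrame (n := n) x
  rw [c.trace_eq c.ψ_self]
  let φ : Fin n → (TangentSpace (𝓡 n) x →L[ℝ] ℝ) →ₗ[ℝ] ℝ := fun i =>
    { toFun := fun α => α (c.E i x), map_add' := fun _ _ => rfl, map_smul' := fun _ _ => rfl }
  exact trace_eq_sum_of_frame φ (fun i => mvfderiv (𝓡 n) (c.f i) x)
    (fun α => (c.eq_sum_form α).symm) _

theorem traceField_conj_transpose (G : TangentIso n (Model n →L[ℝ] ℝ)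
    (fun x : M => TangentSpace (𝓡 n) x →L[ℝ] ℝ)) (N : EndField n M) :
    (traceField fun y => ((G.G y).symm : (TangentSpace (𝓡 n) y →L[ℝ] ℝ) →L[ℝ]
      TangentSpace (𝓡 n) y).comp ((transpose N y).comp
        (G.G y : TangentSpace (𝓡 n) y →L[ℝ] TangentSpace (𝓡 n) y →L[ℝ] ℝ))) = traceField N := by
  funext x
  exact (LinearMap.trace_conj' (transpose N x).toLinearMap (G.G x).toLinearEquiv.symm).trans
    (trace_transpose_eq N x)

end

section

variable {n : ℕ} {M : Type*} [TopologicalSpace M] [ChartedSpace (Model n) M]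
  [IsManifold (𝓡 n) ∞ M] [T2Space M]

/-! ### Riemannian metrics -/

/-- A smooth positive definite bilinear form on the tangent spaces, glued from the forms `∑ dfⱼ ⊗
dfⱼ` by a partition of unity. -/
theorem exists_metric [SigmaCompactSpace M] :
    ∃ g : Π x : M, TangentSpace (𝓡 n) x →L[ℝ] TangentSpace (𝓡 n) x →L[ℝ] ℝ,
      (∀ X Y : VField n M, SmoothVField n X → SmoothVField n Y →
        SmoothFun n (fun x => g x (X x) (Y x))) ∧ ∀ x v, v ≠ 0 → 0 < g x v v := by
  have c : ∀ x₀ : M, CutoffFrame n x₀ := fun x₀ => (exists_cutoffFrame x₀).some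
  obtain ⟨ρ, hρ⟩ := SmoothPartitionOfUnity.exists_isSubordinate (𝓡 n) isClosed_univ
    (fun x₀ => interior {y | (c x₀).ψ y = 1}) (fun _ => isOpen_interior)
    (fun x₀ _ => mem_iUnion_of_mem x₀ (mem_interior_iff_mem_nhds.2 (c x₀).eventually_one))
  let g₀ : M → Π y : M, TangentSpace (𝓡 n) y →L[ℝ] TangentSpace (𝓡 n) y →L[ℝ] ℝ := fun a y =>
    ∑ j, (mvfderiv (𝓡 n) ((c a).f j) y).smulRight (mvfderiv (𝓡 n) ((c a).f j) y)
  have hg₀ : ∀ a y v w, g₀ a y v w =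
      ∑ j, mvfderiv (𝓡 n) ((c a).f j) y v * mvfderiv (𝓡 n) ((c a).f j) y w := by
    intro a y v w
    simp only [g₀]
    rw [_root_.sum_apply, _root_.sum_apply]
    rfl
  have hfin : ∀ y, (Function.support fun a => ρ a y).Finite := fun y =>
    ρ.locallyFinite.point_finite y
  let g : Π y : M, TangentSpace (𝓡 n) y →L[ℝ] TangentSpace (𝓡 n) y →L[ℝ] ℝ := fun y =>
    ∑ a ∈ (hfin y).toFinset, ρ a y • g₀ a y
  have hsupp : ∀ y v w, (Function.support fun a => ρ a y • g₀ a y v w) ⊆ (hfin y).toFinset := by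
    intro y v w a ha
    rw [Set.Finite.coe_toFinset]
    exact left_ne_zero_of_mul ha
  have hg : ∀ y v w, g y v w = ∑ᶠ a, ρ a y • g₀ a y v w := by
    intro y v w
    rw [finsum_eq_sum_of_support_subset _ (hsupp y v w)]
    simp only [g]
    rw [_root_.sum_apply, _root_.sum_apply]
    rfl
  refine ⟨g, fun X Y hX hY => ?_, fun x v hv => ?_⟩
  · simp only [hg]
    refine ρ.contMDiff_finsum_smul fun a x _ => ?_
    simp only [hg₀]
    exact (mvfderiv_sum_of_smooth Finset.univ (fun j => (((c a).smooth_f j).mvfderiv_apply hX).mul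
      (((c a).smooth_f j).mvfderiv_apply hY)) x).1 x
  · rw [hg]
    refine finsum_pos (fun a => ?_) ?_
      ((hfin x).toFinset.finite_toSet.subset (hsupp x v v))
    · rw [hg₀]
      exact mul_nonneg (ρ.nonneg a x) (Finset.sum_nonneg fun j _ => mul_self_nonneg _)
    · obtain ⟨a, ha⟩ := ρ.exists_pos_of_mem (mem_univ x)
      refine ⟨a, mul_pos ha ?_⟩
      rw [hg₀]
      have hx : (c a).ψ x = 1 :=
        interior_subset (s := {y | (c a).ψ y = 1})
          (hρ a (subset_tsupport _ (Function.mem_support.2 ha.ne')))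
      have h1 := (c a).sum_eq v
      rw [hx, one_smul] at h1
      have h2 : ∃ j, mvfderiv (𝓡 n) ((c a).f j) x v ≠ 0 := by
        by_contra! h
        refine hv ?_
        rw [← h1]
        exact Finset.sum_eq_zero fun j _ => by rw [h j, zero_smul]
      obtain ⟨j, hj⟩ := h2
      exact Finset.sum_pos' (fun i _ => mul_self_nonneg _)
        ⟨j, Finset.mem_univ j, mul_self_pos.2 hj⟩

/-- A positive definite bilinear form on a finite-dimensional space identifies it with its dual. -/
theorem exists_equiv_of_pos {V : Type*} [NormedAddCommGroup V] [NormedSpace ℝ V]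
    [FiniteDimensional ℝ V] (g : V →L[ℝ] V →L[ℝ] ℝ) (hg : ∀ v, v ≠ 0 → 0 < g v v) :
    ∃ G : V ≃L[ℝ] (V →L[ℝ] ℝ), ∀ v, G v = g v := by
  have hinj : Function.Injective g.toLinearMap := by
    refine (injective_iff_map_eq_zero _).2 fun v hv => ?_
    by_contra h
    have h1 := hg v h
    have h2 : g v = 0 := hv
    rw [h2] at h1
    exact lt_irrefl _ h1
  have hfr : Module.finrank ℝ V = Module.finrank ℝ (V →L[ℝ] ℝ) :=
    (Subspace.dual_finrank_eq (K := ℝ) (V := V)).symm.trans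
      (LinearMap.toContinuousLinearMap (𝕜 := ℝ) (E := V) (F' := ℝ)).finrank_eq
  exact ⟨(LinearEquiv.ofInjectiveOfFinrankEq g.toLinearMap hinj hfr).toContinuousLinearEquiv,
    fun v => rfl⟩

/-- The vector field dual to a smooth one-form for a metric is smooth: Cramer's rule expresses its
components in a frame. -/
theorem smoothVField_of_metric {α : OneForm n M} (hα : SmoothOneForm n α)
    {g : Π x : M, TangentSpace (𝓡 n) x →L[ℝ] TangentSpace (𝓡 n) x →L[ℝ] ℝ}
    (hg : ∀ X Y : VField n M, SmoothVField n X → SmoothVField n Y →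
      SmoothFun n (fun x => g x (X x) (Y x))) (hpos : ∀ x v, v ≠ 0 → 0 < g x v v)
    {V : VField n M} (hV : ∀ x, g x (V x) = α x) : SmoothVField n V := by
  refine smoothVField_of_apply fun f hf x₀ => ?_
  obtain ⟨c⟩ := exists_cutoffFrame (n := n) x₀
  -- The Gram matrix of the frame, and the components of `α`.
  let B : M → Matrix (Fin n) (Fin n) ℝ := fun y => Matrix.of fun i j => g y (c.E j y) (c.E i y)
  let b : M → Fin n → ℝ := fun y i => α y (c.E i y)
  have hB : ∀ i j, SmoothFun n (fun y => B y i j) := fun i j => hg _ _ (c.smooth_E j) (c.smooth_E i)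
  have hdet : SmoothFun n (fun y => (B y).det) := smoothFun_det hB
  have hcr : ∀ k, SmoothFun n (fun y => (B y).cramer (b y) k) := fun k => by
    refine smoothFun_det (A := fun y => (B y).updateCol k (b y)) fun i j => ?_
    by_cases h : j = k
    · subst h
      simp only [Matrix.updateCol_self]
      exact hα.apply (c.smooth_E i)
    · simp only [Matrix.updateCol_ne h]
      exact hB i j
  have hmul : ∀ y, c.ψ y = 1 → (B y).mulVec (fun k => mvfderiv (𝓡 n) (c.f k) y (V y)) = b y := by
    intro y hy
    funext i
    have h1 := c.sum_eq (V y)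
    rw [hy, one_smul] at h1
    change ∑ j, g y (c.E j y) (c.E i y) * mvfderiv (𝓡 n) (c.f j) y (V y) = α y (c.E i y)
    rw [← hV y]
    conv_rhs => rw [← h1]
    rw [map_sum, _root_.sum_apply]
    refine Finset.sum_congr rfl fun j _ => ?_
    rw [map_smul]
    exact mul_comm _ _
  have hne : ∀ y, c.ψ y = 1 → (B y).det ≠ 0 := by
    intro y hy h0
    obtain ⟨w, hw, hBw⟩ := Matrix.exists_mulVec_eq_zero_iff.2 h0
    let v : TangentSpace (𝓡 n) y := ∑ j, w j • c.E j y
    have h1 : g y v v = 0 := by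
      have h2 : ∀ i, g y v (c.E i y) = 0 := by
        intro i
        have h3 := congrFun hBw i
        refine Eq.trans ?_ h3
        simp only [v]
        rw [map_sum, _root_.sum_apply]
        refine Finset.sum_congr rfl fun j _ => ?_
        rw [map_smul]
        exact mul_comm _ _
      have h4 : g y v v = ∑ j, w j • g y v (c.E j y) := by
        refine (map_sum (g y v) (fun j => w j • c.E j y) Finset.univ).trans ?_
        exact Finset.sum_congr rfl fun j _ => map_smul (g y v) _ _
      rw [h4]
      simp [h2]
    have hv : v = 0 := by
      by_contra h
      exact (hpos y v h).ne' h1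
    refine hw (funext fun i => ?_)
    have h5 : mvfderiv (𝓡 n) (c.f i) y v = w i := by
      simp only [v]
      rw [map_sum]
      simp only [map_smul, c.dual hy, smul_eq_mul, mul_ite, mul_one, mul_zero]
      simp
    rw [← h5, hv]
    exact map_zero _
  have hloc : ∀ᶠ y in 𝓝 x₀, mvfderiv (𝓡 n) f y (V y) =
      ∑ k, ((B y).det)⁻¹ * (B y).cramer (b y) k * mvfderiv (𝓡 n) f y (c.E k y) := by
    filter_upwards [c.eventually_one] with y hy
    have h1 := c.sum_eq (V y)
    rw [hy, one_smul] at h1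
    have h2 : ∀ k, ((B y).det)⁻¹ * (B y).cramer (b y) k = mvfderiv (𝓡 n) (c.f k) y (V y) := by
      intro k
      rw [← hmul y hy, Matrix.cramer_eq_adjugate_mulVec, Matrix.mulVec_mulVec, Matrix.adjugate_mul,
        Matrix.smul_mulVec, Matrix.one_mulVec, Pi.smul_apply, smul_eq_mul,
        inv_mul_cancel_left₀ (hne y hy)]
    simp only [h2]
    conv_lhs => rw [← h1]
    rw [map_sum]
    exact Finset.sum_congr rfl fun k _ => map_smul (mvfderiv (𝓡 n) f y) _ _
  have hx := c.ψ_self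
  refine ContMDiffAt.congr_of_eventuallyEq ?_ hloc
  refine ContMDiffAt.sum fun k _ => ?_
  have hinv : ContMDiffAt (𝓡 n) 𝓘(ℝ, ℝ) ∞ (fun y => ((B y).det)⁻¹) x₀ := by
    exact (hdet x₀).inv₀ (hne x₀ hx)
  exact (hinv.mul (hcr k x₀)).mul (hf.mvfderiv_apply (c.smooth_E k) x₀)

variable (n M) in
/-- The isomorphism `TM → T*M` given by a Riemannian metric. -/
theorem exists_cotangentIso [SigmaCompactSpace M] : Nonempty (TangentIso n (Model n →L[ℝ] ℝ)
    (fun x : M => TangentSpace (𝓡 n) x →L[ℝ] ℝ)) := by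
  obtain ⟨g, hg, hpos⟩ := exists_metric (n := n) (M := M)
  have h1 : ∀ x : M, ∃ G : TangentSpace (𝓡 n) x ≃L[ℝ] (TangentSpace (𝓡 n) x →L[ℝ] ℝ),
      ∀ v, G v = g x v := fun x => exists_equiv_of_pos (V := Model n) (g x) (hpos x)
  choose G hG using h1
  refine ⟨⟨G, fun Y hY => ?_, fun α hα => ?_, ?_⟩⟩
  · refine smoothOneForm_of_apply fun Z hZ => ?_
    simp only [hG]
    exact hg Y Z hY hZ
  · refine smoothVField_of_metric hα hg hpos fun x => ?_
    rw [← hG, (G x).apply_symm_apply]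
  · rw [← (LinearMap.toContinuousLinearMap (𝕜 := ℝ) (E := Model n) (F' := ℝ)).finrank_eq]
    exact (Subspace.dual_finrank_eq (K := ℝ) (V := Model n)).trans finrank_euclideanSpace_fin

end

section

variable {n : ℕ} {M : Type*} [TopologicalSpace M] [ChartedSpace (Model n) M]
  [IsManifold (𝓡 n) ∞ M] [T2Space M]

section Comp

variable {F : Type*} [NormedAddCommGroup F] [NormedSpace ℝ F] {A : M → Type*}
  [TopologicalSpace (TotalSpace F A)] [∀ x, TopologicalSpace (A x)]
  [∀ x, AddCommGroup (A x)] [∀ x, Module ℝ (A x)] [FiberBundle F A]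

/-! ### The morphisms of a Poisson-Nijenhuis structure -/

theorem IsLieAlgebroid.id {D : AlgebroidData n A} (hD : IsLieAlgebroid F D) :
    IsLieAlgebroidMorphism F F D D (fun _ => ContinuousLinearMap.id ℝ _) :=
  ⟨hD, hD, fun _ h => h, fun _ _ => rfl, fun _ _ _ _ _ => rfl⟩

theorem IsLieAlgebroidMorphism.comp {D D' D'' : AlgebroidData n A} {Φ Ψ : Π x, A x →L[ℝ] A x}
    (hΨ : IsLieAlgebroidMorphism F F D' D'' Ψ) (hΦ : IsLieAlgebroidMorphism F F D D' Φ) :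
    IsLieAlgebroidMorphism F F D D'' (fun x => (Ψ x).comp (Φ x)) where
  source := hΦ.source
  target := hΨ.target
  smooth X hX := hΨ.smooth _ (hΦ.smooth X hX)
  anchor x a := (hΨ.anchor x (Φ x a)).trans (hΦ.anchor x a)
  bracket X Y hX hY x := (congrArg (Ψ x) (hΦ.bracket X Y hX hY x)).trans
    (hΨ.bracket _ _ (hΦ.smooth X hX) (hΦ.smooth Y hY) x)

end Comp

variable {P : BiField n M} {N : EndField n M}

theorem hierarchy_zero (N : EndField n M) (P : BiField n M) : hierarchy N P 0 = P := by
  funext x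
  ext α : 1
  exact npow_zero_apply N x _

theorem IsNijenhuisField.morphism_succ (hN : IsNijenhuisField N) (k : ℕ) :
    IsLieAlgebroidMorphism (Model n) (Model n) (tangentAlgebroid (PNModular.npow N (k + 1)))
      (tangentAlgebroid (PNModular.npow N k)) N where
  source := (hN.npow (k + 1)).isLieAlgebroid
  target := (hN.npow k).isLieAlgebroid
  smooth := hN.smooth
  anchor x v := (npow_succ_apply' N k x v).symm
  bracket X Y hX hY x := hN.apply_deformedBracket k X Y hX hY x

theorem IsNijenhuisField.morphism_npow (hN : IsNijenhuisField N) (k : ℕ) :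
    IsLieAlgebroidMorphism (Model n) (Model n) (tangentAlgebroid (PNModular.npow N k))
      (tangentAlgebroid (fun _ => ContinuousLinearMap.id ℝ _)) (PNModular.npow N k) := by
  induction k with
  | zero => exact (hN.npow 0).isLieAlgebroid.id
  | succ k ih =>
    have h := ih.comp (hN.morphism_succ k)
    have e : PNModular.npow N (k + 1) = fun x => (PNModular.npow N k x).comp (N x) := by
      funext x
      ext v : 1
      exact npow_succ_apply' N k x v
    rw [← e] at h
    exact h

theorem IsPoissonNijenhuis.morphism_succ (h : IsPoissonNijenhuis P N) (k : ℕ) :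
    IsLieAlgebroidMorphism (Model n →L[ℝ] ℝ) (Model n →L[ℝ] ℝ)
      (cotangentAlgebroid (hierarchy N P (k + 1))) (cotangentAlgebroid (hierarchy N P k))
      (transpose N) where
  source := (h.isPoissonBivector (k + 1)).isLieAlgebroid
  target := (h.isPoissonBivector k).isLieAlgebroid
  smooth α hα := (N.onForms h.isNijenhuisField.smooth ⟨α, hα⟩).2
  anchor x α := (h.hierarchy_succ_apply' k x α).symm
  bracket _ _ hα hβ x := h.transpose_koszul k hα hβ x

theorem IsPoissonNijenhuis.morphism_npow (h : IsPoissonNijenhuis P N) (k : ℕ) :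
    IsLieAlgebroidMorphism (Model n →L[ℝ] ℝ) (Model n →L[ℝ] ℝ)
      (cotangentAlgebroid (hierarchy N P k)) (cotangentAlgebroid P)
      (transpose (npow N k)) := by
  induction k with
  | zero =>
    have h1 := (h.isPoissonBivector 0).isLieAlgebroid.id
    rw [hierarchy_zero] at h1 ⊢
    exact h1
  | succ k ih =>
    have h1 := ih.comp (h.morphism_succ k)
    have e : transpose (npow N (k + 1)) =
        fun x => (transpose (npow N k) x).comp (transpose N x) := by
      funext x
      ext α v
      exact congrArg α (npow_succ_apply N k x v)
    rw [← e] at h1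
    exact h1

/-! ### The characteristic cocycles of a Poisson-Nijenhuis structure -/

theorem IsNijenhuisField.smoothFun_traceField_npow (hN : IsNijenhuisField N) (k : ℕ) :
    SmoothFun n (traceField (PNModular.npow N k)) :=
  smoothFun_traceField (hN.smooth_npow k)

/-- The characteristic cocycle of `(TM, N ^ k)` is `d Tr (N ^ k)`, because `[X, Y]_{N ^ k}` differs
from `[N ^ k X, Y]` by `(L_X N ^ k) Y`. -/
theorem IsNijenhuisField.isTraceForm (hN : IsNijenhuisField N) (k : ℕ) :
    tangentIsoRefl.IsTraceForm (tangentAlgebroid (PNModular.npow N k))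
      (mvfderiv (𝓡 n) (traceField (PNModular.npow N k))) := by
  intro X hX T hT x
  refine ((isDerivationAlong_mlieBracket hX).trace_commutator (hN.smooth_npow k)
    (fun Y hY x => ?_) x).symm
  refine (hT Y hY x).trans ?_
  change deformedBracket (PNModular.npow N k) X Y x -
    VectorField.mlieBracket (𝓡 n) (fun y => PNModular.npow N k y (X y)) Y x = _
  rw [deformedBracket]
  abel

/-- The bracket of `N ^ (k + 1)` is the deformation by `N` of the bracket of `N ^ k`. -/
theorem IsNijenhuisField.deformedBracket_succ (hN : IsNijenhuisField N) (k : ℕ)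
    {X Y : VField n M} (hX : SmoothVField n X) (hY : SmoothVField n Y) (x : M) :
    deformedBracket (PNModular.npow N (k + 1)) X Y x =
      deformedBracket (PNModular.npow N k) (fun y => N y (X y)) Y x +
      deformedBracket (PNModular.npow N k) X (fun y => N y (Y y)) x -
      N x (deformedBracket (PNModular.npow N k) X Y x) := by
  let A : ℕ → smoothFields n M →+ smoothFields n M := fun i =>
    (PNModular.npow N i).onFields (hN.smooth_npow i)
  have hA1 : ∀ X, A 1 X = N.onFields hN.smooth X := fun X => by
    apply Subtype.ext
    funext x
    simp [A, EndField.onFields, PNModular.npow]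
  have hA : ∀ X, A (k + 1) X = A k (A 1 X) := fun X => by
    rw [hA1]
    apply Subtype.ext
    funext x
    exact npow_succ_apply' N k x _
  have hA' : ∀ X, A (k + 1) X = A 1 (A k X) := fun X => by
    rw [hA1]
    apply Subtype.ext
    funext x
    exact npow_succ_apply N k x _
  have key : ∀ X Y, PNModular.deform (A (k + 1)) X Y = PNModular.deform (A k) (A 1 X) Y +
      PNModular.deform (A k) X (A 1 Y) - A 1 (PNModular.deform (A k) X Y) := by
    intro X Y
    have h1 := hN.mixedTorsion_npow k 1 X Y
    have h2 := hN.mixedTorsion_npow 1 k X Y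
    change mixedTorsion (A k) (A 1) X Y = 0 at h1
    change mixedTorsion (A 1) (A k) X Y = 0 at h2
    simp only [mixedTorsion] at h1 h2
    simp only [PNModular.deform, map_add, map_sub, ← hA, ← hA'] at h1 h2 ⊢
    linear_combination (norm := abel) -h1 - h2
  have h := key ⟨X, hX⟩ ⟨Y, hY⟩
  simp only [hA1] at h
  exact congrFun (congrArg Subtype.val h) x

/-- The comparison of the cocycles `d Tr (N ^ (k + 1))` and `d Tr (N ^ k)` under deformation by `N`.
-/
theorem IsNijenhuisField.mvfderiv_traceField_succ (hN : IsNijenhuisField N) (k : ℕ) (x : M)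
    (v : TangentSpace (𝓡 n) x) :
    mvfderiv (𝓡 n) (traceField (PNModular.npow N (k + 1))) x v =
      mvfderiv (𝓡 n) (traceField (PNModular.npow N k)) x (N x v) +
      mvfderiv (𝓡 n) (traceField N) x (PNModular.npow N k x v) := by
  obtain ⟨X, hX, rfl⟩ := exists_smoothVField_eq x v
  exact TangentIso.IsTraceForm.deform (hN.npow k).isLieAlgebroid
    (hN.npow (k + 1)).isLieAlgebroid (hN.isTraceForm k) (hN.isTraceForm (k + 1)) N hN.smooth
    (npow_succ_apply' N k) (fun X Y hX hY => hN.deformedBracket_succ k hX hY) hX x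

/-- `X · Tr (N ^ (k + 1)) = (k + 1) (N ^ k X) · Tr N`, the identity that uses the vanishing of the
torsion. -/
theorem IsNijenhuisField.mvfderiv_traceField_npow (hN : IsNijenhuisField N) (k : ℕ) (x : M)
    (v : TangentSpace (𝓡 n) x) :
    mvfderiv (𝓡 n) (traceField (PNModular.npow N (k + 1))) x v =
      (k + 1) * mvfderiv (𝓡 n) (traceField N) x (PNModular.npow N k x v) := by
  induction k generalizing x v with
  | zero =>
    have e : PNModular.npow N (0 + 1) = N := by
      funext x
      ext v : 1
      exact (npow_succ_apply N 0 x v).trans (congrArg (N x) (npow_zero_apply N x v))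
    rw [e, npow_zero_apply]
    simp
  | succ k ih =>
    rw [hN.mvfderiv_traceField_succ, ih, npow_succ_apply']
    push_cast
    ring

theorem mvfderiv_traceFun (hN : IsNijenhuisField N) (k : ℕ) (x : M) :
    mvfderiv (𝓡 n) (traceFun N k) x =
      (k : ℝ)⁻¹ • mvfderiv (𝓡 n) (traceField (npow N k)) x := by
  have e : traceFun N k = fun x => (k : ℝ)⁻¹ * traceField (npow N k) x := by
    funext x
    rw [traceFun, div_eq_inv_mul]
    rfl
  rw [e, mvfderiv_const_mul_of_smooth _ (hN.smoothFun_traceField_npow k)]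

theorem mvfderiv_traceFun_succ (hN : IsNijenhuisField N) (k : ℕ) (x : M)
    (v : TangentSpace (𝓡 n) x) :
    mvfderiv (𝓡 n) (traceFun N (k + 1)) x v =
      mvfderiv (𝓡 n) (traceField N) x (npow N k x v) := by
  have hk : ((k : ℝ) + 1) ≠ 0 := by positivity
  rw [mvfderiv_traceFun hN, _root_.smul_apply, hN.mvfderiv_traceField_npow, smul_eq_mul]
  push_cast
  rw [inv_mul_cancel_left₀ hk]

/-- By skew-symmetry, the vector field `-P θ`, as a linear form on `T*M`, is `θ ∘ P`. -/
theorem evalField_negSharp (h : IsPoissonNijenhuis P N) (θ : OneForm n M) (x : M)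
    (α : TangentSpace (𝓡 n) x →L[ℝ] ℝ) : evalField (negSharp P θ) x α = θ x (P x α) := by
  have h1 : α (-P x (θ x)) = - α (P x (θ x)) := map_neg α _
  exact h1.trans (h.poisson.skew x α (θ x)).symm

/-- The characteristic cocycles of consecutive Poisson structures of the hierarchy differ by the
differential of a trace. -/
theorem IsPoissonNijenhuis.traceForm_succ (h : IsPoissonNijenhuis P N)
    {G : TangentIso n (Model n →L[ℝ] ℝ) (fun x : M => TangentSpace (𝓡 n) x →L[ℝ] ℝ)} (k : ℕ)
    {ζ ζ' : Π x : M, (TangentSpace (𝓡 n) x →L[ℝ] ℝ) →L[ℝ] ℝ}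
    (hζ : G.IsTraceForm (cotangentAlgebroid (hierarchy N P k)) ζ)
    (hζ' : G.IsTraceForm (cotangentAlgebroid (hierarchy N P (k + 1))) ζ') (x : M)
    (α : TangentSpace (𝓡 n) x →L[ℝ] ℝ) :
    ζ' x α = ζ x (transpose N x α) + mvfderiv (𝓡 n) (traceField N) x (hierarchy N P k x α) := by
  obtain ⟨f, hf, rfl⟩ := exists_mvfderiv_eq x α
  have h1 := TangentIso.IsTraceForm.deform (h.isPoissonBivector k).isLieAlgebroid
    (h.isPoissonBivector (k + 1)).isLieAlgebroid hζ hζ' (transpose N)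
    (h.morphism_succ k).smooth (h.hierarchy_succ_apply' k)
    (fun _ _ hα hβ x => congrFun (congrArg Subtype.val (h.bracket_succ k ⟨_, hα⟩ ⟨_, hβ⟩)) x)
    (smoothOneForm_mvfderiv hf) x
  rw [traceField_conj_transpose] at h1
  exact h1

end

section

variable {n : ℕ} {M : Type*} [TopologicalSpace M] [ChartedSpace (Model n) M]
  [IsManifold (𝓡 n) ∞ M] [T2Space M] {P : BiField n M} {N : EndField n M}

/-! ### The relation between the modular classes of the two kinds of morphisms -/

/-- The map `-P` sends classes of `(TM, N ^ k)` to classes of `(T*M, N ^ k P)`, since it sends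
`df ∘ N ^ k` to `df ∘ N ^ k P`. -/
theorem IsPoissonNijenhuis.represents_negSharp (h : IsPoissonNijenhuis P N) (k : ℕ)
    {a : H1 (Model n) (tangentAlgebroid (npow N k))}
    {b : H1 (Model n →L[ℝ] ℝ) (cotangentAlgebroid (hierarchy N P k))} {θ₀ : OneForm n M}
    (ha : ∀ θ, Represents (Model n) (tangentAlgebroid (npow N k)) θ a ↔
      θ - θ₀ ∈ B1 (tangentAlgebroid (npow N k)))
    (hb : ∀ ξ, Represents (Model n →L[ℝ] ℝ) (cotangentAlgebroid (hierarchy N P k)) ξ b ↔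
      ξ - evalField (negSharp P θ₀) ∈ B1 (cotangentAlgebroid (hierarchy N P k)))
    (θ : OneForm n M) (hθ : Represents (Model n) (tangentAlgebroid (npow N k)) θ a) :
    Represents (Model n →L[ℝ] ℝ) (cotangentAlgebroid (hierarchy N P k))
      (evalField (negSharp P θ)) b := by
  obtain ⟨f, hf, h1⟩ := (ha θ).1 hθ
  refine (hb _).2 ⟨f, hf, fun x => ?_⟩
  ext α
  change evalField (negSharp P θ) x α - evalField (negSharp P θ₀) x α = _
  rw [evalField_negSharp h, evalField_negSharp h]
  exact congrArg (fun L => L (P x α)) (h1 x)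

theorem mvfderiv_traceField_npow_zero (N : EndField n M) (x : M) :
    mvfderiv (𝓡 n) (traceField (npow N 0)) x = 0 := by
  have e : traceField (npow N 0) = fun _ => (n : ℝ) := by
    funext y
    have h : LinearMap.trace ℝ (Model n) LinearMap.id = n := by
      rw [LinearMap.trace_id, finrank_euclideanSpace_fin]
    exact h
  rw [e, mvfderiv_const]

/-- The characteristic cocycles of `(T*M, N ^ k P)` and `(T*M, P)` differ by `d Tr (N ^ k) ∘ P`. -/
theorem IsPoissonNijenhuis.traceForm_npow (h : IsPoissonNijenhuis P N)
    {G : TangentIso n (Model n →L[ℝ] ℝ) (fun x : M => TangentSpace (𝓡 n) x →L[ℝ] ℝ)}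
    {ζ : ℕ → Π x : M, (TangentSpace (𝓡 n) x →L[ℝ] ℝ) →L[ℝ] ℝ}
    (hζ : ∀ k, G.IsTraceForm (cotangentAlgebroid (hierarchy N P k)) (ζ k)) (k : ℕ) (x : M)
    (α : TangentSpace (𝓡 n) x →L[ℝ] ℝ) :
    ζ k x α = ζ 0 x (transpose (npow N k) x α) +
      mvfderiv (𝓡 n) (traceField (npow N k)) x (P x α) := by
  induction k generalizing α with
  | zero =>
    rw [mvfderiv_traceField_npow_zero]
    exact (add_zero _).symm
  | succ k ih =>
    have hN := h.isNijenhuisField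
    have e1 : transpose (npow N k) x (transpose N x α) = transpose (npow N (k + 1)) x α := by
      ext v
      exact congrArg α (npow_succ_apply N k x v).symm
    have e2 : P x (transpose N x α) = N x (P x α) :=
      (congrArg (fun L => L α) (h.comm x)).symm
    have e3 : mvfderiv (𝓡 n) (traceField (npow N k)) x (N x (P x α)) =
        k * mvfderiv (𝓡 n) (traceField N) x (hierarchy N P k x α) := by
      cases k with
      | zero =>
        rw [mvfderiv_traceField_npow_zero]
        simp
      | succ k =>
        rw [hN.mvfderiv_traceField_npow, ← npow_succ_apply']
        push_cast
        rfl
    rw [h.traceForm_succ k (hζ k) (hζ (k + 1)) x α, ih, e1, e2, e3, hN.mvfderiv_traceField_npow]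
    change _ = _ + (k + 1) * mvfderiv (𝓡 n) (traceField N) x (hierarchy N P k x α)
    ring

/-- The modular classes of `N ^ k` and of its transpose, represented by `d Tr (N ^ k)` and by `-P d
Tr (N ^ k)`. -/
theorem IsPoissonNijenhuis.exists_modularClass_npow [SigmaCompactSpace M]
    (h : IsPoissonNijenhuis P N) (k : ℕ) :
    ∃ (a : H1 (Model n) (tangentAlgebroid (npow N k)))
      (b : H1 (Model n →L[ℝ] ℝ) (cotangentAlgebroid (hierarchy N P k))),
      (∀ c, IsModularClassOfMorphism (Model n) (Model n) (tangentAlgebroid (npow N k))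
        (tangentAlgebroid (fun _ => ContinuousLinearMap.id ℝ _)) (npow N k) c ↔ c = a) ∧
      (∀ c, IsModularClassOfMorphism (Model n →L[ℝ] ℝ) (Model n →L[ℝ] ℝ)
        (cotangentAlgebroid (hierarchy N P k)) (cotangentAlgebroid P)
        (transpose (npow N k)) c ↔ c = b) ∧
      ∀ θ : OneForm n M, Represents (Model n) (tangentAlgebroid (npow N k)) θ a →
        Represents (Model n →L[ℝ] ℝ) (cotangentAlgebroid (hierarchy N P k))
          (evalField (negSharp P θ)) b := by
  obtain ⟨G⟩ := exists_cotangentIso n M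
  have hN := h.isNijenhuisField
  choose ζ hζ using fun k => G.exists_isTraceForm (h.isPoissonBivector k).isLieAlgebroid
  have hζ0 := hζ 0
  rw [hierarchy_zero] at hζ0
  obtain ⟨a, ha, ha'⟩ := (hN.morphism_npow k).exists_modularClass (hN.isTraceForm k)
    (hN.isTraceForm 0)
  obtain ⟨b, hb, hb'⟩ := (h.morphism_npow k).exists_modularClass (hζ k) hζ0
  have ea : (fun x => mvfderiv (𝓡 n) (traceField (npow N k)) x -
      (mvfderiv (𝓡 n) (traceField (npow N 0)) x).comp (npow N k x)) =
      mvfderiv (𝓡 n) (traceField (npow N k)) := by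
    funext x
    rw [mvfderiv_traceField_npow_zero, ContinuousLinearMap.zero_comp, sub_zero]
  have eb : (fun x => ζ k x - (ζ 0 x).comp (transpose (npow N k) x)) =
      evalField (negSharp P (mvfderiv (𝓡 n) (traceField (npow N k)))) := by
    funext x
    ext α
    rw [evalField_negSharp h]
    exact sub_eq_of_eq_add' (h.traceForm_npow hζ k x α)
  rw [ea] at ha'
  rw [eb] at hb'
  exact ⟨a, b, ha, hb, h.represents_negSharp k ha' hb'⟩

/-- `IsPoissonNijenhuis.traceForm_succ`, with the last term written as `d Tr (N ^ (k + 1) / (k + 1))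
∘ P`. -/
theorem IsPoissonNijenhuis.traceForm_succ' (h : IsPoissonNijenhuis P N)
    {G : TangentIso n (Model n →L[ℝ] ℝ) (fun x : M => TangentSpace (𝓡 n) x →L[ℝ] ℝ)} (k : ℕ)
    {ζ ζ' : Π x : M, (TangentSpace (𝓡 n) x →L[ℝ] ℝ) →L[ℝ] ℝ}
    (hζ : G.IsTraceForm (cotangentAlgebroid (hierarchy N P k)) ζ)
    (hζ' : G.IsTraceForm (cotangentAlgebroid (hierarchy N P (k + 1))) ζ') (x : M)
    (α : TangentSpace (𝓡 n) x →L[ℝ] ℝ) :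
    ζ' x α = ζ x (transpose N x α) + mvfderiv (𝓡 n) (traceFun N (k + 1)) x (P x α) := by
  rw [h.traceForm_succ k hζ hζ', mvfderiv_traceFun_succ h.isNijenhuisField]
  rfl

/-- The modular classes of `N` and of its transpose between consecutive members of the hierarchy,
represented by `d Tr (N ^ (k + 1) / (k + 1))` and by its image under `-P`. -/
theorem IsPoissonNijenhuis.exists_modularClass_succ [SigmaCompactSpace M]
    (h : IsPoissonNijenhuis P N) (k : ℕ) :
    ∃ (a : H1 (Model n) (tangentAlgebroid (npow N (k + 1))))
      (b : H1 (Model n →L[ℝ] ℝ) (cotangentAlgebroid (hierarchy N P (k + 1)))),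
      (∀ c, IsModularClassOfMorphism (Model n) (Model n) (tangentAlgebroid (npow N (k + 1)))
        (tangentAlgebroid (npow N k)) N c ↔ c = a) ∧
      (∀ c, IsModularClassOfMorphism (Model n →L[ℝ] ℝ) (Model n →L[ℝ] ℝ)
        (cotangentAlgebroid (hierarchy N P (k + 1))) (cotangentAlgebroid (hierarchy N P k))
        (transpose N) c ↔ c = b) ∧
      (∀ θ : OneForm n M, Represents (Model n) (tangentAlgebroid (npow N (k + 1))) θ a →
        Represents (Model n →L[ℝ] ℝ) (cotangentAlgebroid (hierarchy N P (k + 1)))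
          (evalField (negSharp P θ)) b) ∧
      Represents (Model n →L[ℝ] ℝ) (cotangentAlgebroid (hierarchy N P (k + 1)))
        (evalField (negSharp P (mvfderiv (𝓡 n) (traceFun N (k + 1))))) b := by
  obtain ⟨G⟩ := exists_cotangentIso n M
  have hN := h.isNijenhuisField
  choose ζ hζ using fun k => G.exists_isTraceForm (h.isPoissonBivector k).isLieAlgebroid
  obtain ⟨a, ha, ha'⟩ := (hN.morphism_succ k).exists_modularClass (hN.isTraceForm (k + 1))
    (hN.isTraceForm k)
  obtain ⟨b, hb, hb'⟩ := (h.morphism_succ k).exists_modularClass (hζ (k + 1)) (hζ k)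
  have ea : (fun x => mvfderiv (𝓡 n) (traceField (npow N (k + 1))) x -
      (mvfderiv (𝓡 n) (traceField (npow N k)) x).comp (N x)) =
      mvfderiv (𝓡 n) (traceFun N (k + 1)) := by
    funext x
    ext v
    rw [mvfderiv_traceFun_succ hN]
    exact sub_eq_of_eq_add' (hN.mvfderiv_traceField_succ k x v)
  have eb : (fun x => ζ (k + 1) x - (ζ k x).comp (transpose N x)) =
      evalField (negSharp P (mvfderiv (𝓡 n) (traceFun N (k + 1)))) := by
    funext x
    ext α
    rw [evalField_negSharp h]
    exact sub_eq_of_eq_add' (h.traceForm_succ' k (hζ k) (hζ (k + 1)) x α)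
  rw [ea] at ha'
  rw [eb] at hb'
  refine ⟨a, b, ha, hb, h.represents_negSharp (k + 1) ha' hb', (hb' _).2 ?_⟩
  rw [sub_self]
  exact Submodule.zero_mem _

end

section

variable {n : ℕ} {M : Type*} [TopologicalSpace M] [ChartedSpace (Model n) M]
  [IsManifold (𝓡 n) ∞ M] [T2Space M]

/-! ### Modular vector fields -/

variable (n) in
/-- The tangent spaces are reflexive. -/
theorem exists_sharp (x : M) : ∃ s : ((TangentSpace (𝓡 n) x →L[ℝ] ℝ) →L[ℝ] ℝ) →ₗ[ℝ]
    TangentSpace (𝓡 n) x, ∀ ξ (α : TangentSpace (𝓡 n) x →L[ℝ] ℝ), α (s ξ) = ξ α := by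
  obtain ⟨c⟩ := exists_cutoffFrame (n := n) x
  let φ : Fin n → ((TangentSpace (𝓡 n) x →L[ℝ] ℝ) →L[ℝ] ℝ) →ₗ[ℝ] ℝ := fun i =>
    { toFun := fun ξ => ξ (mvfderiv (𝓡 n) (c.f i) x)
      map_add' := fun _ _ => rfl
      map_smul' := fun _ _ => rfl }
  refine ⟨∑ i, (φ i).smulRight (c.E i x), fun ξ α => ?_⟩
  have h1 := congrArg ξ (c.eq_sum_form α)
  rw [map_sum] at h1
  rw [h1, LinearMap.sum_apply, map_sum]
  refine Finset.sum_congr rfl fun i _ => ?_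
  rw [LinearMap.smulRight_apply, map_smul, map_smul]
  exact mul_comm _ _

/-- The vector attached to an element of the bidual of a tangent space. -/
noncomputable def sharp (x : M) : ((TangentSpace (𝓡 n) x →L[ℝ] ℝ) →L[ℝ] ℝ) →ₗ[ℝ]
    TangentSpace (𝓡 n) x := (exists_sharp n x).choose

theorem apply_sharp {x : M} (ξ : (TangentSpace (𝓡 n) x →L[ℝ] ℝ) →L[ℝ] ℝ)
    (α : TangentSpace (𝓡 n) x →L[ℝ] ℝ) : α (sharp x ξ) = ξ α :=
  (exists_sharp n x).choose_spec ξ α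

theorem sharp_evalField (Z : VField n M) (x : M) : sharp x (evalField Z x) = Z x :=
  tangentVector_ext fun f _ => apply_sharp (evalField Z x) (mvfderiv (𝓡 n) f x)

theorem smoothVField_sharp {ξ : Π x : M, (TangentSpace (𝓡 n) x →L[ℝ] ℝ) →L[ℝ] ℝ}
    (hξ : SmoothDual n (Model n →L[ℝ] ℝ) ξ) : SmoothVField n (fun x => sharp x (ξ x)) := by
  refine smoothVField_of_apply fun f hf => ?_
  simp only [apply_sharp]
  exact hξ _ (smoothOneForm_mvfderiv hf)

theorem smoothDual_evalField {Z : VField n M} (hZ : SmoothVField n Z) :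
    SmoothDual n (Model n →L[ℝ] ℝ) (evalField Z) := fun _ hα => SmoothOneForm.apply hα hZ

/-- The Lie derivative along `df` in `(T*M, Q)` of a vector field `Z` is `[Q df, Z]`. -/
theorem IsBivector.isLieDerivDual_evalField {Q : BiField n M} (hQ : IsBivector Q) {f : M → ℝ}
    (hf : SmoothFun n f) {Z : VField n M} (hZ : SmoothVField n Z) :
    IsLieDerivDual (Model n →L[ℝ] ℝ) (cotangentAlgebroid Q) (mvfderiv (𝓡 n) f) (evalField Z)
      (evalField (VectorField.mlieBracket (𝓡 n) (hamiltonian Q f) Z)) := by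
  have hdf := smoothOneForm_mvfderiv hf
  have hH := hQ.smooth_hamiltonian hf
  refine ⟨smoothDual_evalField (hH.mlieBracket hZ), fun α hα x => ?_⟩
  have hQα := hQ.smooth α hα
  have h1 := koszul_apply hQ.smooth hdf hα hZ x
  have h2 := mvfderiv_mlieBracket hf hQα hZ x
  have h3 : (fun y => mvfderiv (𝓡 n) f y (Q y (α y))) =
      fun y => (-1) * α y (Q y (mvfderiv (𝓡 n) f y)) := by
    funext y
    rw [hQ.skew, neg_one_mul]
  have h4 := congrArg (fun L => L (Z x))
    (mvfderiv_const_mul_of_smooth (-1) (SmoothOneForm.apply hα hH) x)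
  rw [h3] at h2
  change α x (VectorField.mlieBracket (𝓡 n) (hamiltonian Q f) Z x) =
    mvfderiv (𝓡 n) (fun y => α y (Z y)) x (Q x (mvfderiv (𝓡 n) f x)) -
      koszul Q (mvfderiv (𝓡 n) f) α x (Z x)
  have h5 : mvfderiv (𝓡 n) (fun y => -1 * α y (Q y (mvfderiv (𝓡 n) f y))) x (Z x) =
      -1 * mvfderiv (𝓡 n) (fun y => α y (Q y (mvfderiv (𝓡 n) f y))) x (Z x) := h4
  have h6 : α x (VectorField.mlieBracket (𝓡 n) (hamiltonian Q f) Z x) =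
    α x (VectorField.mlieBracket (𝓡 n) (fun y => Q y (mvfderiv (𝓡 n) f y)) Z x) := rfl
  linarith

/-- The section `(θ, Y) ↦ μ(θ) μ(Y)` of `⋀^top A ⊗ ⋀^top T*M` for `A = T*M` and an `n`-form `μ` on
`M`, that is `μ ⊗ μ`. A form `θ` on `T*M` is read as a vector by `sharp`; `G` serves to re-index the
arguments by `Fin n`. -/
noncomputable def squareForm (G : TangentIso n (Model n →L[ℝ] ℝ)
    (fun x : M => TangentSpace (𝓡 n) x →L[ℝ] ℝ))
    (μ : Π x : M, TangentSpace (𝓡 n) x [⋀^Fin n]→ₗ[ℝ] ℝ) :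
    TopField n (Model n →L[ℝ] ℝ) (fun x : M => TangentSpace (𝓡 n) x →L[ℝ] ℝ) := fun x =>
  (LinearMap.toSpanSingleton ℝ _ (μ x)).compAlternatingMap
    (((μ x).compLinearMap (sharp x)).domDomCongr (finCongr G.finrank_eq.symm))

section Volume

variable {G : TangentIso n (Model n →L[ℝ] ℝ) (fun x : M => TangentSpace (𝓡 n) x →L[ℝ] ℝ)}
  {μ : Π x : M, TangentSpace (𝓡 n) x [⋀^Fin n]→ₗ[ℝ] ℝ}

theorem squareForm_apply (x : M) (θ : Fin (Module.finrank ℝ (Model n →L[ℝ] ℝ)) →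
    (TangentSpace (𝓡 n) x →L[ℝ] ℝ) →L[ℝ] ℝ) (Y : Fin n → TangentSpace (𝓡 n) x) :
    squareForm G μ x θ Y =
      μ x (fun i => sharp x (θ (finCongr G.finrank_eq.symm i))) * μ x Y := rfl

theorem squareForm_evalField (x : M) (Z : Fin n → VField n M)
    (Y : Fin n → TangentSpace (𝓡 n) x) :
    squareForm G μ x (fun i => evalField (Z (finCongr G.finrank_eq i)) x) Y =
      μ x (fun i => Z i x) * μ x Y := by
  rw [squareForm_apply]
  simp only [sharp_evalField]
  rfl

theorem squareForm_update (x : M) (Z : Fin n → VField n M) (W : VField n M)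
    (Y : Fin n → TangentSpace (𝓡 n) x) (i : Fin (Module.finrank ℝ (Model n →L[ℝ] ℝ))) :
    squareForm G μ x (Function.update (fun i => evalField (Z (finCongr G.finrank_eq i)) x) i
      (evalField W x)) Y =
      μ x (Function.update (fun i => Z i x) (finCongr G.finrank_eq i) (W x)) * μ x Y := by
  rw [squareForm_apply]
  congr 2
  funext j
  by_cases h : j = finCongr G.finrank_eq i
  · have h' : finCongr G.finrank_eq.symm j = i := by rw [h]; rfl
    rw [h', h, Function.update_self, Function.update_self, sharp_evalField]
  · have h' : finCongr G.finrank_eq.symm j ≠ i := fun e => h (by rw [← e]; rfl)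
    rw [Function.update_of_ne h', Function.update_of_ne h, sharp_evalField]
    rfl

theorem IsVolumeForm.exists_ne_zero (hμ : IsVolumeForm μ) (x : M) :
    ∃ Y : Fin n → VField n M, (∀ j, SmoothVField n (Y j)) ∧ μ x (fun j => Y j x) ≠ 0 := by
  have h1 : ∃ v, μ x v ≠ 0 := by
    by_contra! h
    exact hμ.1 x (AlternatingMap.ext h)
  obtain ⟨v, hv⟩ := h1
  choose Y hY hYv using fun j => exists_smoothVField_eq x (v j)
  exact ⟨Y, hY, by simpa only [hYv] using hv⟩

theorem IsVolumeForm.isNonvanishingTop (hμ : IsVolumeForm μ) :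
    IsNonvanishingTop (Model n →L[ℝ] ℝ) (squareForm G μ) := by
  refine ⟨fun x h => ?_, fun θ Y hθ hY => ?_⟩
  · obtain ⟨Y, hY, hne⟩ := hμ.exists_ne_zero x
    have h1 := squareForm_evalField (G := G) (μ := μ) x Y (fun j => Y j x)
    rw [h] at h1
    exact mul_ne_zero hne hne h1.symm
  · simp only [squareForm_apply]
    exact (hμ.2 (fun i x => sharp x (θ (finCongr G.finrank_eq.symm i) x))
      fun i => smoothVField_sharp (hθ _)).mul (hμ.2 Y hY)

/-- The modular section of `(T*M, Q)` for the square of a volume form is twice the divergence of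
hamiltonian vector fields. -/
theorem IsVolumeForm.two_mul_lieDerivTop (hμ : IsVolumeForm μ) {Q : BiField n M}
    (hQ : IsBivector Q) {ξ : Π x : M, (TangentSpace (𝓡 n) x →L[ℝ] ℝ) →L[ℝ] ℝ}
    (hξ : IsModularForm (Model n →L[ℝ] ℝ) (cotangentAlgebroid Q) (squareForm G μ) ξ)
    {f : M → ℝ} (hf : SmoothFun n f) {Y : Fin n → VField n M} (hY : ∀ j, SmoothVField n (Y j))
    (x : M) : 2 * lieDerivTop (hamiltonian Q f) μ Y x =
      ξ x (mvfderiv (𝓡 n) f x) * μ x (fun j => Y j x) := by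
  have key : ∀ Z Y : Fin n → VField n M, (∀ j, SmoothVField n (Z j)) →
      (∀ j, SmoothVField n (Y j)) →
      ξ x (mvfderiv (𝓡 n) f x) * (μ x (fun j => Z j x) * μ x (fun j => Y j x)) =
        lieDerivTop (hamiltonian Q f) μ Z x * μ x (fun j => Y j x) +
        μ x (fun j => Z j x) * lieDerivTop (hamiltonian Q f) μ Y x := by
    intro Z Y hZ hY
    have h1 := hξ (mvfderiv (𝓡 n) f) (fun i => evalField (Z (finCongr G.finrank_eq i)))
      (fun i => evalField (VectorField.mlieBracket (𝓡 n) (hamiltonian Q f)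
        (Z (finCongr G.finrank_eq i)))) Y (smoothOneForm_mvfderiv hf)
      (fun i => smoothDual_evalField (hZ _)) (fun i => hQ.isLieDerivDual_evalField hf (hZ _)) hY x
    simp only [squareForm_evalField, squareForm_update] at h1
    have h2 := Equiv.sum_comp (finCongr G.finrank_eq) fun i =>
      μ x (Function.update (fun j => Z j x) i
        (VectorField.mlieBracket (𝓡 n) (hamiltonian Q f) (Z i) x)) * μ x (fun j => Y j x)
    rw [h2, ← Finset.sum_mul, ← Finset.mul_sum] at h1
    have h3 := congrArg (fun L => L (hamiltonian Q f x))
      (mvfderiv_mul_of_smooth (hμ.2 Z hZ) (hμ.2 Y hY) x)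
    simp only [_root_.add_apply, _root_.smul_apply, smul_eq_mul] at h3
    rw [h1, lieDerivTop, lieDerivTop]
    change mvfderiv (𝓡 n) (fun y => μ y (fun j => Z j y) * μ y (fun j => Y j y)) x
      (hamiltonian Q f x) - _ - μ x (fun j => Z j x) * ∑ j, μ x (Function.update (fun j => Y j x) j
          (VectorField.mlieBracket (𝓡 n) (hamiltonian Q f) (Y j) x)) = _
    rw [h3]
    ring
  obtain ⟨Z, hZ, hne⟩ := hμ.exists_ne_zero x
  -- The case `Y = Z` computes the divergence, and then the case of a general `Y` follows.
  have h1 := key Z Z hZ hZ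
  have h2 := key Z Y hZ hY
  have h3 : 2 * lieDerivTop (hamiltonian Q f) μ Z x =
      ξ x (mvfderiv (𝓡 n) f x) * μ x (fun j => Z j x) := by
    refine mul_right_cancel₀ hne ?_
    linear_combination -h1
  refine mul_left_cancel₀ hne ?_
  linear_combination (-2) * h2 + μ x (fun j => Y j x) * (-h3)

/-- The modular vector field for `μ` is half the modular section for `μ ⊗ μ`. -/
theorem IsVolumeForm.isModularVField_iff (hμ : IsVolumeForm μ) {Q : BiField n M}
    (hQ : IsBivector Q) {ξ : Π x : M, (TangentSpace (𝓡 n) x →L[ℝ] ℝ) →L[ℝ] ℝ}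
    (hξ : IsModularForm (Model n →L[ℝ] ℝ) (cotangentAlgebroid Q) (squareForm G μ) ξ)
    (hξs : SmoothDual n (Model n →L[ℝ] ℝ) ξ) (Z : VField n M) :
    IsModularVField Q μ Z ↔ Z = fun x => (1 / 2 : ℝ) • sharp x (ξ x) := by
  have key : ∀ {f : M → ℝ} (_ : SmoothFun n f) (Y : Fin n → VField n M),
      (∀ j, SmoothVField n (Y j)) → ∀ x,
      mvfderiv (𝓡 n) f x ((1 / 2 : ℝ) • sharp x (ξ x)) * μ x (fun j => Y j x) =
        lieDerivTop (hamiltonian Q f) μ Y x := by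
    intro f hf Y hY x
    have h1 := hμ.two_mul_lieDerivTop hQ hξ hf hY x
    rw [map_smul, apply_sharp, smul_eq_mul]
    linarith
  constructor
  · rintro ⟨-, hZ⟩
    funext x
    obtain ⟨Y, hY, hne⟩ := hμ.exists_ne_zero x
    refine tangentVector_ext fun f hf => mul_right_cancel₀ hne ?_
    rw [key hf Y hY, hZ f Y hf hY]
  · rintro rfl
    exact ⟨ContMDiff.const_smul_section (a := (1 / 2 : ℝ)) (smoothVField_sharp hξs),
      fun f Y hf hY x => key hf Y hY x⟩

end Volume

/-- The modular vector fields of consecutive Poisson structures of the hierarchy. -/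
theorem IsPoissonNijenhuis.exists_modularVField [SigmaCompactSpace M] {P : BiField n M}
    {N : EndField n M} (h : IsPoissonNijenhuis P N) (k : ℕ)
    {μ : Π x : M, TangentSpace (𝓡 n) x [⋀^Fin n]→ₗ[ℝ] ℝ} (hμ : IsVolumeForm μ) :
    ∃ X Y : VField n M,
      (∀ Z, IsModularVField (hierarchy N P (k + 1)) μ Z ↔ Z = X) ∧
      (∀ Z, IsModularVField (hierarchy N P k) μ Z ↔ Z = Y) ∧
      (fun x => (2 : ℝ) • (X x - N x (Y x)))
        = negSharp P (mvfderiv (𝓡 n) (traceFun N (k + 1))) := by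
  obtain ⟨G⟩ := exists_cotangentIso n M
  choose ζ hζ using fun k => G.exists_isTraceForm (h.isPoissonBivector k).isLieAlgebroid
  obtain ⟨u, hu, hu0, heq⟩ := G.exists_eq_smul_topForm (hμ.isNonvanishingTop (G := G))
  -- The function `u` compares `μ ⊗ μ` with the reference section; it does not depend on `k`.
  let ξ : ℕ → Π x : M, (TangentSpace (𝓡 n) x →L[ℝ] ℝ) →L[ℝ] ℝ := fun k x =>
    ζ k x + (mvfderiv (𝓡 n) (fun y => Real.log (u y)) x).comp (hierarchy N P k x)
  have hξ : ∀ k, IsModularForm (Model n →L[ℝ] ℝ) (cotangentAlgebroid (hierarchy N P k))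
      (squareForm G μ) (ξ k) := fun k =>
    ((hζ k).isModularForm_iff (h.isPoissonBivector k).isLieAlgebroid hu hu0 heq).2 fun _ => rfl
  have hξs : ∀ k, SmoothDual n (Model n →L[ℝ] ℝ) (ξ k) := fun k α hα =>
    (((hζ k).mem_Z1 (h.isPoissonBivector k).isLieAlgebroid).1 α hα).add
      ((smoothFun_log hu hu0).mvfderiv_apply ((h.isBivector k).smooth α hα))
  refine ⟨_, _, hμ.isModularVField_iff (h.isBivector (k + 1)) (hξ (k + 1)) (hξs (k + 1)),
    hμ.isModularVField_iff (h.isBivector k) (hξ k) (hξs k), ?_⟩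
  funext x
  refine tangentVector_ext fun f _ => ?_
  have h1 : mvfderiv (𝓡 n) f x (N x (sharp x (ξ k x))) =
      ξ k x (transpose N x (mvfderiv (𝓡 n) f x)) :=
    apply_sharp (ξ k x) (transpose N x (mvfderiv (𝓡 n) f x))
  have h2 := h.traceForm_succ' k (hζ k) (hζ (k + 1)) x (mvfderiv (𝓡 n) f x)
  have h3 : mvfderiv (𝓡 n) f x (negSharp P (mvfderiv (𝓡 n) (traceFun N (k + 1))) x) =
      mvfderiv (𝓡 n) (traceFun N (k + 1)) x (P x (mvfderiv (𝓡 n) f x)) :=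
    evalField_negSharp h _ x (mvfderiv (𝓡 n) f x)
  have h4 := h.hierarchy_succ_apply' k x (mvfderiv (𝓡 n) f x)
  have h5 : ∀ j α, ξ j x α = ζ j x α +
      mvfderiv (𝓡 n) (fun y => Real.log (u y)) x (hierarchy N P j x α) := fun _ _ => rfl
  rw [h3, map_smul, map_sub, map_smul, map_smul, map_smul, apply_sharp, h1, h5, h5, h2, h4]
  simp only [smul_eq_mul]
  ring

end

end PNModular

theorem mainTheorem4 {n : ℕ} {M : Type*} [TopologicalSpace M] [T2Space M] [SigmaCompactSpace M]
    [ChartedSpace (Model n) M] [IsManifold (𝓡 n) ∞ M]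
    (P : BiField n M) (N : EndField n M) (hPN : IsPoissonNijenhuis P N) (k : ℕ) (hk : 1 ≤ k) :
    -- (i) the morphisms `N^k` and `ᵗN^k`
    (∃ (a : H1 (Model n) (tangentAlgebroid (npow N k)))
       (b : H1 (Model n →L[ℝ] ℝ) (cotangentAlgebroid (hierarchy N P k))),
      (∀ c, IsModularClassOfMorphism (Model n) (Model n) (tangentAlgebroid (npow N k))
        (tangentAlgebroid (fun _ => ContinuousLinearMap.id ℝ _)) (npow N k) c ↔ c = a) ∧
      (∀ c, IsModularClassOfMorphism (Model n →L[ℝ] ℝ) (Model n →L[ℝ] ℝ)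
        (cotangentAlgebroid (hierarchy N P k)) (cotangentAlgebroid P)
        (transpose (npow N k)) c ↔ c = b) ∧
      ∀ θ : OneForm n M, Represents (Model n) (tangentAlgebroid (npow N k)) θ a →
        Represents (Model n →L[ℝ] ℝ) (cotangentAlgebroid (hierarchy N P k))
          (evalField (negSharp P θ)) b) ∧
    -- (ii) the morphisms `N^{[k]}` and `ᵗN^{[k]}`
    (∃ (a : H1 (Model n) (tangentAlgebroid (npow N k)))
       (b : H1 (Model n →L[ℝ] ℝ) (cotangentAlgebroid (hierarchy N P k))),
      (∀ c, IsModularClassOfMorphism (Model n) (Model n) (tangentAlgebroid (npow N k))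
        (tangentAlgebroid (npow N (k - 1))) N c ↔ c = a) ∧
      (∀ c, IsModularClassOfMorphism (Model n →L[ℝ] ℝ) (Model n →L[ℝ] ℝ)
        (cotangentAlgebroid (hierarchy N P k)) (cotangentAlgebroid (hierarchy N P (k - 1)))
        (transpose N) c ↔ c = b) ∧
      (∀ θ : OneForm n M, Represents (Model n) (tangentAlgebroid (npow N k)) θ a →
        Represents (Model n →L[ℝ] ℝ) (cotangentAlgebroid (hierarchy N P k))
          (evalField (negSharp P θ)) b) ∧
      -- `-P d Tr(N^k / k)` represents the modular class of `ᵗN^{[k]}`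
      Represents (Model n →L[ℝ] ℝ) (cotangentAlgebroid (hierarchy N P k))
        (evalField (negSharp P (mvfderiv (𝓡 n) (traceFun N k)))) b ∧
      -- and it is equal to `2 X^{(k)} = 2 (X^k_μ - N X^{k-1}_μ)`, for every volume form `μ`
      ∀ μ : Π x : M, TangentSpace (𝓡 n) x [⋀^Fin n]→ₗ[ℝ] ℝ, IsVolumeForm μ →
        ∃ X Y : VField n M,
          (∀ Z, IsModularVField (hierarchy N P k) μ Z ↔ Z = X) ∧
          (∀ Z, IsModularVField (hierarchy N P (k - 1)) μ Z ↔ Z = Y) ∧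
          (fun x => (2 : ℝ) • (X x - N x (Y x)))
            = negSharp P (mvfderiv (𝓡 n) (traceFun N k))) := by
  obtain ⟨m, rfl⟩ : ∃ m, k = m + 1 := ⟨k - 1, (Nat.sub_add_cancel hk).symm⟩
  obtain ⟨a, b, ha, hb, hab, hrep⟩ := hPN.exists_modularClass_succ m
  exact ⟨hPN.exists_modularClass_npow (m + 1), a, b, ha, hb, hab, hrep,
    fun μ hμ => hPN.exists_modularVField m hμ⟩
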